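/- All graphs are finite and simple. A set $F$ of vertices of a graph $G$ is a *dissociation set* if the induced subgraph $G[F]$ has maximum degree at most $1$; it is a *maximal dissociation set* if it is not a proper subset of another dissociation set. Let $\phi(G)$ denote the number of maximal dissociation sets of $G$. Write $C_4$ for the cycle on $4$ vertices, $P_3$ for the path on $3$ vertices, $K_{a,b}$ for the complete bipartite graph with parts of sizes $a$ and $b$, $\cup$ for disjoint union, and $kG$ for the disjoint union of $k$ copies of $G$ (the graph with no vertices if $k=0$). **Theorem 5.2.** Let $n\ge 4$ and write $n=4t+r$ with $t\ge 1$ and $r\in\{0,1,2,3\}$. The maximum of $\phi(G)$ over all triangle-free graphs $G$ with $n$ vertices is $$ \begin{cases} 6^t & \text{if } n=4t,\\ 8\cdot 6^{t-1} & \text{if } n=4t+1,\\ 11\cdot 6^{t-1} & \text{if } n=4t+2,\\ 3\cdot 6^t & \text{if } n=4t+3. \end{cases} $$ Moreover, a triangle-free graph $G$ with $n$ vertices attains this maximum if and only if $$ G\cong \begin{cases} tC_4 & \text{if } n=4t,\\ K_{2,3}\cup (t-1)C_4 & \text{if } n=4t+1,\\ K_{3,3}\cup (t-1)C_4 & \text{if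 } n=4t+2,\\ P_3\cup tC_4 & \text{if } n=4t+3. \end{cases} $$ -/

import Mathlib

namespace DissociationSets

open Classical in
/-- `F` is a dissociation set of `G`: the induced subgraph `G[F]` has maximum degree at most `1`. -/
def IsDissociationSet {V : Type*} (G : SimpleGraph V) (F : Finset V) : Prop :=
  (G.induce (F : Set V)).maxDegree ≤ 1

/-- The set `MD(G)` of all maximal dissociation sets of `G` (maximal with respect to inclusion). -/
def maximalDissociationSets {V : Type*} (G : SimpleGraph V) : Set (Finset V) :=
  {F | Maximal (IsDissociationSet G) F}

/-- `φ(G)`, the number of maximal dissociation sets of a finite graph `G`. -/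
noncomputable def phi {V : Type*} [Finite V] (G : SimpleGraph V) : ℕ :=
  (maximalDissociationSets G).ncard

/-- The disjoint union of `k` copies of a graph `G` (the empty graph for `k = 0`). -/
def copies {W : Type*} (k : ℕ) (G : SimpleGraph W) : SimpleGraph (Fin k × W) where
  Adj x y := x.1 = y.1 ∧ G.Adj x.2 y.2
  symm := ⟨fun _ _ h => ⟨h.1.symm, h.2.symm⟩⟩
  loopless := ⟨fun _ h => h.2.ne rfl⟩

/-- The values `φ(G)`, as `G` ranges over the triangle-free graphs with vertex set `V`. -/
def triangleFreePhiValues (V : Type*) [Finite V] : Set ℕ :=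
  {m | ∃ G : SimpleGraph V, G.CliqueFree 3 ∧ phi G = m}

end DissociationSets

/-! Deciding the status of a few vertices splits the maximal dissociation sets into classes. A class
forces a set `I` in, forces a set `O` out, and allows no further neighbours of `I`. Deleting the
`zone` of decided vertices maps the class injectively into the maximal dissociation sets of a
smaller induced subgraph (`card_cls_le_ph`). Every local configuration thus yields a linear
recursion, and the theorem follows by strong induction on the vertex set from finitely many such
recursions.

A component K_{a,b} with a, b ≥ 2 has ab + 2 maximal dissociation sets: its edges and its two parts.
Hence a C_4 contributes a factor 6 for four vertices. The induction (`good`) proves more than the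
bound `Fz`: a graph is extremal (`Ext`) or lies strictly below `Kz`. The two sequences differ only
at orders divisible by 4, where `Kz` has a genuine gap, the factor 22/27. This gap is used when a
deletion leaves a graph of such an order.

Graphs without four-cycles obey the smaller bound `Bz` (`noC4_le`), which is below `Kz` from order 4
on. It is proved by a separate induction that distinguishes the small degrees.

If `v, a, w, b` is a four-cycle, every set contains an edge of it, or avoids {a, b}, or avoids {v,
w} (`IsC4.cover`). The edge classes are controlled by degrees. If the cycle has a vertex of degree
two, the avoiding classes can be described explicitly, and either a component C_4 or K_{2,3} splits
off or the count is strict. If all vertices on four-cycles have degree at least three (`Heavy`), the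
sets avoiding {a, b} are counted in `W \ {a, b}`. There the induction hypothesis is strict at the
critical residues, and vertices of degree three have become leaves, which lowers the bound to `Lz`
or `Dz`. Two situations remain, both at residue 2. If both opposite pairs have a common outer
neighbour, a K_{3,3} component or a strict bound results (`both_common_good`). If every four-cycle
is `Special`, two overlapping remainders cannot both be unions of four-cycles (`not_both_c4s`).

Conversely, the counts of components multiply (`ph_mul_le`, `Comp.le_ph`), so extremal graphs attain
`Fz`. -/

namespace DissociationSets
open Finset
set_option linter.unusedSectionVars false

/-! ### Classes of maximal dissociation sets and their zones -/

variable {V : Type*} [DecidableEq V] (G : SimpleGraph V) [DecidableRel G.Adj]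

/-- `F` spans a subgraph of maximum degree at most one. -/
def Diss (F : Finset V) : Prop := ∀ x ∈ F, #(F.filter (G.Adj x)) ≤ 1

/-- The neighbours of `x` inside `W`. -/
def nb (W : Finset V) (x : V) : Finset V := W.filter (G.Adj x)

open Classical in
/-- The maximal dissociation sets of the subgraph induced on `W`. -/
noncomputable def MD (W : Finset V) : Finset (Finset V) :=
  W.powerset.filter fun F => Diss G F ∧ ∀ y ∈ W, y ∉ F → ¬ Diss G (insert y F)

/-- The number of maximal dissociation sets of the subgraph induced on `W`. -/
noncomputable def ph (W : Finset V) : ℕ := #(MD G W)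

open Classical in
/-- Maximal dissociation sets containing `I`, and avoiding `O` and all further neighbours of `I`. -/
noncomputable def cls (W I O : Finset V) : Finset (Finset V) :=
  (MD G W).filter fun F => I ⊆ F ∧ ∀ z ∈ F, z ∉ I → (∀ i ∈ I, ¬ G.Adj i z) ∧ z ∉ O

/-- The vertices whose status is decided in the class `cls G W I O`. -/
def zone (W I O : Finset V) : Finset V :=
  W.filter fun z => z ∈ I ∨ (∃ i ∈ I, G.Adj i z) ∨ z ∈ O

variable {G}

lemma mem_nb {W : Finset V} {x y : V} : y ∈ nb G W x ↔ y ∈ W ∧ G.Adj x y := by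
  simp [nb]

lemma mem_zone {W I O : Finset V} {z : V} :
    z ∈ zone G W I O ↔ z ∈ W ∧ (z ∈ I ∨ (∃ i ∈ I, G.Adj i z) ∨ z ∈ O) := by
  simp [zone]

lemma mem_MD {W F : Finset V} : F ∈ MD G W ↔
    F ⊆ W ∧ Diss G F ∧ ∀ y ∈ W, y ∉ F → ¬ Diss G (insert y F) := by
  simp [MD]

lemma mem_cls {W I O F : Finset V} : F ∈ cls G W I O ↔
    F ∈ MD G W ∧ I ⊆ F ∧ ∀ z ∈ F, z ∉ I → (∀ i ∈ I, ¬ G.Adj i z) ∧ z ∉ O := by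
  simp [cls]

lemma Diss.mono {F F' : Finset V} (h : Diss G F) (hs : F' ⊆ F) : Diss G F' := fun x hx =>
  (card_le_card (filter_subset_filter _ hs)).trans (h x (hs hx))

lemma Diss.eq {F : Finset V} (h : Diss G F) {x y z : V} (hx : x ∈ F) (hy : y ∈ F) (hz : z ∈ F)
    (hxy : G.Adj x y) (hxz : G.Adj x z) : y = z :=
  card_le_one.1 (h x hx) y (by simp [hy, hxy]) z (by simp [hz, hxz])

lemma diss_iff {F : Finset V} : Diss G F ↔
    ∀ x ∈ F, ∀ y ∈ F, ∀ z ∈ F, G.Adj x y → G.Adj x z → y = z := by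
  constructor
  · intro h x hx y hy z hz h1 h2
    exact h.eq hx hy hz h1 h2
  · intro h x hx
    refine card_le_one.2 fun y hy z hz => ?_
    simp only [mem_filter] at hy hz
    exact h x hx y hy.1 z hz.1 hy.2 hz.2

/-- No vertex of `W` outside the zone is adjacent to `I`, so a vertex that could be added to `F \
zone` could be added to `F` as well: deleting the zone preserves maximality. It is injective on the
class because inside the zone `F` is exactly `I`. -/
lemma card_cls_le_ph (W I O : Finset V) :
    #(cls G W I O) ≤ ph G (W \ zone G W I O) := by
  refine card_le_card_of_injOn (fun F => F \ zone G W I O) ?_ ?_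
  · intro F hF
    obtain ⟨hMD, hIF, hcl⟩ := mem_cls.1 hF
    obtain ⟨hFW, hD, hmax⟩ := mem_MD.1 hMD
    refine mem_MD.2 ⟨sdiff_subset_sdiff hFW le_rfl, hD.mono sdiff_subset, ?_⟩
    intro y hy hyF hDy
    obtain ⟨hyW, hyZ⟩ := mem_sdiff.1 hy
    have hyF' : y ∉ F := fun h => hyF (mem_sdiff.2 ⟨h, hyZ⟩)
    refine hmax y hyW hyF' (diss_iff.2 ?_)
    have hyI : ∀ i ∈ I, ¬ G.Adj i y := fun i hi h =>
      hyZ (mem_zone.2 ⟨hyW, Or.inr (Or.inl ⟨i, hi, h⟩)⟩)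
    have key : ∀ z ∈ insert y F, z ∉ I → z ∈ insert y (F \ zone G W I O) ∧ ∀ i ∈ I, ¬ G.Adj i z := by
      intro z hz hzI
      rcases mem_insert.1 hz with rfl | hzF
      · exact ⟨mem_insert_self _ _, hyI⟩
      · refine ⟨mem_insert_of_mem (mem_sdiff.2 ⟨hzF, ?_⟩), (hcl z hzF hzI).1⟩
        intro h
        rcases (mem_zone.1 h).2 with h | ⟨i, hi, h⟩ | h
        · exact hzI h
        · exact (hcl z hzF hzI).1 i hi h
        · exact (hcl z hzF hzI).2 h
    have keyI : ∀ x ∈ I, ∀ u ∈ insert y F, G.Adj x u → u ∈ F := by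
      intro x hx u hu h
      rcases mem_insert.1 hu with rfl | hu
      · exact absurd h (hyI x hx)
      · exact hu
    intro x hx u hu w hw hxu hxw
    by_cases hxI : x ∈ I
    · exact hD.eq (hIF hxI) (keyI x hxI u hu hxu) (keyI x hxI w hw hxw) hxu hxw
    · have hx' := key x hx hxI
      have hu' := key u hu (fun h => hx'.2 u h hxu.symm)
      have hw' := key w hw (fun h => hx'.2 w h hxw.symm)
      exact diss_iff.1 hDy x hx'.1 u hu'.1 w hw'.1 hxu hxw
  · intro F hF F' hF' h
    have aux : ∀ F ∈ cls G W I O, F = (F \ zone G W I O) ∪ I := by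
      intro F hF
      obtain ⟨hMD, hIF, hcl⟩ := mem_cls.1 hF
      ext z
      simp only [mem_union, mem_sdiff]
      constructor
      · intro hz
        by_cases hzI : z ∈ I
        · exact Or.inr hzI
        · refine Or.inl ⟨hz, fun h => ?_⟩
          rcases (mem_zone.1 h).2 with h | ⟨i, hi, h⟩ | h
          · exact hzI h
          · exact (hcl z hz hzI).1 i hi h
          · exact (hcl z hz hzI).2 h
      · rintro (h | h)
        · exact h.1
        · exact hIF h
    rw [aux F hF, aux F' hF']
    simp only at h
    rw [h]

lemma card_sdiff_zone {W I O T : Finset V} {k : ℕ}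
    (hT : ∀ z ∈ T, z ∈ W ∧ (z ∈ I ∨ (∃ i ∈ I, G.Adj i z) ∨ z ∈ O)) (hk : k ≤ #T) :
    ((#(W \ zone G W I O) : ℕ) : ℤ) ≤ #W - k := by
  have h1 : T ⊆ zone G W I O := fun z hz => mem_zone.2 (hT z hz)
  have h2 := card_le_card h1
  have h3 : zone G W I O ⊆ W := filter_subset _ _
  have h4 := card_sdiff_add_card_eq_card h3
  omega

/-- The counting bound `f` holds for all proper subsets of `W`. -/
def Bdd (G : SimpleGraph V) [DecidableRel G.Adj] (f : ℤ → ℚ) (W : Finset V) : Prop :=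
  Monotone f ∧ ∀ W' ⊂ W, (ph G W' : ℚ) ≤ f #W'

/-- The form in which all recursions are obtained: `T` exhibits `k` decided vertices. It must be
nonempty so that the induction hypothesis applies to a proper subset. -/
lemma cls_le {f : ℤ → ℚ} {W : Finset V} (hf : Bdd G f W) (I O T : Finset V) (k : ℕ)
    (hT : ∀ z ∈ T, z ∈ W ∧ (z ∈ I ∨ (∃ i ∈ I, G.Adj i z) ∨ z ∈ O)) (hk : k ≤ #T)
    (h0 : 0 < #T) : (#(cls G W I O) : ℚ) ≤ f (#W - k) := by
  have h1 : T ⊆ zone G W I O := fun z hz => mem_zone.2 (hT z hz)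
  obtain ⟨z, hz⟩ := card_pos.1 h0
  have hss : W \ zone G W I O ⊂ W :=
    sdiff_ssubset (filter_subset _ _) ⟨z, h1 hz⟩
  calc (#(cls G W I O) : ℚ) ≤ ph G (W \ zone G W I O) := by exact_mod_cast card_cls_le_ph W I O
    _ ≤ f #(W \ zone G W I O) := hf.2 _ hss
    _ ≤ _ := hf.1 (card_sdiff_zone hT hk)

lemma Bdd.subset {f : ℤ → ℚ} {W W' : Finset V} (hf : Bdd G f W) (h : W' ⊆ W) : Bdd G f W' :=
  ⟨hf.1, fun _ h' => hf.2 _ (h'.trans_subset h)⟩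

lemma biUnion_le {X : Finset V} {g : V → Finset (Finset V)} {c : ℚ}
    (h : ∀ x ∈ X, (#(g x) : ℚ) ≤ c) : (#(X.biUnion g) : ℚ) ≤ #X * c := by
  calc (#(X.biUnion g) : ℚ) ≤ ((∑ x ∈ X, #(g x) : ℕ) : ℚ) := by exact_mod_cast card_biUnion_le
    _ = ∑ x ∈ X, (#(g x) : ℚ) := by push_cast; rfl
    _ ≤ ∑ x ∈ X, c := sum_le_sum h
    _ = #X * c := by simp

/-! ### Status of a vertex with respect to a maximal dissociation set -/

section status
variable {W F I O I' O' : Finset V} {x y z : V}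

lemma cls_MD (h : F ∈ cls G W I O) : F ∈ MD G W := (mem_cls.1 h).1
lemma MD_sub (h : F ∈ MD G W) : F ⊆ W := (mem_MD.1 h).1
lemma cls_in (h : F ∈ cls G W I O) (hx : x ∈ I) : x ∈ F := (mem_cls.1 h).2.1 hx
lemma cls_adj (h : F ∈ cls G W I O) (hx : x ∈ I) (hxz : G.Adj x z) (hz : z ∉ I) : z ∉ F :=
  fun hzF => ((mem_cls.1 h).2.2 z hzF hz).1 x hx hxz
lemma cls_out (h : F ∈ cls G W I O) (hx : x ∈ O) (hz : x ∉ I) : x ∉ F :=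
  fun hzF => ((mem_cls.1 h).2.2 x hzF hz).2 hx

lemma cls_union (h : F ∈ cls G W I O) (h' : F ∈ cls G W I' O') :
    F ∈ cls G W (I ∪ I') (O ∪ O') := by
  obtain ⟨a, b, c⟩ := mem_cls.1 h
  obtain ⟨a', b', c'⟩ := mem_cls.1 h'
  refine mem_cls.2 ⟨a, union_subset b b', fun z hz hzI => ?_⟩
  rw [mem_union, not_or] at hzI
  refine ⟨fun i hi => ?_, ?_⟩
  · rcases mem_union.1 hi with hi | hi
    · exact (c z hz hzI.1).1 i hi
    · exact (c' z hz hzI.2).1 i hi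
  · rw [mem_union, not_or]
    exact ⟨(c z hz hzI.1).2, (c' z hz hzI.2).2⟩

lemma cls_congr (h : F ∈ cls G W I O) (hI : I = I') (hO : O = O') : F ∈ cls G W I' O' := by
  subst hI; subst hO; exact h

lemma out_cls (hF : F ∈ MD G W) (h : ∀ x ∈ O, x ∉ F) : F ∈ cls G W ∅ O :=
  mem_cls.2 ⟨hF, empty_subset _, fun z hz _ => ⟨by simp, fun hzO => h z hzO hz⟩⟩

/-- An edge inside `F` saturates both of its ends, so no other member of `F` is adjacent to either.
This is what allows an edge to serve as `I`. -/
lemma pair_cls (hF : F ∈ MD G W) (hx : x ∈ F) (hy : y ∈ F) (hxy : G.Adj x y) :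
    F ∈ cls G W {x, y} ∅ := by
  have hD := (mem_MD.1 hF).2.1
  refine mem_cls.2 ⟨hF, by intro z; simp; rintro (rfl | rfl) <;> assumption, ?_⟩
  intro z hz hzI
  refine ⟨fun i hi hiz => ?_, by simp⟩
  simp only [mem_insert, mem_singleton, not_or] at hi hzI
  rcases hi with rfl | rfl
  · exact hzI.2 (hD.eq hx hz hy hiz hxy)
  · exact hzI.1 (hD.eq hy hz hx hiz hxy.symm)

lemma single_cls (hF : F ∈ MD G W) (hx : x ∈ F) (h : ∀ y ∈ F, ¬ G.Adj x y) :
    F ∈ cls G W {x} ∅ := by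
  refine mem_cls.2 ⟨hF, by simpa using hx, fun z hz _ => ⟨?_, by simp⟩⟩
  intro i hi; rw [mem_singleton] at hi; subst hi; exact h z hz

lemma in_cases (hF : F ∈ MD G W) (hx : x ∈ F) :
    F ∈ cls G W {x} ∅ ∨ ∃ y ∈ nb G W x, y ∈ F ∧ F ∈ cls G W {x, y} ∅ := by
  by_cases h : ∃ y ∈ F, G.Adj x y
  · obtain ⟨y, hy, hxy⟩ := h
    exact Or.inr ⟨y, mem_nb.2 ⟨MD_sub hF hy, hxy⟩, hy, pair_cls hF hx hy hxy⟩
  · push Not at h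
    exact Or.inl (single_cls hF hx h)

/-- A vertex outside a maximal dissociation set is blocked. -/
lemma blocked (hF : F ∈ MD G W) (hx : x ∈ W) (hxF : x ∉ F) :
    (∃ y ∈ F, ∃ z ∈ F, y ≠ z ∧ G.Adj x y ∧ G.Adj x z) ∨
      ∃ y ∈ F, G.Adj x y ∧ ∃ z ∈ F, G.Adj y z := by
  by_contra hcon
  push Not at hcon
  obtain ⟨h1, h2⟩ := hcon
  obtain ⟨_, hD, hmax⟩ := mem_MD.1 hF
  refine hmax x hx hxF (diss_iff.2 ?_)
  intro a ha b hb c hc hab hac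
  rcases mem_insert.1 ha with rfl | haF
  · have hb' : b ∈ F := (mem_insert.1 hb).resolve_left (fun h => hab.ne h.symm)
    have hc' : c ∈ F := (mem_insert.1 hc).resolve_left (fun h => hac.ne h.symm)
    by_contra hne
    exact h1 b hb' c hc' hne hab hac
  · rcases mem_insert.1 hb with rfl | hbF
    · rcases mem_insert.1 hc with rfl | hcF
      · rfl
      · exact absurd hac (h2 a haF hab.symm c hcF)
    · rcases mem_insert.1 hc with rfl | hcF
      · exact absurd hab (h2 a haF hac.symm b hbF)
      · exact hD.eq haF hbF hcF hab hac

lemma mem_of_free (hF : F ∈ MD G W) (hx : x ∈ W) (h : ∀ y ∈ F, ¬ G.Adj x y) : x ∈ F := by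
  by_contra hx'
  rcases blocked hF hx hx' with ⟨y, hy, _, _, _, h1, _⟩ | ⟨y, hy, h1, _⟩ <;> exact h y hy h1

end status

/-! ### The periodic numerical bounds -/

/-- The values `a, b, c, d` repeated with period `4`, scaled by `6` in each period. -/
def quad (a b c d : ℚ) (n : ℤ) : ℚ :=
  (if n % 4 = 0 then a else if n % 4 = 1 then b else if n % 4 = 2 then c else d) * 6 ^ (n / 4)

/-- The largest number of maximal dissociation sets of a triangle-free graph of order `n`. -/
def Fz : ℤ → ℚ := quad 1 (4 / 3) (11 / 6) 3

/-- Non-extremal graphs stay below this value. -/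
def Kz : ℤ → ℚ := quad (22 / 27) (4 / 3) (11 / 6) 3

/-- A bound for graphs with a vertex of degree at most one. -/
def Lz : ℤ → ℚ := quad (25 / 36) (19 / 18) (65 / 36) 3

/-- A bound for graphs without four-cycles that have at least five vertices. -/
def Gz : ℤ → ℚ := quad (149 / 200) (7 / 6) (913 / 500) (1429 / 500)

/-- A bound for graphs without four-cycles. -/
def Bz (n : ℤ) : ℚ :=
  if n < 0 then 0 else if n ≤ 2 then 1 else if n = 3 then 3 else if n = 4 then 4 else Gz n

lemma quad_shift (a b c d : ℚ) (n : ℤ) : quad a b c d (n - 4) = quad a b c d n / 6 := by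
  have h1 : (n - 4) % 4 = n % 4 := by omega
  have h2 : (n - 4) / 4 = n / 4 - 1 := by omega
  rw [quad, quad, h1, h2, zpow_sub_one₀ (by norm_num)]
  ring

/-- Values at distance 4 to 15 are reduced to the four values near `n`, which `quad_cases` expresses
through a single positive factor. Each numerical inequality then becomes linear in that factor, one
for each residue. -/
lemma quad_far (n : ℤ) (a b c d : ℚ) :
    quad a b c d (n - 4) = quad a b c d n / 6 ∧
    quad a b c d (n - 5) = quad a b c d (n - 1) / 6 ∧
    quad a b c d (n - 6) = quad a b c d (n - 2) / 6 ∧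
    quad a b c d (n - 7) = quad a b c d (n - 3) / 6 ∧
    quad a b c d (n - 8) = quad a b c d n / 36 ∧
    quad a b c d (n - 9) = quad a b c d (n - 1) / 36 ∧
    quad a b c d (n - 10) = quad a b c d (n - 2) / 36 ∧
    quad a b c d (n - 11) = quad a b c d (n - 3) / 36 ∧
    quad a b c d (n - 12) = quad a b c d n / 216 ∧
    quad a b c d (n - 13) = quad a b c d (n - 1) / 216 ∧
    quad a b c d (n - 14) = quad a b c d (n - 2) / 216 ∧
    quad a b c d (n - 15) = quad a b c d (n - 3) / 216 := by
  have h : ∀ k, quad a b c d (n - (k + 4)) = quad a b c d (n - k) / 6 := fun k => by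
    rw [← quad_shift]; ring_nf
  have h0 := h 0; have h1 := h 1; have h2 := h 2; have h3 := h 3; have h4 := h 4
  have h5 := h 5; have h6 := h 6; have h7 := h 7; have h8 := h 8; have h9 := h 9
  have h10 := h 10; have h11 := h 11
  norm_num at h0 h1 h2 h3 h4 h5 h6 h7 h8 h9 h10 h11
  refine ⟨?_, ?_, ?_, ?_, ?_, ?_, ?_, ?_, ?_, ?_, ?_, ?_⟩ <;> linarith

/-- The values of the periodic sequences near `n`, in terms of a common positive factor. -/
lemma quad_cases (n : ℤ) : ∃ s : ℚ, 0 < s ∧ (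
    (n % 4 = 0 ∧ ∀ a b c d, quad a b c d n = a * s ∧ quad a b c d (n - 1) = d / 6 * s ∧
      quad a b c d (n - 2) = c / 6 * s ∧ quad a b c d (n - 3) = b / 6 * s) ∨
    (n % 4 = 1 ∧ ∀ a b c d, quad a b c d n = b * s ∧ quad a b c d (n - 1) = a * s ∧
      quad a b c d (n - 2) = d / 6 * s ∧ quad a b c d (n - 3) = c / 6 * s) ∨
    (n % 4 = 2 ∧ ∀ a b c d, quad a b c d n = c * s ∧ quad a b c d (n - 1) = b * s ∧
      quad a b c d (n - 2) = a * s ∧ quad a b c d (n - 3) = d / 6 * s) ∨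
    (n % 4 = 3 ∧ ∀ a b c d, quad a b c d n = d * s ∧ quad a b c d (n - 1) = c * s ∧
      quad a b c d (n - 2) = b * s ∧ quad a b c d (n - 3) = a * s)) := by
  refine ⟨6 ^ (n / 4), by positivity, ?_⟩
  have e : (6 : ℚ) ^ (n / 4 - 1) = 6 ^ (n / 4) / 6 := zpow_sub_one₀ (by norm_num) _
  have h : n % 4 = 0 ∨ n % 4 = 1 ∨ n % 4 = 2 ∨ n % 4 = 3 := by omega
  rcases h with h | h | h | h
  · have h1 : (n - 1) % 4 = 3 ∧ (n - 1) / 4 = n / 4 - 1 := by omega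
    have h2 : (n - 2) % 4 = 2 ∧ (n - 2) / 4 = n / 4 - 1 := by omega
    have h3 : (n - 3) % 4 = 1 ∧ (n - 3) / 4 = n / 4 - 1 := by omega
    refine Or.inl ⟨h, fun a b c d => ?_⟩
    norm_num [quad, h, h1, h2, h3, e]
    refine ⟨?_, ?_, ?_⟩ <;> ring
  · have h1 : (n - 1) % 4 = 0 ∧ (n - 1) / 4 = n / 4 := by omega
    have h2 : (n - 2) % 4 = 3 ∧ (n - 2) / 4 = n / 4 - 1 := by omega
    have h3 : (n - 3) % 4 = 2 ∧ (n - 3) / 4 = n / 4 - 1 := by omega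
    refine Or.inr <| Or.inl ⟨h, fun a b c d => ?_⟩
    norm_num [quad, h, h1, h2, h3, e]
    refine ⟨?_, ?_⟩ <;> ring
  · have h1 : (n - 1) % 4 = 1 ∧ (n - 1) / 4 = n / 4 := by omega
    have h2 : (n - 2) % 4 = 0 ∧ (n - 2) / 4 = n / 4 := by omega
    have h3 : (n - 3) % 4 = 3 ∧ (n - 3) / 4 = n / 4 - 1 := by omega
    refine Or.inr <| Or.inr <| Or.inl ⟨h, fun a b c d => ?_⟩
    norm_num [quad, h, h1, h2, h3, e]
    ring
  · have h1 : (n - 1) % 4 = 2 ∧ (n - 1) / 4 = n / 4 := by omega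
    have h2 : (n - 2) % 4 = 1 ∧ (n - 2) / 4 = n / 4 := by omega
    have h3 : (n - 3) % 4 = 0 ∧ (n - 3) / 4 = n / 4 := by omega
    refine Or.inr <| Or.inr <| Or.inr ⟨h, fun a b c d => ?_⟩
    norm_num [quad, h, h1, h2, h3]

lemma quad_mono {a b c d : ℚ} (h : a ≤ b ∧ b ≤ c ∧ c ≤ d ∧ d ≤ 6 * a) : Monotone (quad a b c d) := by
  refine monotone_int_of_le_succ fun n => ?_
  obtain ⟨s, hs, hc⟩ := quad_cases (n + 1)
  rw [show n = n + 1 - 1 by ring, show n + 1 - 1 + 1 = n + 1 by ring]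
  rcases hc with hc | hc | hc | hc <;> simp only [hc] <;> nlinarith

lemma Fz_mono : Monotone Fz := quad_mono (by norm_num)
lemma Lz_mono : Monotone Lz := quad_mono (by norm_num)
lemma Gz_mono : Monotone Gz := quad_mono (by norm_num)

lemma Fz_pos (n : ℤ) : 0 < Fz n := by
  obtain ⟨s, hs, hc⟩ := quad_cases n
  rcases hc with hc | hc | hc | hc <;> simp only [Fz, hc] <;> linarith

lemma Kz_le_Fz (n : ℤ) : Kz n ≤ Fz n := by
  obtain ⟨s, hs, hc⟩ := quad_cases n
  rcases hc with hc | hc | hc | hc <;> simp only [Fz, Kz, hc] <;> linarith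

lemma Gz_le_Fz (n : ℤ) : Gz n ≤ Fz n := by
  obtain ⟨s, hs, hc⟩ := quad_cases n
  rcases hc with hc | hc | hc | hc <;> simp only [Fz, Gz, hc] <;> linarith

lemma Gz_lt_Kz (n : ℤ) : Gz n < Kz n := by
  obtain ⟨s, hs, hc⟩ := quad_cases n
  rcases hc with hc | hc | hc | hc <;> simp only [Kz, Gz, hc] <;> linarith

/-- The worst ratio of consecutive values is from residue 0 to residue 1, where it is 1 to 4/3. -/
lemma Fz_pred (n : ℤ) : Fz (n - 1) ≤ 3 / 4 * Fz n := by
  obtain ⟨s, hs, hc⟩ := quad_cases n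
  rcases hc with hc | hc | hc | hc <;> simp only [Fz, hc] <;> linarith

/-- Passing from `p` to `p + 1` multiplies the left side by at most (p + 1)/p · 3/4, which is at
most 1 exactly from `p = 3` on. A vertex of large degree therefore gives no more than one of a fixed
moderate degree, and only finitely many degrees need to be examined. -/
lemma mul_Fz_le (m : ℤ) (k p : ℕ) (hk : 3 ≤ k) (h : k ≤ p) : p * Fz (m - p) ≤ k * Fz (m - k) := by
  induction p, h using Nat.le_induction with
  | base => rfl
  | succ p hp ih =>
    refine le_trans ?_ ih
    have h1 := Fz_pred (m - p)
    have h2 : (3 : ℚ) ≤ p := by exact_mod_cast hk.trans hp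
    have h3 := Fz_pos (m - p)
    push_cast
    rw [show m - ((p : ℤ) + 1) = m - p - 1 by ring]
    nlinarith

lemma Bz_le_Fz (n : ℤ) : Bz n ≤ Fz n := by
  rcases lt_or_ge n 0 with h | h
  · simpa [Bz, h] using (Fz_pos n).le
  rcases lt_or_ge n 5 with h5 | h5
  · interval_cases n <;> norm_num [Bz, Fz, quad]
  · rw [Bz, if_neg (by omega), if_neg (by omega), if_neg (by omega), if_neg (by omega)]
    exact Gz_le_Fz n

lemma Bz_eq {n : ℤ} (h : 5 ≤ n) : Bz n = Gz n := by
  rw [Bz, if_neg (by omega), if_neg (by omega), if_neg (by omega), if_neg (by omega)]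

lemma Bz_lt_Kz {n : ℤ} (h : 4 ≤ n) : Bz n < Kz n := by
  rcases h.eq_or_lt with rfl | h
  · norm_num [Bz, Kz, quad]
  · rw [Bz_eq h]; exact Gz_lt_Kz n

lemma Bz_mono : Monotone Bz := by
  refine monotone_int_of_le_succ fun n => ?_
  rcases lt_or_ge n (-1) with h | h
  · rw [Bz, if_pos (by omega), Bz, if_pos (by omega)]
  rcases lt_or_ge n 5 with h5 | h5
  · interval_cases n <;> norm_num [Bz, Gz, quad]
  · rw [Bz_eq h5, Bz_eq (by omega)]
    exact Gz_mono (by omega)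

lemma Bz_nonneg (n : ℤ) : 0 ≤ Bz n := by
  rcases lt_or_ge n 0 with h | h
  · simp [Bz, h]
  · calc (0 : ℚ) ≤ Bz 0 := by norm_num [Bz]
      _ ≤ _ := Bz_mono h

/-! ### Recursions around a vertex of a triangle-free graph -/

/-- `G` has no triangles. -/
def TF (G : SimpleGraph V) : Prop := ∀ x y z, G.Adj x y → G.Adj y z → ¬ G.Adj x z

/-- The vertices in `W` span no four-cycle. -/
def NoC4 (G : SimpleGraph V) (W : Finset V) : Prop :=
  ∀ v ∈ W, ∀ w ∈ W, ∀ a ∈ W, ∀ b ∈ W, v ≠ w → G.Adj v a → G.Adj w a → G.Adj v b → G.Adj w b → a = b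

lemma NoC4.subset {W W' : Finset V} (h : NoC4 G W) (hs : W' ⊆ W) : NoC4 G W' :=
  fun v hv w hw a ha b hb => h v (hs hv) w (hs hw) a (hs ha) b (hs hb)

lemma cu {A B : Finset (Finset V)} {x y : ℚ} (h1 : (#A : ℚ) ≤ x) (h2 : (#B : ℚ) ≤ y) :
    (#(A ∪ B) : ℚ) ≤ x + y :=
  (by exact_mod_cast card_union_le A B : (#(A ∪ B) : ℚ) ≤ #A + #B).trans (add_le_add h1 h2)

lemma ph_le_of_cover {W : Finset V} {S : Finset (Finset V)} {x : ℚ} (h : ∀ F ∈ MD G W, F ∈ S)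
    (hS : (#S : ℚ) ≤ x) : (ph G W : ℚ) ≤ x :=
  (by exact_mod_cast card_le_card h : (ph G W : ℚ) ≤ #S).trans hS

lemma card_two_le_exists {s : Finset V} (h : 2 ≤ #s) (x : V) : ∃ y ∈ s, y ≠ x := by
  by_contra hcon
  push Not at hcon
  have := card_le_card (show s ⊆ {x} from fun y hy => mem_singleton.2 (hcon y hy))
  simp at this
  omega

lemma ph_out_le {W : Finset V} (O : Finset V) (hO : O ⊆ W) : #(cls G W ∅ O) ≤ ph G (W \ O) := by
  have h := card_cls_le_ph (G := G) W ∅ O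
  have : zone G W ∅ O = O := by
    ext z; simp only [mem_zone, notMem_empty, false_and, exists_false, false_or]
    exact ⟨fun h => h.2, fun h => ⟨hO h, h⟩⟩
  rwa [this] at h

/-- Adjacent vertices of a triangle-free graph have disjoint neighbourhoods, and each end lies in
the neighbourhood of the other. So an edge class decides as many vertices as the sum of the two
degrees. -/
lemma pair_le {f : ℤ → ℚ} {W : Finset V} (hf : Bdd G f W) (ht : TF G) {x y : V} (hx : x ∈ W)
    (hy : y ∈ W) (hxy : G.Adj x y) (k : ℕ) (hk : k ≤ #(nb G W x) + #(nb G W y)) :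
    (#(cls G W {x, y} ∅) : ℚ) ≤ f (#W - k) := by
  refine cls_le hf _ _ (nb G W x ∪ nb G W y) k ?_ ?_ ?_
  · intro z hz
    rcases mem_union.1 hz with hz | hz <;> rw [mem_nb] at hz
    · exact ⟨hz.1, Or.inr (Or.inl ⟨x, by simp, hz.2⟩)⟩
    · exact ⟨hz.1, Or.inr (Or.inl ⟨y, by simp, hz.2⟩)⟩
  · rw [card_union_of_disjoint]
    · exact hk
    · rw [disjoint_left]
      intro z h1 h2
      exact ht x z y (mem_nb.1 h1).2 (mem_nb.1 h2).2.symm hxy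
  · exact card_pos.2 ⟨y, mem_union_left _ (mem_nb.2 ⟨hy, hxy⟩)⟩

lemma single_le {f : ℤ → ℚ} {W : Finset V} (hf : Bdd G f W) {x : V} (hx : x ∈ W)
    (k : ℕ) (hk : k ≤ #(nb G W x) + 1) :
    (#(cls G W {x} ∅) : ℚ) ≤ f (#W - k) := by
  refine cls_le hf _ _ (insert x (nb G W x)) k ?_ ?_ ?_
  · intro z hz
    rcases mem_insert.1 hz with rfl | hz
    · exact ⟨hx, Or.inl (by simp)⟩
    · rw [mem_nb] at hz
      exact ⟨hz.1, Or.inr (Or.inl ⟨x, by simp, hz.2⟩)⟩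
  · rw [card_insert_of_notMem]
    · exact hk
    · simp [mem_nb]
  · exact card_pos.2 ⟨x, mem_insert_self _ _⟩

lemma isolated_le {f : ℤ → ℚ} {W : Finset V} (hf : Bdd G f W) {v : V} (hv : v ∈ W)
    (h : nb G W v = ∅) : (ph G W : ℚ) ≤ f (#W - 1) := by
  refine ph_le_of_cover (S := cls G W {v} ∅) ?_ (single_le hf hv 1 (by omega))
  intro F hF
  have hn : ∀ y ∈ F, ¬ G.Adj v y := fun y hy hvy => by
    have : y ∈ nb G W v := mem_nb.2 ⟨MD_sub hF hy, hvy⟩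
    simp [h] at this
  exact single_cls hF (mem_of_free hF hv hn) hn

/-- A component consisting of a single edge. -/
lemma edge_component_le {f : ℤ → ℚ} {W : Finset V} (hf : Bdd G f W) (ht : TF G) {v u : V}
    (hv : nb G W v = {u}) (hu : nb G W u = {v}) : (ph G W : ℚ) ≤ f (#W - 2) := by
  have huv : u ∈ W ∧ G.Adj v u := mem_nb.1 (hv ▸ mem_singleton_self u)
  have hvu : v ∈ W ∧ G.Adj u v := mem_nb.1 (hu ▸ mem_singleton_self v)
  have hv' : ∀ y ∈ W, G.Adj v y → y = u := fun y hy h => by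
    have : y ∈ nb G W v := mem_nb.2 ⟨hy, h⟩
    simpa [hv] using this
  have hu' : ∀ y ∈ W, G.Adj u y → y = v := fun y hy h => by
    have : y ∈ nb G W u := mem_nb.2 ⟨hy, h⟩
    simpa [hu] using this
  refine ph_le_of_cover (S := cls G W {v, u} ∅) ?_
    (by exact_mod_cast pair_le hf ht hvu.1 huv.1 huv.2 2 (by simp [hv, hu]))
  intro F hF
  have h1 : v ∈ F := by
    by_contra hvF
    rcases blocked hF hvu.1 hvF with ⟨y, hy, z, hz, hne, h1, h2⟩ | ⟨y, hy, h1, z, hz, h2⟩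
    · exact hne ((hv' y (MD_sub hF hy) h1).trans (hv' z (MD_sub hF hz) h2).symm)
    · obtain rfl := hv' y (MD_sub hF hy) h1
      obtain rfl := hu' z (MD_sub hF hz) h2
      exact hvF hz
  have h2 : u ∈ F := by
    by_contra huF
    rcases blocked hF huv.1 huF with ⟨y, hy, z, hz, hne, h1, h2⟩ | ⟨y, hy, h1, z, hz, h2⟩
    · exact hne ((hu' y (MD_sub hF hy) h1).trans (hu' z (MD_sub hF hz) h2).symm)
    · obtain rfl := hu' y (MD_sub hF hy) h1
      obtain rfl := hv' z (MD_sub hF hz) h2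
      exact huF hz
  exact pair_cls hF h1 h2 huv.2

/-- The bound obtained from a set `L` of leaves adjacent to the same vertex `u`. -/
lemma leaves_le {f : ℤ → ℚ} {W : Finset V} (hf : Bdd G f W) (ht : TF G) {u : V} {L : Finset V}
    (hu : u ∈ W) (hL : L ⊆ nb G W u) (hL0 : L.Nonempty) (hleaf : ∀ x ∈ L, nb G W x = {u}) {k : ℕ}
    (hk : ∀ x ∈ nb G W u, x ∉ L → k ≤ #(nb G W x)) :
    (ph G W : ℚ) ≤ f (#W - (1 + #L : ℕ)) + (#L * f (#W - (1 + #(nb G W u) : ℕ)) +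
      (#(nb G W u) - #L : ℕ) * f (#W - (k + #(nb G W u) : ℕ))) := by
  have hleaf' : ∀ x ∈ L, ∀ y ∈ W, G.Adj x y → y = u := fun x hx y hy h => by
    have : y ∈ nb G W x := mem_nb.2 ⟨hy, h⟩
    simpa [hleaf x hx] using this
  refine ph_le_of_cover (S := cls G W L ∅ ∪ (L.biUnion (fun x => cls G W {u, x} ∅) ∪
    (nb G W u \ L).biUnion (fun x => cls G W {u, x} ∅))) ?_ (cu ?_ (cu ?_ ?_))
  · intro F hF
    by_cases huF : u ∈ F
    · rcases in_cases hF huF with h | ⟨y, hy, hyF, h⟩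
      -- If `u` had no partner in `F`, a leaf at `u` could be added to `F`.
      · exfalso
        obtain ⟨v, hv⟩ := hL0
        have hvW := (mem_nb.1 (hL hv)).1
        have huv := (mem_nb.1 (hL hv)).2
        have hvF : v ∉ F := cls_adj h (mem_singleton_self u) huv (by simpa using huv.ne.symm)
        rcases blocked hF hvW hvF with ⟨y, hy, z, hz, hne, h1, h2⟩ | ⟨y, hy, h1, z, hz, h2⟩
        · exact hne ((hleaf' v hv y (MD_sub hF hy) h1).trans (hleaf' v hv z (MD_sub hF hz) h2).symm)
        · obtain rfl := hleaf' v hv y (MD_sub hF hy) h1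
          exact cls_adj h (mem_singleton_self y) h2 (by simpa using h2.ne.symm) hz
      · by_cases hyL : y ∈ L
        · exact mem_union_right _ (mem_union_left _ (mem_biUnion.2 ⟨y, hyL, h⟩))
        · exact mem_union_right _ (mem_union_right _
            (mem_biUnion.2 ⟨y, mem_sdiff.2 ⟨hy, hyL⟩, h⟩))
    · refine mem_union_left _ (mem_cls.2 ⟨hF, fun x hx => ?_, fun z hz _ => ⟨fun i hi h => ?_, by simp⟩⟩)
      · refine mem_of_free hF (mem_nb.1 (hL hx)).1 fun y hy h => huF ?_
        exact hleaf' x hx y (MD_sub hF hy) h ▸ hy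
      · exact huF (hleaf' i hi z (MD_sub hF hz) h ▸ hz)
  · refine cls_le hf _ _ (insert u L) _ ?_ ?_ (card_pos.2 ⟨u, mem_insert_self _ _⟩)
    · intro z hz
      rcases mem_insert.1 hz with rfl | hz
      · obtain ⟨v, hv⟩ := hL0
        exact ⟨hu, Or.inr (Or.inl ⟨v, hv, (mem_nb.1 (hL hv)).2.symm⟩)⟩
      · exact ⟨(mem_nb.1 (hL hz)).1, Or.inl hz⟩
    · rw [card_insert_of_notMem fun h => (mem_nb.1 (hL h)).2.ne rfl]
      omega
  · refine biUnion_le fun x hx => pair_le hf ht hu (mem_nb.1 (hL hx)).1 (mem_nb.1 (hL hx)).2 _ ?_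
    rw [hleaf x hx, card_singleton]; omega
  · rw [← card_sdiff_of_subset hL]
    refine biUnion_le fun x hx => ?_
    obtain ⟨hx, hxL⟩ := mem_sdiff.1 hx
    refine pair_le hf ht hu (mem_nb.1 hx).1 (mem_nb.1 hx).2 _ ?_
    have := hk x hx hxL
    omega

/-- The bound obtained from the three possible roles of a vertex `v`. -/
lemma vertex_le {f : ℤ → ℚ} {W : Finset V} (hf : Bdd G f W) (ht : TF G) {v : V} (hv : v ∈ W)
    {k : ℕ} {X : Finset V} (hX : X ⊆ nb G W v) (hk : ∀ x ∈ nb G W v, x ∉ X → k ≤ #(nb G W x))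
    {l : ℕ} (hl : ∀ x ∈ X, l ≤ #(nb G W x)) :
    (ph G W : ℚ) ≤ ph G (W \ {v}) + (f (#W - (#(nb G W v) + 1 : ℕ)) +
      (#X * f (#W - (#(nb G W v) + l : ℕ)) +
        (#(nb G W v) - #X : ℕ) * f (#W - (#(nb G W v) + k : ℕ)))) := by
  refine ph_le_of_cover (S := cls G W ∅ {v} ∪ (cls G W {v} ∅ ∪
    (X.biUnion (fun x => cls G W {v, x} ∅) ∪ (nb G W v \ X).biUnion (fun x => cls G W {v, x} ∅))))
    ?_ (cu ?_ (cu ?_ (cu ?_ ?_)))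
  · intro F hF
    by_cases hvF : v ∈ F
    · refine mem_union_right _ ?_
      rcases in_cases hF hvF with h | ⟨y, hy, hyF, h⟩
      · exact mem_union_left _ h
      · refine mem_union_right _ ?_
        by_cases hyX : y ∈ X
        · exact mem_union_left _ (mem_biUnion.2 ⟨y, hyX, h⟩)
        · exact mem_union_right _ (mem_biUnion.2 ⟨y, mem_sdiff.2 ⟨hy, hyX⟩, h⟩)
    · exact mem_union_left _ (out_cls hF (by simpa using hvF))
  · exact_mod_cast ph_out_le {v} (by simpa using hv)
  · exact single_le hf hv _ le_rfl
  · refine biUnion_le fun x hx => ?_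
    exact pair_le hf ht hv (mem_nb.1 (hX hx)).1 (mem_nb.1 (hX hx)).2 _ (by have := hl x hx; omega)
  · rw [← card_sdiff_of_subset hX]
    refine biUnion_le fun x hx => ?_
    obtain ⟨hx, hxX⟩ := mem_sdiff.1 hx
    exact pair_le hf ht hv (mem_nb.1 hx).1 (mem_nb.1 hx).2 _ (by have := hk x hx hxX; omega)

lemma nb_pair {W : Finset V} {v a b : V} (h : nb G W v = {a, b}) :
    a ∈ W ∧ b ∈ W ∧ G.Adj v a ∧ G.Adj v b ∧ ∀ y ∈ W, G.Adj v y → y = a ∨ y = b := by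
  have h1 : a ∈ nb G W v := by simp [h]
  have h2 : b ∈ nb G W v := by simp [h]
  refine ⟨(mem_nb.1 h1).1, (mem_nb.1 h2).1, (mem_nb.1 h1).2, (mem_nb.1 h2).2, fun y hy hvy => ?_⟩
  have : y ∈ nb G W v := mem_nb.2 ⟨hy, hvy⟩
  simpa [h] using this

lemma card_erase_nb {W : Finset V} {v a : V} (hv : v ∈ W) (h : G.Adj a v) :
    #((nb G W a).erase v) + 1 = #(nb G W a) :=
  card_erase_add_one (mem_nb.2 ⟨hv, h⟩)

/-- The bound obtained from a vertex `v` of degree two that lies in no four-cycle. -/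
lemma deg_two_le {f : ℤ → ℚ} {W : Finset V} (hf : Bdd G f W) (ht : TF G) (hc : NoC4 G W)
    {v a b : V} (hv : v ∈ W) (hab : a ≠ b) (hnv : nb G W v = {a, b}) {p q : ℕ}
    (hp : #(nb G W a) = p + 1) (hq : #(nb G W b) = q + 1)
    (ha2 : ∀ x ∈ nb G W a, 2 ≤ #(nb G W x)) (hb2 : ∀ x ∈ nb G W b, 2 ≤ #(nb G W x)) :
    (ph G W : ℚ) ≤ f (#W - 3) + (f (#W - (3 + p : ℕ)) + (f (#W - (3 + q : ℕ)) +
      (q * f (#W - (3 + q : ℕ)) + (f (#W - (3 + p + q : ℕ)) + (p * f (#W - (3 + p + q : ℕ)) +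
      p * f (#W - (4 + p : ℕ))))))) := by
  obtain ⟨haW, hbW, hva, hvb, hv'⟩ := nb_pair hnv
  set A := (nb G W a).erase v with hA
  set B := (nb G W b).erase v with hB
  have hpA : #A = p := by have := card_erase_nb (G := G) hv hva.symm; rw [← hA] at this; omega
  have hqB : #B = q := by have := card_erase_nb (G := G) hv hvb.symm; rw [← hB] at this; omega
  have hnab : ¬ G.Adj a b := fun h => ht v a b hva h hvb
  have mA : ∀ {x}, x ∈ A ↔ x ≠ v ∧ x ∈ W ∧ G.Adj a x := by simp [A, mem_nb]
  have mB : ∀ {x}, x ∈ B ↔ x ≠ v ∧ x ∈ W ∧ G.Adj b x := by simp [B, mem_nb]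
  -- A common neighbour of `a` and `b` other than `v` would close a four-cycle.
  have hAB : Disjoint A B := by
    rw [disjoint_left]; intro x h1 h2
    rw [mA] at h1; rw [mB] at h2
    exact hab (hc x h1.2.1 v hv a haW b hbW h1.1 h1.2.2.symm hva h2.2.2.symm hvb)
  have haA : a ∉ A := fun h => (mA.1 h).2.2.ne rfl
  have hbB : b ∉ B := fun h => (mB.1 h).2.2.ne rfl
  have hbA : b ∉ A := fun h => hnab (mA.1 h).2.2
  have haB : a ∉ B := fun h => hnab (mB.1 h).2.2.symm
  have hvA : v ∉ A := fun h => (mA.1 h).1 rfl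
  have hvB : v ∉ B := fun h => (mB.1 h).1 rfl
  have cT : #(insert v (insert a (insert b (A ∪ B)))) = 3 + p + q := by
    rw [card_insert_of_notMem (by simp [hva.ne, hvb.ne, hvA, hvB]),
      card_insert_of_notMem (by simp [hab, haA, haB]), card_insert_of_notMem (by simp [hbA, hbB]),
      card_union_of_disjoint hAB]; omega
  have zT : ∀ I : Finset V, a ∈ I → b ∈ I → ∀ z ∈ insert v (insert a (insert b (A ∪ B))),
      z ∈ W ∧ (z ∈ I ∨ (∃ i ∈ I, G.Adj i z) ∨ z ∈ (∅ : Finset V)) := by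
    intro I haI hbI z hz
    simp only [mem_insert, mem_union, mA, mB] at hz
    rcases hz with rfl | rfl | rfl | h | h
    · exact ⟨hv, Or.inr (Or.inl ⟨a, haI, hva.symm⟩)⟩
    · exact ⟨haW, Or.inl haI⟩
    · exact ⟨hbW, Or.inl hbI⟩
    · exact ⟨h.2.1, Or.inr (Or.inl ⟨a, haI, h.2.2⟩)⟩
    · exact ⟨h.2.1, Or.inr (Or.inl ⟨b, hbI, h.2.2⟩)⟩
  -- The first three classes have `v` in `F`, isolated or matched. With `v` out, either `b` is
  -- matched, or `b` is isolated in `F` and then `a` is isolated or matched, or `b` is out, which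
  -- forces `a` to be matched since `v` has to be blocked.
  refine ph_le_of_cover (S := cls G W {v} ∅ ∪ (cls G W {v, a} ∅ ∪ (cls G W {v, b} ∅ ∪
    (B.biUnion (fun y => cls G W {b, y} ∅) ∪ (cls G W {a, b} ∅ ∪
    (A.biUnion (fun x => cls G W {a, x, b} ∅) ∪ A.biUnion (fun x => cls G W {a, x} {b}))))))) ?_
    (cu ?_ (cu ?_ (cu ?_ (cu ?_ (cu ?_ (cu ?_ ?_))))))
  · intro F hF
    simp only [mem_union, mem_biUnion]
    by_cases hvF : v ∈ F
    · rcases in_cases hF hvF with h | ⟨y, hy, hyF, h⟩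
      · exact Or.inl h
      · rcases hv' y (mem_nb.1 hy).1 (mem_nb.1 hy).2 with rfl | rfl
        · exact Or.inr (Or.inl h)
        · exact Or.inr (Or.inr (Or.inl h))
    by_cases hbF : b ∈ F
    · rcases in_cases hF hbF with hb | ⟨y, hy, hyF, h⟩
      · by_cases haF : a ∈ F
        · rcases in_cases hF haF with ha | ⟨x, hx, hxF, h⟩
          · exact Or.inr (Or.inr (Or.inr (Or.inr (Or.inl
              (cls_congr (cls_union ha hb) (by ext; simp) (by simp))))))
          · refine Or.inr (Or.inr (Or.inr (Or.inr (Or.inr (Or.inl ⟨x, ?_, cls_congr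
              (cls_union h hb) (by ext; simp) (by simp)⟩)))))
            exact mA.2 ⟨fun h => hvF (h ▸ hxF), (mem_nb.1 hx).1, (mem_nb.1 hx).2⟩
        -- Here the only neighbour of `v` in `F` would be the isolated vertex `b`, so `v` could be
        -- added.
        · exfalso
          rcases blocked hF hv hvF with ⟨y, hy, z, hz, hne, h1, h2⟩ | ⟨y, hy, h1, z, hz, h2⟩
          · rcases hv' y (MD_sub hF hy) h1 with rfl | rfl
            · exact haF hy
            · rcases hv' z (MD_sub hF hz) h2 with rfl | rfl
              · exact haF hz
              · exact hne rfl
          · rcases hv' y (MD_sub hF hy) h1 with rfl | rfl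
            · exact haF hy
            · exact cls_adj hb (mem_singleton_self y) h2 (by simpa using h2.ne.symm) hz
      · refine Or.inr (Or.inr (Or.inr (Or.inl ⟨y, ?_, h⟩)))
        exact mB.2 ⟨fun h => hvF (h ▸ hyF), (mem_nb.1 hy).1, (mem_nb.1 hy).2⟩
    · have : a ∈ F ∧ ∃ x ∈ F, G.Adj a x := by
        rcases blocked hF hv hvF with ⟨y, hy, z, hz, hne, h1, h2⟩ | ⟨y, hy, h1, z, hz, h2⟩
        · rcases hv' y (MD_sub hF hy) h1 with rfl | rfl
          · rcases hv' z (MD_sub hF hz) h2 with rfl | rfl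
            · exact absurd rfl hne
            · exact absurd hz hbF
          · exact absurd hy hbF
        · rcases hv' y (MD_sub hF hy) h1 with rfl | rfl
          · exact ⟨hy, z, hz, h2⟩
          · exact absurd hy hbF
      obtain ⟨haF, x, hxF, hax⟩ := this
      refine Or.inr (Or.inr (Or.inr (Or.inr (Or.inr (Or.inr ⟨x, ?_, ?_⟩)))))
      · exact mA.2 ⟨fun h => hvF (h ▸ hxF), MD_sub hF hxF, hax⟩
      · exact cls_congr (cls_union (pair_cls hF haF hxF hax)
          (out_cls (O := {b}) hF (by simpa using hbF))) (by simp) (by simp)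
  · exact single_le hf hv 3 (by rw [hnv, card_pair hab])
  · exact pair_le hf ht hv haW hva _ (by rw [hnv, card_pair hab]; omega)
  · exact pair_le hf ht hv hbW hvb _ (by rw [hnv, card_pair hab]; omega)
  · rw [← hqB]
    refine biUnion_le fun y hy => pair_le hf ht hbW (mB.1 hy).2.1 (mB.1 hy).2.2 _ ?_
    have := hb2 y (mem_nb.2 (mB.1 hy).2)
    omega
  · exact cls_le hf _ _ _ _ (zT _ (by simp) (by simp)) cT.ge (by omega)
  · rw [show (p : ℚ) = #A by rw [hpA]]
    exact biUnion_le fun x hx => cls_le hf _ _ _ _ (zT _ (by simp) (by simp)) cT.ge (by omega)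
  · rw [show (p : ℚ) = #A by rw [hpA]]
    refine biUnion_le fun x hx => ?_
    obtain ⟨hxv, hxW, hax⟩ := mA.1 hx
    -- A second neighbour `y` of `x` is one more decided vertex: the absence of triangles separates
    -- it from `v` and `A`, the absence of four-cycles from `b`.
    obtain ⟨y, hy, hya⟩ := card_two_le_exists (ha2 x (mem_nb.2 ⟨hxW, hax⟩)) a
    obtain ⟨hyW, hxy⟩ := mem_nb.1 hy
    have hyA : y ∉ A := fun h => ht a x y hax hxy (mA.1 h).2.2
    have hyv : y ≠ v := by
      rintro rfl
      exact ht y a x hva hax hxy.symm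
    have hyb : y ≠ b := by
      rintro rfl
      exact disjoint_left.1 hAB hx (mB.2 ⟨hxv, hxW, hxy.symm⟩)
    refine cls_le hf _ _ (insert y (insert v (insert a (insert b A)))) _ ?_ ?_
      (card_pos.2 ⟨y, mem_insert_self _ _⟩)
    · intro z hz
      simp only [mem_insert, mA] at hz
      rcases hz with rfl | rfl | rfl | rfl | h
      · exact ⟨hyW, Or.inr (Or.inl ⟨x, by simp, hxy⟩)⟩
      · exact ⟨hv, Or.inr (Or.inl ⟨a, by simp, hva.symm⟩)⟩
      · exact ⟨haW, Or.inl (by simp)⟩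
      · exact ⟨hbW, Or.inr (Or.inr (by simp))⟩
      · exact ⟨h.2.1, Or.inr (Or.inl ⟨a, by simp, h.2.2⟩)⟩
    · rw [card_insert_of_notMem (by simp [hyv, hya, hyb, hyA]),
        card_insert_of_notMem (by simp [hva.ne, hvb.ne, hvA]),
        card_insert_of_notMem (by simp [hab, haA]), card_insert_of_notMem (by simp [hbA]), hpA]
      omega

/-- If `v` is out, it is blocked either by `a` and `b` together or by one of them matched to its
other neighbour. As `a` and `b` have degree two, each of them is isolated in `F` as soon as it is in
`F` and its other neighbour is out. -/
lemma path_cases {W F : Finset V} {v a b a' b' : V} (hv : v ∈ W) (hnv : nb G W v = {a, b})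
    (hna : nb G W a = {v, a'}) (hnb : nb G W b = {v, b'}) (hF : F ∈ MD G W) :
    (F ∈ cls G W {v} ∅ ∨ F ∈ cls G W {v, a} ∅ ∨ F ∈ cls G W {v, b} ∅) ∨
    v ∉ F ∧ ((a ∈ F ∧ b ∈ F) ∨ (a ∈ F ∧ a' ∈ F) ∨ (b ∈ F ∧ b' ∈ F)) ∧
    (a ∈ F → a' ∉ F → F ∈ cls G W {a} ∅) ∧ (b ∈ F → b' ∉ F → F ∈ cls G W {b} ∅) := by
  obtain ⟨haW, hbW, hva, hvb, hv'⟩ := nb_pair hnv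
  obtain ⟨-, ha'W, -, haa', ha''⟩ := nb_pair hna
  obtain ⟨-, hb'W, -, hbb', hb''⟩ := nb_pair hnb
  by_cases hvF : v ∈ F
  · refine Or.inl ?_
    rcases in_cases hF hvF with h | ⟨y, hy, hyF, h⟩
    · exact Or.inl h
    · rcases hv' y (mem_nb.1 hy).1 (mem_nb.1 hy).2 with rfl | rfl
      · exact Or.inr (Or.inl h)
      · exact Or.inr (Or.inr h)
  refine Or.inr ⟨hvF, ?_, fun haF ha'F => ?_, fun hbF hb'F => ?_⟩
  · rcases blocked hF hv hvF with ⟨y, hy, z, hz, hne, h1, h2⟩ | ⟨y, hy, h1, z, hz, h2⟩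
    · rcases hv' y (MD_sub hF hy) h1 with rfl | rfl <;>
      rcases hv' z (MD_sub hF hz) h2 with rfl | rfl
      · exact absurd rfl hne
      · exact Or.inl ⟨hy, hz⟩
      · exact Or.inl ⟨hz, hy⟩
      · exact absurd rfl hne
    · rcases hv' y (MD_sub hF hy) h1 with rfl | rfl
      · rcases ha'' z (MD_sub hF hz) h2 with rfl | rfl
        · exact absurd hz hvF
        · exact Or.inr (Or.inl ⟨hy, hz⟩)
      · rcases hb'' z (MD_sub hF hz) h2 with rfl | rfl
        · exact absurd hz hvF
        · exact Or.inr (Or.inr ⟨hy, hz⟩)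
  · refine single_cls hF haF fun y hy h => ?_
    rcases ha'' y (MD_sub hF hy) h with rfl | rfl
    · exact hvF hy
    · exact ha'F hy
  · refine single_cls hF hbF fun y hy h => ?_
    rcases hb'' y (MD_sub hF hy) h with rfl | rfl
    · exact hvF hy
    · exact hb'F hy

/-- The bound obtained from a five-cycle three of whose vertices have degree two. -/
lemma five_cycle_le {f : ℤ → ℚ} {W : Finset V} (hf : Bdd G f W) (ht : TF G)
    (hc : NoC4 G W) {v a b a' b' : V} (hv : v ∈ W) (hab : a ≠ b) (hnv : nb G W v = {a, b})
    (hna : nb G W a = {v, a'}) (hnb : nb G W b = {v, b'}) (hva' : v ≠ a') (hvb' : v ≠ b')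
    (hadj : G.Adj a' b') : (ph G W : ℚ) ≤ f (#W - 3) + (f (#W - 4) + (f (#W - 4) + (f (#W - 4) +
      (f (#W - 5) + f (#W - 5))))) := by
  obtain ⟨haW, hbW, hva, hvb, hv'⟩ := nb_pair hnv
  obtain ⟨-, ha'W, -, haa', ha''⟩ := nb_pair hna
  obtain ⟨-, hb'W, -, hbb', hb''⟩ := nb_pair hnb
  have hab' : a' ≠ b' := by
    rintro rfl
    exact hab (hc v hv a' ha'W a haW b hbW hva' hva haa'.symm hvb hbb'.symm)
  have hnab : ¬ G.Adj a b := fun h => ht v a b hva h hvb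
  have ha'b : a' ≠ b := by rintro rfl; exact hnab haa'
  have hb'a : b' ≠ a := by rintro rfl; exact hnab hbb'.symm
  have c5 : #({v, a, b, a', b'} : Finset V) = 5 := by
    rw [card_insert_of_notMem (by simp [hva.ne, hvb.ne, hva', hvb']),
      card_insert_of_notMem (by simp [hab, haa'.ne, hb'a.symm]),
      card_insert_of_notMem (by simp [ha'b.symm, hbb'.ne]), card_pair hab']
  have z5 : ∀ I O : Finset V, a ∈ I → (b ∈ I ∨ b ∈ O) → (b' ∈ I ∨ (∃ i ∈ I, G.Adj i b')) →
      ∀ z ∈ ({v, a, b, a', b'} : Finset V), z ∈ W ∧ (z ∈ I ∨ (∃ i ∈ I, G.Adj i z) ∨ z ∈ O) := by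
    intro I O haI hbI hb'I z hz
    simp only [mem_insert, mem_singleton] at hz
    rcases hz with rfl | rfl | rfl | rfl | rfl
    · exact ⟨hv, Or.inr (Or.inl ⟨a, haI, hva.symm⟩)⟩
    · exact ⟨haW, Or.inl haI⟩
    · exact ⟨hbW, hbI.imp_right Or.inr⟩
    · exact ⟨ha'W, Or.inr (Or.inl ⟨a, haI, haa'⟩)⟩
    · exact ⟨hb'W, hb'I.imp_right Or.inl⟩
  have l3 : (#(cls G W {v} ∅) : ℚ) ≤ f (#W - 3) := single_le hf hv 3 (by rw [hnv, card_pair hab])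
  have l4a : (#(cls G W {v, a} ∅) : ℚ) ≤ f (#W - 4) :=
    pair_le hf ht hv haW hva 4 (by rw [hnv, card_pair hab, hna, card_pair hva'])
  have l4b : (#(cls G W {v, b} ∅) : ℚ) ≤ f (#W - 4) :=
    pair_le hf ht hv hbW hvb 4 (by rw [hnv, card_pair hab, hnb, card_pair hvb'])
  have l5 : (#(cls G W {a, b} ∅) : ℚ) ≤ f (#W - 5) :=
    cls_le hf _ _ _ _ (z5 _ _ (by simp) (by simp) (Or.inr ⟨b, by simp, hbb'⟩)) c5.ge (by omega)
  refine ph_le_of_cover (S := cls G W {v} ∅ ∪ (cls G W {v, a} ∅ ∪ (cls G W {v, b} ∅ ∪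
      (cls G W {b, b'} ∅ ∪ (cls G W {a, b} ∅ ∪ cls G W {a, a', b} ∅))))) ?_
      (cu l3 (cu l4a (cu l4b (cu ?_ (cu l5 ?_)))))
  · intro F hF
    simp only [mem_union]
    rcases path_cases hv hnv hna hnb hF with (h | h | h) | ⟨hvF, hblock, hisoa, hisob⟩
    · exact Or.inl h
    · exact Or.inr (Or.inl h)
    · exact Or.inr (Or.inr (Or.inl h))
    by_cases hbF : b ∈ F
    · by_cases hb'F : b' ∈ F
      · exact Or.inr (Or.inr (Or.inr (Or.inl (pair_cls hF hbF hb'F hbb'))))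
      · have hb := hisob hbF hb'F
        have haF : a ∈ F := by
          rcases hblock with h | h | h
          · exact h.1
          · exact h.1
          · exact absurd h.2 hb'F
        by_cases ha'F : a' ∈ F
        · exact Or.inr (Or.inr (Or.inr (Or.inr (Or.inr (cls_congr
            (cls_union (pair_cls hF haF ha'F haa') hb) (by ext; simp) (by simp))))))
        · exact Or.inr (Or.inr (Or.inr (Or.inr (Or.inl (cls_congr
            (cls_union (hisoa haF ha'F) hb) (by ext; simp) (by simp))))))
    -- With `b` out, `v` must be blocked through the edge `a a'`. This keeps `b'` out, so `b` has no
    -- neighbour in `F` and could be added.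
    · exfalso
      have h : a ∈ F ∧ a' ∈ F := by
        rcases hblock with h | h | h
        · exact absurd h.2 hbF
        · exact h
        · exact absurd h.1 hbF
      have hb'F : b' ∉ F := cls_adj (pair_cls hF h.1 h.2 haa') (x := a') (by simp) hadj
        (by simp [hb'a, hab'.symm])
      rcases blocked hF hbW hbF with ⟨y, hy, z, hz, hne, h1, h2⟩ | ⟨y, hy, h1, z, hz, h2⟩
      · rcases hb'' y (MD_sub hF hy) h1 with rfl | rfl
        · exact hvF hy
        · exact hb'F hy
      · rcases hb'' y (MD_sub hF hy) h1 with rfl | rfl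
        · exact hvF hy
        · exact hb'F hy
  · refine pair_le hf ht hbW hb'W hbb' 4 ?_
    have : #({b, a'} : Finset V) ≤ #(nb G W b') := card_le_card (by
      intro z; simp only [mem_insert, mem_singleton]
      rintro (rfl | rfl)
      · exact mem_nb.2 ⟨hbW, hbb'.symm⟩
      · exact mem_nb.2 ⟨ha'W, hadj.symm⟩)
    rw [card_pair ha'b.symm] at this
    rw [hnb, card_pair hvb']; omega
  · exact cls_le hf _ _ _ _ (z5 _ _ (by simp) (by simp) (Or.inr ⟨b, by simp, hbb'⟩)) c5.ge
      (by omega)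

/-- The bound obtained from an induced path `a', a, v, b, b'` whose inner vertices have degree
two. -/
lemma deg_two_path_le {f : ℤ → ℚ} {W : Finset V} (hf : Bdd G f W) (hf0 : ∀ m, 0 ≤ f m) (ht : TF G)
    (hc : NoC4 G W) {v a b a' b' : V} (hv : v ∈ W) (hab : a ≠ b) (hnv : nb G W v = {a, b})
    (hna : nb G W a = {v, a'}) (hnb : nb G W b = {v, b'}) (hva' : v ≠ a') (hvb' : v ≠ b')
    (hadj : ¬ G.Adj a' b') : ∃ D : ℕ, D + 1 = #(nb G W a') ∧ (2 ≤ #(nb G W b') → (ph G W : ℚ) ≤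
      f (#W - 3) + (f (#W - 4) + (f (#W - 4) + (f (#W - (3 + D : ℕ)) +
      (f (#W - 5) + (f (#W - 6) + D * f (#W - (if D = 1 then 7 else 5 + D : ℕ)))))))) := by
  obtain ⟨haW, hbW, hva, hvb, hv'⟩ := nb_pair hnv
  obtain ⟨-, ha'W, -, haa', ha''⟩ := nb_pair hna
  obtain ⟨-, hb'W, -, hbb', hb''⟩ := nb_pair hnb
  have hab' : a' ≠ b' := by
    rintro rfl
    exact hab (hc v hv a' ha'W a haW b hbW hva' hva haa'.symm hvb hbb'.symm)
  have hnab : ¬ G.Adj a b := fun h => ht v a b hva h hvb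
  have ha'b : a' ≠ b := by rintro rfl; exact hnab haa'
  have hb'a : b' ≠ a := by rintro rfl; exact hnab hbb'.symm
  have c5 : #({v, a, b, a', b'} : Finset V) = 5 := by
    rw [card_insert_of_notMem (by simp [hva.ne, hvb.ne, hva', hvb']),
      card_insert_of_notMem (by simp [hab, haa'.ne, hb'a.symm]),
      card_insert_of_notMem (by simp [ha'b.symm, hbb'.ne]), card_pair hab']
  have z5 : ∀ I O : Finset V, a ∈ I → (b ∈ I ∨ b ∈ O) → (b' ∈ I ∨ (∃ i ∈ I, G.Adj i b')) →
      ∀ z ∈ ({v, a, b, a', b'} : Finset V), z ∈ W ∧ (z ∈ I ∨ (∃ i ∈ I, G.Adj i z) ∨ z ∈ O) := by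
    intro I O haI hbI hb'I z hz
    simp only [mem_insert, mem_singleton] at hz
    rcases hz with rfl | rfl | rfl | rfl | rfl
    · exact ⟨hv, Or.inr (Or.inl ⟨a, haI, hva.symm⟩)⟩
    · exact ⟨haW, Or.inl haI⟩
    · exact ⟨hbW, hbI.imp_right Or.inr⟩
    · exact ⟨ha'W, Or.inr (Or.inl ⟨a, haI, haa'⟩)⟩
    · exact ⟨hb'W, hb'I.imp_right Or.inl⟩
  have l3 : (#(cls G W {v} ∅) : ℚ) ≤ f (#W - 3) := single_le hf hv 3 (by rw [hnv, card_pair hab])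
  have l4a : (#(cls G W {v, a} ∅) : ℚ) ≤ f (#W - 4) :=
    pair_le hf ht hv haW hva 4 (by rw [hnv, card_pair hab, hna, card_pair hva'])
  have l4b : (#(cls G W {v, b} ∅) : ℚ) ≤ f (#W - 4) :=
    pair_le hf ht hv hbW hvb 4 (by rw [hnv, card_pair hab, hnb, card_pair hvb'])
  have l5 : (#(cls G W {a, b} ∅) : ℚ) ≤ f (#W - 5) :=
    cls_le hf _ _ _ _ (z5 _ _ (by simp) (by simp) (Or.inr ⟨b, by simp, hbb'⟩)) c5.ge (by omega)
  set X := (nb G W a').erase a with hX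
  have hXc : #X + 1 = #(nb G W a') := card_erase_nb haW haa'.symm
  have mX : ∀ {x}, x ∈ X ↔ x ≠ a ∧ x ∈ W ∧ G.Adj a' x := by simp [X, mem_nb]
  have hvX : v ∉ X := fun h => ht v a a' hva haa' (mX.1 h).2.2.symm
  have hbX : b ∉ X := fun h => by
    rcases hb'' a' ha'W (mX.1 h).2.2.symm with h | h
    · exact hva' h.symm
    · exact hab' h
  have hb'X : b' ∉ X := fun h => hadj (mX.1 h).2.2
  have ha'X : a' ∉ X := fun h => (mX.1 h).2.2.ne rfl
  have haX : a ∉ X := fun h => (mX.1 h).1 rfl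
  refine ⟨#X, hXc, fun hb2 => ?_⟩
  refine ph_le_of_cover (S := cls G W {v} ∅ ∪ (cls G W {v, a} ∅ ∪ (cls G W {v, b} ∅ ∪
    (cls G W {a, a'} {v} ∪ (cls G W {a, b} ∅ ∪ (cls G W {a, b, b'} ∅ ∪
    X.biUnion (fun x => cls G W {b, b', a', x} {a}))))))) ?_
    (cu l3 (cu l4a (cu l4b (cu ?_ (cu l5 (cu ?_ (biUnion_le fun x hx => ?_)))))))
  · intro F hF
    simp only [mem_union, mem_biUnion]
    rcases path_cases hv hnv hna hnb hF with (h | h | h) | ⟨hvF, hblock, hisoa, hisob⟩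
    · exact Or.inl h
    · exact Or.inr (Or.inl h)
    · exact Or.inr (Or.inr (Or.inl h))
    by_cases haF : a ∈ F
    · by_cases ha'F : a' ∈ F
      · exact Or.inr (Or.inr (Or.inr (Or.inl (cls_congr (cls_union (pair_cls hF haF ha'F haa')
          (out_cls (O := {v}) hF (by simpa using hvF))) (by simp) (by simp)))))
      · have ha := hisoa haF ha'F
        have hbF : b ∈ F := by
          rcases hblock with h | h | h
          · exact h.2
          · exact absurd h.2 ha'F
          · exact h.1
        by_cases hb'F : b' ∈ F
        · exact Or.inr (Or.inr (Or.inr (Or.inr (Or.inr (Or.inl (cls_congr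
            (cls_union ha (pair_cls hF hbF hb'F hbb')) (by ext; simp [or_left_comm]) (by simp)))))))
        · exact Or.inr (Or.inr (Or.inr (Or.inr (Or.inl (cls_congr
            (cls_union ha (hisob hbF hb'F)) (by ext; simp) (by simp))))))
    -- With `v` and `a` both out, `v` is blocked through `b b'`, and `a` is blocked through `a'`,
    -- which must therefore be matched with some member of `X`.
    · have h : b ∈ F ∧ b' ∈ F := by
        rcases hblock with h | h | h
        · exact absurd h.1 haF
        · exact absurd h.1 haF
        · exact h
      have h' : a' ∈ F ∧ ∃ x ∈ F, G.Adj a' x := by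
        rcases blocked hF haW haF with ⟨y, hy, z, hz, hne, h1, h2⟩ | ⟨y, hy, h1, z, hz, h2⟩
        · rcases ha'' y (MD_sub hF hy) h1 with rfl | rfl
          · exact absurd hy hvF
          · rcases ha'' z (MD_sub hF hz) h2 with rfl | rfl
            · exact absurd hz hvF
            · exact absurd rfl hne
        · rcases ha'' y (MD_sub hF hy) h1 with rfl | rfl
          · exact absurd hy hvF
          · exact ⟨hy, z, hz, h2⟩
      obtain ⟨ha'F, x, hxF, hax⟩ := h'
      refine Or.inr (Or.inr (Or.inr (Or.inr (Or.inr (Or.inr ⟨x, mX.2 ⟨?_, MD_sub hF hxF, hax⟩,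
        cls_congr (cls_union (pair_cls hF h.1 h.2 hbb') (cls_union (pair_cls hF ha'F hxF hax)
        (out_cls (O := {a}) hF (by simpa using haF)))) (by ext; simp; clear * -; tauto) (by simp)⟩)))))
      rintro rfl
      exact haF hxF
  · refine cls_le hf _ _ (insert v (insert a (insert a' X))) _ ?_ ?_
      (card_pos.2 ⟨v, mem_insert_self _ _⟩)
    · intro z hz
      simp only [mem_insert, mX] at hz
      rcases hz with rfl | rfl | rfl | h
      · exact ⟨hv, Or.inr (Or.inr (by simp))⟩
      · exact ⟨haW, Or.inl (by simp)⟩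
      · exact ⟨ha'W, Or.inl (by simp)⟩
      · exact ⟨h.2.1, Or.inr (Or.inl ⟨a', by simp, h.2.2⟩)⟩
    · rw [card_insert_of_notMem (by simp [hva.ne, hva', hvX]),
        card_insert_of_notMem (by simp [haa'.ne, haX]), card_insert_of_notMem ha'X]
      omega
  · obtain ⟨y, hy, hyb⟩ := card_two_le_exists hb2 b
    obtain ⟨hyW, hby⟩ := mem_nb.1 hy
    refine cls_le hf _ _ (insert y {v, a, b, a', b'}) 6 ?_ ?_ (card_pos.2 ⟨y, mem_insert_self _ _⟩)
    · intro z hz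
      rcases mem_insert.1 hz with rfl | hz
      · exact ⟨hyW, Or.inr (Or.inl ⟨b', by simp, hby⟩)⟩
      · exact z5 {a, b, b'} ∅ (by simp) (by simp) (by simp) z hz
    · rw [card_insert_of_notMem, c5]
      simp only [mem_insert, mem_singleton, not_or]
      refine ⟨?_, ?_, hyb, ?_, hby.ne.symm⟩
      · rintro rfl; exact ht y b b' hvb hbb' hby.symm
      · rintro rfl
        rcases ha'' b' hb'W hby.symm with h | h
        · exact hvb' h.symm
        · exact hab' h.symm
      · rintro rfl; exact hadj hby.symm
  · obtain ⟨hxa, hxW, hax⟩ := mX.1 hx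
    obtain ⟨y, hy, hyb⟩ := card_two_le_exists hb2 b
    obtain ⟨hyW, hby⟩ := mem_nb.1 hy
    have hxb : x ≠ b := fun h => hbX (h ▸ hx)
    have hxb' : x ≠ b' := fun h => hb'X (h ▸ hx)
    by_cases hbx : G.Adj b' x
    -- The vertex `b'` would have the two neighbours `b` and `x` in `F`.
    · have : cls G W {b, b', a', x} {a} = ∅ := by
        refine eq_empty_of_forall_notMem fun F hF => ?_
        have hD := (mem_MD.1 (cls_MD hF)).2.1
        exact hxb (hD.eq (cls_in hF (x := b') (by simp)) (cls_in hF (x := x) (by simp))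
          (cls_in hF (x := b) (by simp)) hbx hbb'.symm)
      rw [this]; simpa using hf0 _
    have z : ∀ z ∈ insert v (insert a (insert b (insert a' (insert b' X)))), z ∈ W ∧
        (z ∈ ({b, b', a', x} : Finset V) ∨ (∃ i ∈ ({b, b', a', x} : Finset V), G.Adj i z) ∨
          z ∈ ({a} : Finset V)) := by
      intro z hz
      simp only [mem_insert, mX] at hz
      rcases hz with rfl | rfl | rfl | rfl | rfl | h
      · exact ⟨hv, Or.inr (Or.inl ⟨b, by simp, hvb.symm⟩)⟩
      · exact ⟨haW, Or.inr (Or.inr (by simp))⟩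
      · exact ⟨hbW, Or.inl (by simp)⟩
      · exact ⟨ha'W, Or.inl (by simp)⟩
      · exact ⟨hb'W, Or.inl (by simp)⟩
      · exact ⟨h.2.1, Or.inr (Or.inl ⟨a', by simp, h.2.2⟩)⟩
    have c : #(insert v (insert a (insert b (insert a' (insert b' X))))) = 5 + #X := by
      rw [card_insert_of_notMem (by simp [hva.ne, hvb.ne, hva', hvb', hvX]),
        card_insert_of_notMem (by simp [hab, haa'.ne, hb'a.symm, haX]),
        card_insert_of_notMem (by simp [ha'b.symm, hbb'.ne, hbX]),
        card_insert_of_notMem (by simp [hab', ha'X]), card_insert_of_notMem hb'X]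
      omega
    -- If `X` consists of `x` alone, the second neighbour `y` of `b'` lies outside `X`, since `b'`
    -- is not adjacent to `x`; it is a seventh decided vertex. For larger `X`, `y` may belong to `X`
    -- and nothing is gained.
    split_ifs with hX1
    · refine cls_le hf _ _ (insert y (insert v (insert a (insert b (insert a' (insert b' X))))))
        7 ?_ ?_ (card_pos.2 ⟨y, mem_insert_self _ _⟩)
      · intro u hu
        rcases mem_insert.1 hu with rfl | hu
        · exact ⟨hyW, Or.inr (Or.inl ⟨b', by simp, hby⟩)⟩
        · exact z u hu
      · rw [card_insert_of_notMem, c]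
        · omega
        · simp only [mem_insert, not_or]
          refine ⟨?_, ?_, hyb, ?_, hby.ne.symm, ?_⟩
          · rintro rfl; exact ht y b b' hvb hbb' hby.symm
          · rintro rfl
            rcases ha'' b' hb'W hby.symm with h | h
            · exact hvb' h.symm
            · exact hab' h.symm
          · rintro rfl; exact hadj hby.symm
          · intro hyX
            obtain ⟨w, hw⟩ := card_eq_one.1 hX1
            rw [hw, mem_singleton] at hx hyX
            exact hbx (hx ▸ hyX ▸ hby)
    · exact cls_le hf _ _ _ _ z c.ge (by omega)

/-! ### Numerical recursions for graphs without four-cycles -/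

lemma Bz_far {n : ℤ} (h : 18 ≤ n) : Bz n = Gz n ∧ Bz (n - 1) = Gz (n - 1) ∧
    Bz (n - 2) = Gz (n - 2) ∧
    Bz (n - 3) = Gz (n - 3) ∧
    Bz (n - 4) = Gz (n - 4) ∧
    Bz (n - 5) = Gz (n - 5) ∧
    Bz (n - 6) = Gz (n - 6) ∧
    Bz (n - 7) = Gz (n - 7) ∧
    Bz (n - 8) = Gz (n - 8) ∧
    Bz (n - 9) = Gz (n - 9) ∧
    Bz (n - 10) = Gz (n - 10) ∧
    Bz (n - 11) = Gz (n - 11) ∧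
    Bz (n - 12) = Gz (n - 12) := by
  refine ⟨?_, ?_, ?_, ?_, ?_, ?_, ?_, ?_, ?_, ?_, ?_, ?_, ?_⟩ <;> exact Bz_eq (by omega)

/-- `Bz` is constant on the orders 0, 1, 2, so truncating large degrees inside `Bz` itself would
fail. This is why `Fz` appears in some of the recursions for `Bz`. -/
lemma mul_Bz_le (m : ℤ) (k p : ℕ) (hk : 3 ≤ k) (h : k ≤ p) : p * Bz (m - p) ≤ k * Fz (m - k) :=
  (mul_le_mul_of_nonneg_left (Bz_le_Fz _) (by positivity)).trans (mul_Fz_le m k p hk h)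

/-- This and the following inequalities each close one local case of `noC4_le`. Orders below 18 are
evaluated. From 18 on all arguments are at least 5, where `Bz` coincides with the periodic sequence
`Gz`. -/
lemma Bz_edge (n : ℤ) (h1 : 2 ≤ n) :
    Bz (n - 2) ≤ Bz n := by
  rcases lt_or_ge n 18 with h | h
  · interval_cases n <;> norm_num [Bz, Gz, Fz, quad]
  · obtain ⟨s, hs, hc⟩ := quad_cases n
    simp only [Bz_far h, Gz]
    rcases hc with hc | hc | hc | hc <;> simp only [hc] <;> linarith

lemma Bz_leaf_two (n : ℤ) (h1 : 1 ≤ n) :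
    Bz (n - 2) + 2 * Bz (n - 3) ≤ Bz n := by
  rcases lt_or_ge n 18 with h | h
  · interval_cases n <;> norm_num [Bz, Gz, Fz, quad]
  · obtain ⟨s, hs, hc⟩ := quad_cases n
    simp only [Bz_far h, Gz]
    rcases hc with hc | hc | hc | hc <;> simp only [hc] <;> linarith

lemma Bz_leaf_three (n : ℤ) (h1 : 1 ≤ n) :
    Bz (n - 2) + 3 * Bz (n - 4) ≤ Bz n := by
  rcases lt_or_ge n 18 with h | h
  · interval_cases n <;> norm_num [Bz, Gz, Fz, quad]
  · obtain ⟨s, hs, hc⟩ := quad_cases n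
    simp only [Bz_far h, Gz, quad_far n]
    rcases hc with hc | hc | hc | hc <;> simp only [hc] <;> linarith

/-- Equality holds at `n = 5`, where the left side is 3 + 4: the entry 7/6 of `Gz` cannot be lowered
here. -/
lemma Bz_leaf_four (n : ℤ) (h1 : 5 ≤ n) :
    Bz (n - 2) + 4 * Fz (n - 5) ≤ Bz n := by
  rcases lt_or_ge n 18 with h | h
  · interval_cases n <;> norm_num [Bz, Gz, Fz, quad]
  · obtain ⟨s, hs, hc⟩ := quad_cases n
    simp only [Bz_far h, Gz, Fz, quad_far n]
    rcases hc with hc | hc | hc | hc <;> simp only [hc] <;> linarith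

lemma Bz_five_cycle (n : ℤ) (h1 : 1 ≤ n) :
    Bz (n - 3) + (Bz (n - 4) + (Bz (n - 4) + (Bz (n - 4) + (Bz (n - 5) + Bz (n - 5))))) ≤ Bz n := by
  rcases lt_or_ge n 18 with h | h
  · interval_cases n <;> norm_num [Bz, Gz, Fz, quad]
  · obtain ⟨s, hs, hc⟩ := quad_cases n
    simp only [Bz_far h, Gz, quad_far n]
    rcases hc with hc | hc | hc | hc <;> simp only [hc] <;> linarith

lemma Bz_cubic (n : ℤ) (h1 : 1 ≤ n) :
    24 / 25 * Bz (n - 1) + (Bz (n - 4) + 3 * Bz (n - 6)) ≤ Bz n := by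
  rcases lt_or_ge n 18 with h | h
  · interval_cases n <;> norm_num [Bz, Gz, Fz, quad]
  · obtain ⟨s, hs, hc⟩ := quad_cases n
    simp only [Bz_far h, Gz, quad_far n]
    rcases hc with hc | hc | hc | hc <;> simp only [hc] <;> linarith

lemma Bz_cubic' (n : ℤ) (h1 : 1 ≤ n) :
    Bz (n - 1) + (Bz (n - 4) + 3 * Bz (n - 7)) ≤ Bz n := by
  rcases lt_or_ge n 18 with h | h
  · interval_cases n <;> norm_num [Bz, Gz, Fz, quad]
  · obtain ⟨s, hs, hc⟩ := quad_cases n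
    simp only [Bz_far h, Gz, quad_far n]
    rcases hc with hc | hc | hc | hc <;> simp only [hc] <;> linarith

lemma Bz_large (n : ℤ) (h1 : 5 ≤ n) :
    Bz (n - 1) + (Bz (n - 5) + 4 * Fz (n - 8)) ≤ Bz n := by
  rcases lt_or_ge n 18 with h | h
  · interval_cases n <;> norm_num [Bz, Gz, Fz, quad]
  · obtain ⟨s, hs, hc⟩ := quad_cases n
    simp only [Bz_far h, Gz, Fz, quad_far n]
    rcases hc with hc | hc | hc | hc <;> simp only [hc] <;> linarith

lemma Bz_path_one (n : ℤ) (h1 : 3 ≤ n) :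
    Bz (n - 3) + (Bz (n - 4) + (Bz (n - 4) + (Bz (n - 4) + (Bz (n - 5) + (Bz (n - 6) + Bz (n - 7)))))) ≤ Bz n := by
  rcases lt_or_ge n 18 with h | h
  · interval_cases n <;> norm_num [Bz, Gz, Fz, quad]
  · obtain ⟨s, hs, hc⟩ := quad_cases n
    simp only [Bz_far h, Gz, quad_far n]
    rcases hc with hc | hc | hc | hc <;> simp only [hc] <;> linarith

lemma Bz_path_two (n : ℤ) (h1 : 4 ≤ n) :
    Bz (n - 3) + (Bz (n - 4) + (Bz (n - 4) + (Bz (n - 5) + (Bz (n - 5) + (Bz (n - 6) + 2 * Bz (n - 7)))))) ≤ Bz n := by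
  rcases lt_or_ge n 18 with h | h
  · interval_cases n <;> norm_num [Bz, Gz, Fz, quad]
  · obtain ⟨s, hs, hc⟩ := quad_cases n
    simp only [Bz_far h, Gz, quad_far n]
    rcases hc with hc | hc | hc | hc <;> simp only [hc] <;> linarith

lemma Bz_path_three (n : ℤ) (h1 : 5 ≤ n) :
    Bz (n - 3) + (Bz (n - 4) + (Bz (n - 4) + (Bz (n - 6) + (Bz (n - 5) + (Bz (n - 6) + 3 * Fz (n - 8)))))) ≤ Bz n := by
  rcases lt_or_ge n 18 with h | h
  · interval_cases n <;> norm_num [Bz, Gz, Fz, quad]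
  · obtain ⟨s, hs, hc⟩ := quad_cases n
    simp only [Bz_far h, Gz, Fz, quad_far n]
    rcases hc with hc | hc | hc | hc <;> simp only [hc] <;> linarith

lemma Bz_two_one_two (n : ℤ) (h1 : 4 ≤ n) :
    Bz (n - 3) + (Bz (n - 4) + (Bz (n - 5) + (2 * Bz (n - 5) +
      (Bz (n - 6) + (Bz (n - 6) + Bz (n - 5)))))) ≤ Bz n := by
  rcases lt_or_ge n 18 with h | h
  · interval_cases n <;> norm_num [Bz, Gz, Fz, quad]
  · obtain ⟨s, hs, hc⟩ := quad_cases n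
    simp only [Bz_far h, Gz, quad_far n]
    rcases hc with hc | hc | hc | hc <;> simp only [hc] <;> linarith

lemma Bz_two_one_three (n : ℤ) (h1 : 5 ≤ n) :
    Bz (n - 3) + (Bz (n - 4) + (Bz (n - 6) + (3 * Fz (n - 6) +
      (Bz (n - 7) + (Bz (n - 7) + Bz (n - 5)))))) ≤ Bz n := by
  rcases lt_or_ge n 18 with h | h
  · interval_cases n <;> norm_num [Bz, Gz, Fz, quad]
  · obtain ⟨s, hs, hc⟩ := quad_cases n
    simp only [Bz_far h, Gz, Fz, quad_far n]
    rcases hc with hc | hc | hc | hc <;> simp only [hc] <;> linarith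

/-- The factor 24/25 is spare in the present case but is exactly what `Bz_cubic` consumes. It is
available when both neighbours of the vertex of degree two have degree at least three. -/
lemma Bz_two_two_two (n : ℤ) (h1 : 4 ≤ n) :
    Bz (n - 3) + (Bz (n - 5) + (Bz (n - 5) + (2 * Bz (n - 5) +
      (Bz (n - 7) + (2 * Bz (n - 7) + 2 * Bz (n - 6)))))) ≤ 24 / 25 * Bz n := by
  rcases lt_or_ge n 18 with h | h
  · interval_cases n <;> norm_num [Bz, Gz, Fz, quad]
  · obtain ⟨s, hs, hc⟩ := quad_cases n
    simp only [Bz_far h, Gz, quad_far n]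
    rcases hc with hc | hc | hc | hc <;> simp only [hc] <;> linarith

lemma Bz_two_two_three (n : ℤ) (h1 : 5 ≤ n) :
    Bz (n - 3) + (Bz (n - 5) + (Bz (n - 6) + (3 * Fz (n - 6) +
      (Bz (n - 8) + (2 * Bz (n - 8) + 2 * Bz (n - 6)))))) ≤ 24 / 25 * Bz n := by
  rcases lt_or_ge n 18 with h | h
  · interval_cases n <;> norm_num [Bz, Gz, Fz, quad]
  · obtain ⟨s, hs, hc⟩ := quad_cases n
    simp only [Bz_far h, Gz, Fz, quad_far n]
    rcases hc with hc | hc | hc | hc <;> simp only [hc] <;> linarith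

lemma Bz_two_three_three (n : ℤ) (h1 : 5 ≤ n) :
    Bz (n - 3) + (Bz (n - 6) + (Bz (n - 6) + (3 * Fz (n - 6) +
      (Bz (n - 9) + (3 * Fz (n - 9) + 3 * Fz (n - 7)))))) ≤ 24 / 25 * Bz n := by
  rcases lt_or_ge n 18 with h | h
  · interval_cases n <;> norm_num [Bz, Gz, Fz, quad]
  · obtain ⟨s, hs, hc⟩ := quad_cases n
    simp only [Bz_far h, Gz, Fz, quad_far n]
    rcases hc with hc | hc | hc | hc <;> simp only [hc] <;> linarith

/-! ### The bound for graphs without four-cycles -/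

lemma card_nb_lt {W : Finset V} {v : V} (hv : v ∈ W) : #(nb G W v) + 1 ≤ #W := by
  have h : insert v (nb G W v) ⊆ W := insert_subset hv (filter_subset _ _)
  have := card_le_card h
  rwa [card_insert_of_notMem (by simp [mem_nb])] at this

/-- Degree-two vertices, when one neighbour has degree at least three. -/
lemma deg_two_Bz {W : Finset V} (hf : Bdd G Bz W) (ht : TF G) (hc : NoC4 G W)
    {v a b : V} (hv : v ∈ W) (hab : a ≠ b) (hnv : nb G W v = {a, b}) {p q : ℕ}
    (hp : #(nb G W a) = p + 1) (hq : #(nb G W b) = q + 1)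
    (ha2 : ∀ x ∈ nb G W a, 2 ≤ #(nb G W x)) (hb2 : ∀ x ∈ nb G W b, 2 ≤ #(nb G W x))
    (hp1 : 1 ≤ p) (hpq : p ≤ q) (hq2 : 2 ≤ q) :
    (ph G W : ℚ) ≤ Bz #W ∧ (2 ≤ p → (ph G W : ℚ) ≤ 24 / 25 * Bz #W) := by
  have h := deg_two_le hf ht hc hv hab hnv hp hq ha2 hb2
  have hn := card_nb_lt (G := G) (nb_pair hnv).2.1
  generalize hm : (#W : ℤ) = n at *
  have hn' : (q : ℤ) + 2 ≤ n := by omega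
  have hn0 := Bz_nonneg n
  rcases hpq.eq_or_lt with rfl | hlt
  · rcases hp1.eq_or_lt with rfl | hp2
    · omega
    rcases (show 2 ≤ p by omega).eq_or_lt with rfl | hp3
    · push_cast at h
      have := Bz_two_two_two n (by omega)
      exact ⟨by linarith, fun _ => by linarith⟩
    · have h1 : Bz (n - (3 + p : ℕ)) ≤ Bz (n - 6) := Bz_mono (by omega)
      have h2 : Bz (n - (3 + p + p : ℕ)) ≤ Bz (n - 9) := Bz_mono (by omega)
      have h3 := mul_Bz_le (n - 3) 3 p le_rfl hp3
      have h4 := mul_Bz_le (n - 6) 3 p le_rfl hp3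
      have h5 := mul_Bz_le (n - 4) 3 p le_rfl hp3
      have h6 : (p : ℚ) * Bz (n - (3 + p + p : ℕ)) ≤ p * Bz (n - 6 - p) :=
        mul_le_mul_of_nonneg_left (Bz_mono (by push_cast; omega)) (by positivity)
      have := Bz_two_three_three n (by omega)
      rw [show n - 3 - (p : ℤ) = n - (3 + p : ℕ) by push_cast; ring, show n - 3 - ((3 : ℕ) : ℤ) = n - 6 by push_cast; ring] at h3
      rw [show n - 6 - ((3 : ℕ) : ℤ) = n - 9 by push_cast; ring] at h4
      rw [show n - 4 - (p : ℤ) = n - (4 + p : ℕ) by push_cast; ring, show n - 4 - ((3 : ℕ) : ℤ) = n - 7 by push_cast; ring] at h5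
      push_cast at h3 h4 h5
      exact ⟨by push_cast at *; linarith, fun _ => by push_cast at *; linarith⟩
  · rcases hp1.eq_or_lt with rfl | hp2
    · refine ⟨?_, fun h => by omega⟩
      rcases hq2.eq_or_lt with rfl | hq3
      · push_cast at h
        norm_num at h
        have := Bz_two_one_two n (by omega)
        linarith
      · have h1 : Bz (n - (3 + q : ℕ)) ≤ Bz (n - 6) := Bz_mono (by omega)
        have h2 : Bz (n - (3 + 1 + q : ℕ)) ≤ Bz (n - 7) := Bz_mono (by omega)
        have h3 := mul_Bz_le (n - 3) 3 q le_rfl hq3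
        have := Bz_two_one_three n (by omega)
        rw [show n - 3 - (q : ℤ) = n - (3 + q : ℕ) by push_cast; ring, show n - 3 - ((3 : ℕ) : ℤ) = n - 6 by push_cast; ring] at h3
        push_cast at *
        norm_num at *
        linarith
    · rcases (show 2 ≤ p by omega).eq_or_lt with rfl | hp3
      · have h1 : Bz (n - (3 + q : ℕ)) ≤ Bz (n - 6) := Bz_mono (by omega)
        have h2 : Bz (n - (3 + 2 + q : ℕ)) ≤ Bz (n - 8) := Bz_mono (by omega)
        have h3 := mul_Bz_le (n - 3) 3 q le_rfl (by omega)
        have := Bz_two_two_three n (by omega)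
        rw [show n - 3 - (q : ℤ) = n - (3 + q : ℕ) by push_cast; ring, show n - 3 - ((3 : ℕ) : ℤ) = n - 6 by push_cast; ring] at h3
        push_cast at *
        norm_num at *
        exact ⟨by linarith, by linarith⟩
      · have h0 : Bz (n - (3 + p : ℕ)) ≤ Bz (n - 6) := Bz_mono (by omega)
        have h1 : Bz (n - (3 + q : ℕ)) ≤ Bz (n - 6) := Bz_mono (by omega)
        have h2 : Bz (n - (3 + p + q : ℕ)) ≤ Bz (n - 9) := Bz_mono (by omega)
        have h3 := mul_Bz_le (n - 3) 3 q le_rfl (by omega)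
        have h4 := mul_Bz_le (n - 6) 3 p le_rfl hp3
        have h5 := mul_Bz_le (n - 4) 3 p le_rfl hp3
        have h6 : (p : ℚ) * Bz (n - (3 + p + q : ℕ)) ≤ p * Bz (n - 6 - p) :=
          mul_le_mul_of_nonneg_left (Bz_mono (by push_cast; omega)) (by positivity)
        have := Bz_two_three_three n (by omega)
        rw [show n - 3 - (q : ℤ) = n - (3 + q : ℕ) by push_cast; ring, show n - 3 - ((3 : ℕ) : ℤ) = n - 6 by push_cast; ring] at h3
        rw [show n - 6 - ((3 : ℕ) : ℤ) = n - 9 by push_cast; ring] at h4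
        rw [show n - 4 - (p : ℤ) = n - (4 + p : ℕ) by push_cast; ring, show n - 4 - ((3 : ℕ) : ℤ) = n - 7 by push_cast; ring] at h5
        push_cast at h3 h4 h5
        exact ⟨by push_cast at *; linarith, fun _ => by push_cast at *; linarith⟩

lemma leaf_Bz {W : Finset V} (hf : Bdd G Bz W) (ht : TF G) {v u : V} (hv : nb G W v = {u}) (hvW : v ∈ W) :
    (ph G W : ℚ) ≤ Bz #W := by
  have hu : u ∈ nb G W v := by simp [hv]
  obtain ⟨huW, hvu⟩ := mem_nb.1 hu
  have hvu' : v ∈ nb G W u := mem_nb.2 ⟨hvW, hvu.symm⟩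
  have hn := card_nb_lt (G := G) huW
  have hd0 : 0 < #(nb G W u) := card_pos.2 ⟨v, hvu'⟩
  rcases (show 1 ≤ #(nb G W u) by omega).eq_or_lt with h1 | h2
  · obtain ⟨w, hw⟩ := card_eq_one.1 h1.symm
    rw [hw, mem_singleton] at hvu'
    subst hvu'
    have := edge_component_le hf ht hv hw
    exact this.trans (Bz_edge _ (by omega))
  · have h := leaves_le hf ht (k := 1) huW (L := {v}) (by simpa using hvu') (by simp)
      (by simpa using hv) (fun x hx _ => card_pos.2 ⟨u, mem_nb.2 ⟨huW, (mem_nb.1 hx).2.symm⟩⟩)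
    rw [card_singleton] at h
    generalize hd : #(nb G W u) = d at *
    generalize hm : (#W : ℤ) = n at *
    rw [Nat.cast_sub (by omega)] at h
    rcases (show 2 ≤ d by omega).eq_or_lt with rfl | h3
    · have := Bz_leaf_two n (by omega)
      norm_num at h; linarith
    rcases (show 3 ≤ d by omega).eq_or_lt with rfl | h4
    · have := Bz_leaf_three n (by omega)
      norm_num at h; linarith
    · have := Bz_leaf_four n (by omega)
      have h5 := mul_Bz_le (n - 1) 4 d (by omega) h4
      rw [show n - 1 - (d : ℤ) = n - (1 + d : ℕ) by push_cast; ring, show n - 1 - ((4 : ℕ) : ℤ) = n - 5 by push_cast; ring] at h5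
      push_cast at *
      norm_num at *
      linarith

/-- Degrees 0, 1 and 2 give recursions that decide several vertices in every class. From minimum
degree three on, the branching is on whether a vertex is out, isolated or matched. The branch where
it is out removes only one vertex and is expensive. It is compensated by a cubic neighbour, which
drops to degree two and brings the factor 24/25, or else by the large degrees of the neighbours in
the matched branches. -/
theorem noC4_le (ht : TF G) (W : Finset V) (hc : NoC4 G W) : (ph G W : ℚ) ≤ Bz #W := by
  induction W using Finset.strongInduction with
  | H W ih =>
  have hf : Bdd G Bz W := ⟨Bz_mono, fun W' h => ih W' h (hc.subset h.1)⟩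
  rcases W.eq_empty_or_nonempty with rfl | hW
  · have : ph G ∅ ≤ 1 := card_le_card (show MD G ∅ ⊆ {∅} from fun F hF =>
      mem_singleton.2 (subset_empty.1 (MD_sub hF)))
    simpa [Bz] using (by exact_mod_cast this : (ph G ∅ : ℚ) ≤ 1)
  have hpos : (1 : ℤ) ≤ #W := by have := card_pos.2 hW; omega
  by_cases h0 : ∃ v ∈ W, #(nb G W v) = 0
  · obtain ⟨v, hv, h⟩ := h0
    exact (isolated_le hf hv (card_eq_zero.1 h)).trans (Bz_mono (by omega))
  by_cases h1 : ∃ v ∈ W, #(nb G W v) = 1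
  · obtain ⟨v, hv, h⟩ := h1
    obtain ⟨u, hu⟩ := card_eq_one.1 h
    exact leaf_Bz hf ht hu hv
  push Not at h0 h1
  have hmin : ∀ v ∈ W, 2 ≤ #(nb G W v) := fun v hv => by
    have := h0 v hv; have := h1 v hv; omega
  have hminn : ∀ v ∈ W, ∀ x ∈ nb G W v, 2 ≤ #(nb G W x) := fun v hv x hx => hmin x (mem_nb.1 hx).1
  by_cases h2 : ∃ v ∈ W, #(nb G W v) = 2
  · obtain ⟨v, hv, h⟩ := h2
    obtain ⟨a, b, hab, hnv⟩ := card_eq_two.1 h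
    obtain ⟨haW, hbW, hva, hvb, hv'⟩ := nb_pair hnv
    have ha := hmin a haW
    have hb := hmin b hbW
    obtain ⟨p, hp⟩ : ∃ p, #(nb G W a) = p + 1 := ⟨_, (Nat.sub_add_cancel (by omega)).symm⟩
    obtain ⟨q, hq⟩ : ∃ q, #(nb G W b) = q + 1 := ⟨_, (Nat.sub_add_cancel (by omega)).symm⟩
    by_cases h3 : 2 ≤ q ∧ p ≤ q
    · exact (deg_two_Bz hf ht hc hv hab hnv hp hq (hminn a haW) (hminn b hbW) (by omega) h3.2 h3.1).1
    by_cases h4 : 2 ≤ p ∧ q ≤ p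
    · exact (deg_two_Bz hf ht hc hv hab.symm (by rw [hnv, pair_comm]) hq hp (hminn b hbW)
        (hminn a haW) (by omega) h4.2 h4.1).1
    have hp1 : p = 1 := by omega
    have hq1 : q = 1 := by omega
    have key : ∀ x, G.Adj v x → #(nb G W x) = 2 → ∃ x', v ≠ x' ∧ nb G W x = {v, x'} := by
      intro x hvx hx
      obtain ⟨y, z, hyz, hxn⟩ := card_eq_two.1 hx
      have : v ∈ nb G W x := mem_nb.2 ⟨hv, hvx.symm⟩
      rw [hxn] at this
      rcases mem_insert.1 this with rfl | h
      · exact ⟨z, hyz, hxn⟩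
      · rw [mem_singleton] at h; subst h
        exact ⟨y, hyz.symm, by rw [hxn, pair_comm]⟩
    obtain ⟨a', hva', hna⟩ := key a hva (by omega)
    obtain ⟨b', hvb', hnb⟩ := key b hvb (by omega)
    by_cases hadj : G.Adj a' b'
    · exact (five_cycle_le hf ht hc hv hab hnv hna hnb hva' hvb' hadj).trans (Bz_five_cycle _ hpos)
    · obtain ⟨D, hD, h⟩ := deg_two_path_le hf Bz_nonneg ht hc hv hab hnv hna hnb hva' hvb' hadj
      have ha'W := (nb_pair hna).2.1
      have h := h (hmin b' (nb_pair hnb).2.1)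
      have hn := card_nb_lt (G := G) ha'W
      have hD1 := hmin a' ha'W
      rw [← hD] at hn hD1
      generalize hm : (#W : ℤ) = n at *
      refine h.trans ?_
      rcases (show 1 ≤ D by omega).eq_or_lt with rfl | hD2
      · have := Bz_path_one n (by omega)
        norm_num at *; linarith
      rw [if_neg (by omega)]
      rcases (show 2 ≤ D by omega).eq_or_lt with rfl | hD3
      · have := Bz_path_two n (by omega)
        norm_num at *; linarith
      · have := Bz_path_three n (by omega)
        have h1 : Bz (n - (3 + D : ℕ)) ≤ Bz (n - 6) := Bz_mono (by omega)
        have h5 := mul_Bz_le (n - 5) 3 D le_rfl hD3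
        rw [show n - 5 - (D : ℤ) = n - (5 + D : ℕ) by push_cast; ring, show n - 5 - ((3 : ℕ) : ℤ) = n - 8 by push_cast; ring] at h5
        push_cast at *
        linarith
  push Not at h2
  have hmin3 : ∀ v ∈ W, 3 ≤ #(nb G W v) := fun v hv => by
    have := hmin v hv; have := h2 v hv; omega
  have hout : ∀ v ∈ W, (ph G (W \ {v}) : ℚ) ≤ Bz (#W - 1) := by
    intro v hv
    refine (hf.2 _ (sdiff_ssubset (by simpa using hv) (by simp))).trans (Bz_mono ?_)
    have := card_sdiff_add_card_eq_card (show {v} ⊆ W by simpa using hv)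
    rw [card_singleton] at this
    omega
  by_cases h3 : ∃ v ∈ W, #(nb G W v) = 3
  · obtain ⟨v, hv, h⟩ := h3
    by_cases h4 : ∃ u ∈ nb G W v, #(nb G W u) = 3
    · obtain ⟨u, hu, hu3⟩ := h4
      obtain ⟨huW, hvu⟩ := mem_nb.1 hu
      have hvn : v ∈ nb G W u := mem_nb.2 ⟨hv, hvu.symm⟩
      have hnb' : ∀ x, nb G (W \ {v}) x = (nb G W x).erase v := by
        intro x; ext y; simp only [mem_nb, mem_sdiff, mem_singleton, mem_erase]; tauto
      have hle : ∀ x, #(nb G W x) ≤ #(nb G (W \ {v}) x) + 1 := fun x => by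
        rw [hnb']; exact Nat.sub_le_iff_le_add.1 pred_card_le_card_erase
      have heq : ∀ x, ¬ G.Adj v x → nb G (W \ {v}) x = nb G W x := fun x hx => by
        rw [hnb', erase_eq_of_notMem]
        intro h; exact hx (mem_nb.1 h).2.symm
      have hu2 : #(nb G (W \ {v}) u) = 2 := by
        rw [hnb', card_erase_of_mem hvn, hu3]
      obtain ⟨a, b, hab, hnu⟩ := card_eq_two.1 hu2
      obtain ⟨haW, hbW, hua, hub, -⟩ := nb_pair hnu
      have hva : ¬ G.Adj v a := ht v u a hvu hua
      have hvb : ¬ G.Adj v b := ht v u b hvu hub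
      have ha3 := hmin3 a (sdiff_subset haW)
      have hb3 := hmin3 b (sdiff_subset hbW)
      rw [← heq a hva] at ha3
      rw [← heq b hvb] at hb3
      obtain ⟨p, hp⟩ : ∃ p, #(nb G (W \ {v}) a) = p + 1 := ⟨_, (Nat.sub_add_cancel (by omega)).symm⟩
      obtain ⟨q, hq⟩ : ∃ q, #(nb G (W \ {v}) b) = q + 1 := ⟨_, (Nat.sub_add_cancel (by omega)).symm⟩
      have hm2 : ∀ y, ∀ x ∈ nb G (W \ {v}) y, 2 ≤ #(nb G (W \ {v}) x) := fun y x hx => by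
        have := hmin3 x (sdiff_subset (mem_nb.1 hx).1)
        have := hle x
        omega
      have hf' := hf.subset (sdiff_subset (s := W) (t := {v}))
      have hc' := hc.subset (sdiff_subset (s := W) (t := {v}))
      have huW' : u ∈ W \ {v} := by simp [huW, hvu.ne.symm]
      have hcard : (#(W \ {v}) : ℤ) = #W - 1 := by
        have := card_sdiff_add_card_eq_card (show {v} ⊆ W by simpa using hv)
        rw [card_singleton] at this
        omega
      -- After the deletion of `v` its cubic neighbour `u` has degree two. The other neighbours of
      -- `u` are not adjacent to `v`, so they keep degree at least three, and the improved form of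
      -- `deg_two_Bz` applies.
      have hmain : (ph G (W \ {v}) : ℚ) ≤ 24 / 25 * Bz #(W \ {v}) := by
        rcases le_total p q with hpq | hpq
        · exact (deg_two_Bz hf' ht hc' huW' hab hnu hp hq (hm2 a) (hm2 b) (by omega) hpq
            (by omega)).2 (by omega)
        · exact (deg_two_Bz hf' ht hc' huW' hab.symm (by rw [hnu, pair_comm]) hq hp (hm2 b) (hm2 a)
            (by omega) hpq (by omega)).2 (by omega)
      rw [hcard] at hmain
      have := vertex_le hf ht hv (X := ∅) (k := 3) (l := 0) (by simp)
        (fun x hx _ => hmin3 x (mem_nb.1 hx).1) (by simp)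
      rw [h] at this
      have h5 := Bz_cubic _ hpos
      norm_num at this
      linarith
    · push Not at h4
      have := vertex_le hf ht hv (X := ∅) (k := 4) (l := 0) (by simp)
        (fun x hx _ => by have := hmin3 x (mem_nb.1 hx).1; have := h4 x hx; omega) (by simp)
      rw [h] at this
      have h5 := Bz_cubic' _ hpos
      have := hout v hv
      norm_num at *
      linarith
  · push Not at h3
    have hmin4 : ∀ v ∈ W, 4 ≤ #(nb G W v) := fun v hv => by
      have := hmin3 v hv; have := h3 v hv; omega
    obtain ⟨v, hv⟩ := hW
    have := vertex_le hf ht hv (X := ∅) (k := 4) (l := 0) (by simp)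
        (fun x hx _ => hmin4 x (mem_nb.1 hx).1) (by simp)
    have hd := hmin4 v hv
    have hn := card_nb_lt (G := G) hv
    have ho := hout v hv
    generalize #(nb G W v) = d at *
    generalize hm : (#W : ℤ) = n at *
    have h5 := Bz_large n (by omega)
    have h6 : Bz (n - (d + 1 : ℕ)) ≤ Bz (n - 5) := Bz_mono (by omega)
    have h7 := mul_Bz_le (n - 4) 4 d (by omega) hd
    rw [show n - 4 - (d : ℤ) = n - (d + 4 : ℕ) by push_cast; ring, show n - 4 - ((4 : ℕ) : ℤ) = n - 8 by push_cast; ring] at h7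
    simp only [card_empty, Nat.sub_zero, Nat.cast_zero, zero_mul, zero_add] at this
    push_cast at *
    linarith

/-! ### Graphs with vertices of degree at most one -/

lemma Lz_leaf_aux (n : ℤ) : Fz (n - 1) ≤ Lz n ∧ Fz (n - 2) ≤ Lz n ∧
    Fz (n - 2) + (Fz (n - 3) + Fz (n - 4)) ≤ Lz n ∧
    Fz (n - 3) + 2 * Fz (n - 3) ≤ Lz n ∧
    Fz (n - 2) + (Fz (n - 4) + 2 * Fz (n - 5)) ≤ Lz n ∧
    Fz (n - 3) + (2 * Fz (n - 4) + Fz (n - 5)) ≤ Lz n ∧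
    Fz (n - 4) + 3 * Fz (n - 4) ≤ Lz n ∧
    Fz (n - 2) + (Fz (n - 5) + 3 * Fz (n - 6)) ≤ Lz n ∧
    Fz (n - 3) + 4 * Fz (n - 5) ≤ Lz n := by
  -- The values of `Lz` are all attained: by the third expression at residues 0 and 2, by the fifth
  -- at residue 1, and by the fourth at residue 3.
  obtain ⟨s, hs, hc⟩ := quad_cases n
  simp only [Fz, Lz, quad_far n]
  rcases hc with hc | hc | hc | hc <;> simp only [hc] <;>
    refine ⟨?_, ?_, ?_, ?_, ?_, ?_, ?_, ?_, ?_⟩ <;> linarith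

lemma Fz_lump (m : ℤ) {k p : ℕ} {j l : ℤ} (hk : 3 ≤ k) (h : k ≤ p) (hj : j = m - p)
    (hl : l = m - k) : (p : ℚ) * Fz j ≤ k * Fz l := by
  subst hj; subst hl; exact mul_Fz_le m k p hk h

/-- The bound for a leaf whose neighbour has large degree. -/
lemma leaf_large {W : Finset V} (hf : Bdd G Fz W) (ht : TF G) {v u : V} (hvW : v ∈ W)
    (hv : nb G W v = {u}) (hd : 4 ≤ #(nb G W u)) :
    (ph G W : ℚ) ≤ Fz (#W - 2) + (Fz (#W - 5) + 3 * Fz (#W - 6)) ∨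
    (ph G W : ℚ) ≤ Fz (#W - 3) + 4 * Fz (#W - 5) := by
  obtain ⟨huW, hvu⟩ := mem_nb.1 (hv ▸ mem_singleton_self u)
  have hvu' : v ∈ nb G W u := mem_nb.2 ⟨hvW, hvu.symm⟩
  have hpos : ∀ x ∈ nb G W u, 1 ≤ #(nb G W x) := fun x hx =>
    card_pos.2 ⟨u, mem_nb.2 ⟨huW, (mem_nb.1 hx).2.symm⟩⟩
  -- Using two leaves at `u` suffices when there are several. If `v` is the only one, all other
  -- neighbours of `u` have degree at least two, which enlarges their zones.
  by_cases h2 : ∃ x ∈ nb G W u, x ≠ v ∧ #(nb G W x) = 1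
  · right
    obtain ⟨x, hx, hxv, h1⟩ := h2
    have hxu : nb G W x = {u} := by
      obtain ⟨y, hy⟩ := card_eq_one.1 h1
      have : u ∈ nb G W x := mem_nb.2 ⟨huW, (mem_nb.1 hx).2.symm⟩
      rw [hy, mem_singleton] at this
      rw [hy, this]
    have h := leaves_le hf ht (k := 1) huW (L := {v, x})
      (by intro y hy; simp at hy; rcases hy with rfl | rfl <;> assumption) (by simp)
      (by intro y hy; simp at hy; rcases hy with rfl | rfl <;> assumption)
      (fun x hx _ => hpos x hx)
    rw [card_pair hxv.symm] at h
    generalize #(nb G W u) = d at *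
    generalize hm : (#W : ℤ) = n at *
    have h5 := Fz_lump (n - 1) (j := n - (1 + d : ℕ)) (l := n - 5) (by omega) hd
      (by push_cast; ring) (by norm_num; ring)
    rw [Nat.cast_sub (by omega)] at h
    norm_num at *
    linarith
  · left
    push Not at h2
    have h := leaves_le hf ht (k := 2) huW (L := {v}) (by simpa using hvu') (by simp)
      (by simpa using hv) (fun x hx hxv => by
        have := hpos x hx; have := h2 x hx (by simpa using hxv); omega)
    rw [card_singleton] at h
    generalize #(nb G W u) = d at *
    generalize hm : (#W : ℤ) = n at *
    have h5 := Fz_lump (n - 3) (j := n - (2 + d : ℕ)) (l := n - 6) (p := d - 1) (k := 3) le_rfl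
      (by omega) (by omega) (by norm_num; ring)
    have h6 : Fz (n - (1 + d : ℕ)) ≤ Fz (n - 5) := Fz_mono (by omega)
    push_cast at *
    norm_num at *
    linarith

/-- All leaves at `u` are treated together: they are all isolated in `F` once `u` is out. Large
degree of `u` is covered by `leaf_large`, which leaves finitely many pairs of degree and number of
leaves. -/
lemma low_degree_le {W : Finset V} (hf : Bdd G Fz W) (ht : TF G) {v : V} (hvW : v ∈ W)
    (h : #(nb G W v) ≤ 1) : (ph G W : ℚ) ≤ Lz #W := by
  obtain ⟨a1, a2, a3, a4, a5, a6, a7, a8, a9⟩ := Lz_leaf_aux #W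
  rcases Nat.le_one_iff_eq_zero_or_eq_one.1 h with h | h
  · exact (isolated_le hf hvW (card_eq_zero.1 h)).trans a1
  obtain ⟨u, hv⟩ := card_eq_one.1 h
  obtain ⟨huW, hvu⟩ := mem_nb.1 (hv ▸ mem_singleton_self u)
  have hvu' : v ∈ nb G W u := mem_nb.2 ⟨hvW, hvu.symm⟩
  have hpos : ∀ x ∈ nb G W u, 1 ≤ #(nb G W x) := fun x hx =>
    card_pos.2 ⟨u, mem_nb.2 ⟨huW, (mem_nb.1 hx).2.symm⟩⟩
  rcases le_or_gt 4 #(nb G W u) with hd | hd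
  · rcases leaf_large hf ht hvW hv hd with h | h
    · exact h.trans a8
    · exact h.trans a9
  have hd0 : 0 < #(nb G W u) := card_pos.2 ⟨v, hvu'⟩
  rcases (show 1 ≤ #(nb G W u) by omega).eq_or_lt with hd1 | hd1
  · obtain ⟨w, hw⟩ := card_eq_one.1 hd1.symm
    rw [hw, mem_singleton] at hvu'
    subst hvu'
    exact (edge_component_le hf ht hv hw).trans a2
  set L := (nb G W u).filter (fun x => #(nb G W x) = 1) with hL
  have hLv : v ∈ L := mem_filter.2 ⟨hvu', by simp [hv]⟩
  have h := leaves_le hf ht (k := 2) huW (L := L) (filter_subset _ _) ⟨v, hLv⟩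
    (fun x hx => by
      obtain ⟨hx, h1⟩ := mem_filter.1 hx
      obtain ⟨y, hy⟩ := card_eq_one.1 h1
      have : u ∈ nb G W x := mem_nb.2 ⟨huW, (mem_nb.1 hx).2.symm⟩
      rw [hy, mem_singleton] at this
      rw [hy, this])
    (fun x hx hxL => by
      have := hpos x hx
      have : #(nb G W x) ≠ 1 := fun h => hxL (mem_filter.2 ⟨hx, h⟩)
      omega)
  have hl1 : 1 ≤ #L := card_pos.2 ⟨v, hLv⟩
  have hl2 : #L ≤ #(nb G W u) := card_le_card (filter_subset _ _)
  generalize #L = l at *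
  generalize #(nb G W u) = d at *
  interval_cases d <;> interval_cases l <;> norm_num at h <;> linarith

lemma nb_mono {W W' : Finset V} (h : W' ⊆ W) (x : V) : nb G W' x ⊆ nb G W x :=
  filter_subset_filter _ h

/-- A class whose complement contains a vertex of degree at most one. -/
lemma cls_le_Lz {W : Finset V} (hf : Bdd G Fz W) (ht : TF G) {w : V} (hw : w ∈ W)
    (hw1 : #(nb G W w) ≤ 1) (I O T : Finset V) (k : ℕ)
    (hT : ∀ z ∈ T, z ∈ W ∧ (z ∈ I ∨ (∃ i ∈ I, G.Adj i z) ∨ z ∈ O)) (hk : k ≤ #T)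
    (hI : w ∉ I) (hI' : ∀ i ∈ I, ¬ G.Adj i w) (hO : w ∉ O) :
    (#(cls G W I O) : ℚ) ≤ Lz (#W - k) := by
  have hz : w ∈ W \ zone G W I O := by
    refine mem_sdiff.2 ⟨hw, fun h => ?_⟩
    rcases (mem_zone.1 h).2 with h | ⟨i, hi, h⟩ | h
    · exact hI h
    · exact hI' i hi h
    · exact hO h
  calc (#(cls G W I O) : ℚ) ≤ ph G (W \ zone G W I O) := by exact_mod_cast card_cls_le_ph W I O
    _ ≤ Lz #(W \ zone G W I O) := low_degree_le (hf.subset sdiff_subset) ht hz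
        ((card_le_card (nb_mono sdiff_subset w)).trans hw1)
    _ ≤ _ := Lz_mono (card_sdiff_zone hT hk)

lemma pair_le_Lz {W : Finset V} (hf : Bdd G Fz W) (ht : TF G) {w : V} (hw : w ∈ W)
    (hw1 : #(nb G W w) ≤ 1) {x y : V} (hxy : G.Adj x y) (k : ℕ)
    (hk : k ≤ #(nb G W x) + #(nb G W y)) (hx : ¬ G.Adj x w) (hy : ¬ G.Adj y w) :
    (#(cls G W {x, y} ∅) : ℚ) ≤ Lz (#W - k) := by
  refine cls_le_Lz hf ht hw hw1 _ _ (nb G W x ∪ nb G W y) k ?_ ?_ ?_ ?_ (by simp)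
  · intro z hz
    rcases mem_union.1 hz with hz | hz <;> rw [mem_nb] at hz
    · exact ⟨hz.1, Or.inr (Or.inl ⟨x, by simp, hz.2⟩)⟩
    · exact ⟨hz.1, Or.inr (Or.inl ⟨y, by simp, hz.2⟩)⟩
  · rw [card_union_of_disjoint]
    · exact hk
    · rw [disjoint_left]
      intro z h1 h2
      exact ht x z y (mem_nb.1 h1).2 (mem_nb.1 h2).2.symm hxy
  · simp only [mem_insert, mem_singleton, not_or]
    exact ⟨fun h => hy (h ▸ hxy.symm), fun h => hx (h ▸ hxy)⟩
  · simp [hx, hy]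

/-- A bound for graphs with two leaves that have distinct neighbours. -/
def Dz : ℤ → ℚ := quad (16 / 27) (74 / 75) (65 / 36) 3

/-- Only residues 0 and 1 matter, because `Dz` is applied after deleting two vertices from a graph
of residue 2 or 3. At residue 0 the third expression equals 16/27 exactly. -/
lemma Dz_aux (n : ℤ) (hn : n % 4 = 0 ∨ n % 4 = 1) : Fz (n - 2) ≤ Dz n ∧
    Fz (n - 4) + (Lz (n - 3) + Fz (n - 4)) ≤ Dz n ∧
    Lz (n - 2) + (Lz (n - 3) + Lz (n - 4)) ≤ Dz n ∧
    Lz (n - 2) + (Lz (n - 3) + Fz (n - 5)) ≤ Dz n ∧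
    Lz (n - 3) + 2 * Lz (n - 3) ≤ Dz n ∧
    Lz (n - 2) + (Lz (n - 4) + (Lz (n - 5) + Fz (n - 5))) ≤ Dz n ∧
    Lz (n - 3) + (2 * Lz (n - 4) + Fz (n - 5)) ≤ Dz n ∧
    Lz (n - 4) + 3 * Lz (n - 4) ≤ Dz n ∧
    Fz (n - 2) + (Fz (n - 5) + 3 * Fz (n - 6)) ≤ Dz n ∧
    Fz (n - 3) + 4 * Fz (n - 5) ≤ Dz n := by
  obtain ⟨s, hs, hc⟩ := quad_cases n
  simp only [Fz, Lz, Dz, quad_far n]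
  rcases hc with hc | hc | hc | hc
  · simp only [hc]
    refine ⟨?_, ?_, ?_, ?_, ?_, ?_, ?_, ?_, ?_, ?_⟩ <;> linarith
  · simp only [hc]
    refine ⟨?_, ?_, ?_, ?_, ?_, ?_, ?_, ?_, ?_, ?_⟩ <;> linarith
  · omega
  · omega

/-- The cover obtained from a set `L` of leaves adjacent to the same vertex `u`. -/
lemma leaves_cover {W : Finset V} {u : V} {L : Finset V}
    (hL : L ⊆ nb G W u) (hL0 : L.Nonempty) (hleaf : ∀ x ∈ L, nb G W x = {u}) {F : Finset V}
    (hF : F ∈ MD G W) : (u ∉ F ∧ F ∈ cls G W L ∅) ∨ ∃ x ∈ nb G W u, F ∈ cls G W {u, x} ∅ := by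
  have hleaf' : ∀ x ∈ L, ∀ y ∈ W, G.Adj x y → y = u := fun x hx y hy h => by
    have : y ∈ nb G W x := mem_nb.2 ⟨hy, h⟩
    simpa [hleaf x hx] using this
  by_cases huF : u ∈ F
  · rcases in_cases hF huF with h | ⟨y, hy, hyF, h⟩
    · exfalso
      obtain ⟨v, hv⟩ := hL0
      have hvW := (mem_nb.1 (hL hv)).1
      have huv := (mem_nb.1 (hL hv)).2
      have hvF : v ∉ F := cls_adj h (mem_singleton_self u) huv (by simpa using huv.ne.symm)
      rcases blocked hF hvW hvF with ⟨y, hy, z, hz, hne, h1, h2⟩ | ⟨y, hy, h1, z, hz, h2⟩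
      · exact hne ((hleaf' v hv y (MD_sub hF hy) h1).trans (hleaf' v hv z (MD_sub hF hz) h2).symm)
      · obtain rfl := hleaf' v hv y (MD_sub hF hy) h1
        exact cls_adj h (mem_singleton_self y) h2 (by simpa using h2.ne.symm) hz
    · exact Or.inr ⟨y, hy, h⟩
  · refine Or.inl ⟨huF, mem_cls.2 ⟨hF, fun x hx => ?_, fun z hz _ => ⟨fun i hi h => ?_, by simp⟩⟩⟩
    · refine mem_of_free hF (mem_nb.1 (hL hx)).1 fun y hy h => huF ?_
      exact hleaf' x hx y (MD_sub hF hy) h ▸ hy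
    · exact huF (hleaf' i hi z (MD_sub hF hz) h ▸ hz)

lemma nb_single {W : Finset V} {v u : V} (h : nb G W v = {u}) :
    u ∈ W ∧ G.Adj v u ∧ ∀ y ∈ W, G.Adj v y → y = u := by
  obtain ⟨hu, hvu⟩ := mem_nb.1 (h ▸ mem_singleton_self u)
  exact ⟨hu, hvu, fun y hy hvy => by simpa [h] using (mem_nb.2 ⟨hy, hvy⟩ : y ∈ nb G W v)⟩

lemma nb_eq_single {W : Finset V} {x u : V} (hu : u ∈ W) (hxu : G.Adj x u)
    (h : #(nb G W x) = 1) : nb G W x = {u} := by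
  obtain ⟨y, hy⟩ := card_eq_one.1 h
  have : u ∈ nb G W x := mem_nb.2 ⟨hu, hxu⟩
  rw [hy, mem_singleton] at this
  rw [hy, this]

/-- The branching at the neighbour `u` of the leaf `v` mostly leaves the other leaf `w` in the
remaining graph, which then obeys `Lz` instead of `Fz`. Only the class matching `u` with `u'`
reaches `w`. -/
lemma two_leaves_le {W : Finset V} (hf : Bdd G Fz W) (ht : TF G) {v u w u' : V} (hvW : v ∈ W)
    (hwW : w ∈ W) (hv : nb G W v = {u}) (hw : nb G W w = {u'}) (huu : u ≠ u') (hwu : w ≠ u)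
    (hn : #W % 4 = 0 ∨ #W % 4 = 1) : (ph G W : ℚ) ≤ Dz #W := by
  obtain ⟨a1, a2, a3, a4, a5, a6, a7, a8, a9, a10⟩ := Dz_aux #W (by omega)
  obtain ⟨huW, hvu, hv'⟩ := nb_single hv
  obtain ⟨-, hwu', hw'⟩ := nb_single hw
  have hvu' : v ∈ nb G W u := mem_nb.2 ⟨hvW, hvu.symm⟩
  have hwv : w ≠ v := by
    rintro rfl
    rw [hv] at hw
    exact huu (singleton_injective hw)
  have hpos : ∀ x ∈ nb G W u, 1 ≤ #(nb G W x) := fun x hx =>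
    card_pos.2 ⟨u, mem_nb.2 ⟨huW, (mem_nb.1 hx).2.symm⟩⟩
  have hw1 : #(nb G W w) ≤ 1 := by simp [hw]
  have huw : ¬ G.Adj u w := fun h => huu (hw' u huW h.symm)
  have hvw : ¬ G.Adj v w := fun h => hwu (hv' w hwW h)
  have hxw : ∀ x ∈ nb G W u, x ≠ u' → ¬ G.Adj x w := fun x hx hxu h =>
    hxu (hw' x (mem_nb.1 hx).1 h.symm)
  have hd0 : 0 < #(nb G W u) := card_pos.2 ⟨v, hvu'⟩
  -- classes leaving `w` untouched
  have hcls : ∀ L : Finset V, v ∈ L → L ⊆ nb G W u → (∀ x ∈ L, nb G W x = {u}) →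
      (#(cls G W L ∅) : ℚ) ≤ Lz (#W - (1 + #L : ℕ)) := by
    intro L hvL hL hleaf
    refine cls_le_Lz hf ht hwW hw1 _ _ (insert u L) _ ?_ ?_ ?_ ?_ (by simp)
    · intro z hz
      rcases mem_insert.1 hz with rfl | hz
      · exact ⟨huW, Or.inr (Or.inl ⟨v, hvL, hvu⟩)⟩
      · exact ⟨(mem_nb.1 (hL hz)).1, Or.inl hz⟩
    · rw [card_insert_of_notMem fun h => (mem_nb.1 (hL h)).2.ne rfl]
      omega
    · intro h
      have := hleaf w h
      rw [hw] at this
      exact huu (singleton_injective this).symm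
    · intro i hi h
      have := hleaf i hi
      have h2 : w ∈ nb G W i := mem_nb.2 ⟨hwW, h⟩
      rw [this, mem_singleton] at h2
      exact hwu h2
  have hpair : ∀ x ∈ nb G W u, x ≠ u' → ∀ k : ℕ, k ≤ #(nb G W u) + #(nb G W x) →
      (#(cls G W {u, x} ∅) : ℚ) ≤ Lz (#W - k) := fun x hx hxu k hk =>
    pair_le_Lz hf ht hwW hw1 (mem_nb.1 hx).2 k hk huw (hxw x hx hxu)
  have hpairF : ∀ x ∈ nb G W u, ∀ k : ℕ, k ≤ #(nb G W u) + #(nb G W x) →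
      (#(cls G W {u, x} ∅) : ℚ) ≤ Fz (#W - k) := fun x hx k hk =>
    pair_le hf ht huW (mem_nb.1 hx).1 (mem_nb.1 hx).2 k hk
  have hleafne : ∀ x ∈ nb G W u, #(nb G W x) = 1 → x ≠ u' := by
    rintro x hx h rfl
    have := nb_eq_single huW (mem_nb.1 hx).2.symm h
    have h2 : w ∈ nb G W x := mem_nb.2 ⟨hwW, hwu'.symm⟩
    rw [this, mem_singleton] at h2
    exact hwu h2
  have hvu'' : v ≠ u' := hleafne v hvu' (by simp [hv])
  have hleaf : ∀ x ∈ nb G W u, #(nb G W x) = 1 → nb G W x = {u} := fun x hx h =>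
    nb_eq_single huW (mem_nb.1 hx).2.symm h
  have hv1 : #(nb G W v) = 1 := by simp [hv]
  rcases le_or_gt 4 #(nb G W u) with hd | hd
  · rcases leaf_large hf ht hvW hv hd with h | h
    · exact h.trans a9
    · exact h.trans a10
  rcases (show #(nb G W u) = 1 ∨ #(nb G W u) = 2 ∨ #(nb G W u) = 3 by omega) with hd | hd | hd
  · exact (edge_component_le hf ht hv (nb_eq_single hvW hvu.symm hd)).trans a1
  · obtain ⟨x, hxv, hnu⟩ : ∃ x, x ≠ v ∧ nb G W u = {v, x} := by
      obtain ⟨y, z, hyz, h⟩ := card_eq_two.1 hd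
      rw [h] at hvu'
      rcases mem_insert.1 hvu' with rfl | h'
      · exact ⟨z, hyz.symm, h⟩
      · rw [mem_singleton] at h'; subst h'
        exact ⟨y, hyz, by rw [h, pair_comm]⟩
    have hx : x ∈ nb G W u := by simp [hnu]
    have cov : ∀ L : Finset V, v ∈ L → L ⊆ nb G W u → (∀ y ∈ L, nb G W y = {u}) →
        ∀ F ∈ MD G W, F ∈ cls G W L ∅ ∪ (cls G W {u, v} ∅ ∪ cls G W {u, x} ∅) := by
      intro L hvL hL hl F hF
      rcases leaves_cover hL ⟨v, hvL⟩ hl hF with ⟨-, h⟩ | ⟨y, hy, h⟩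
      · exact mem_union_left _ h
      · rw [hnu] at hy
        simp only [mem_insert, mem_singleton] at hy
        rcases hy with rfl | rfl
        · exact mem_union_right _ (mem_union_left _ h)
        · exact mem_union_right _ (mem_union_right _ h)
    have hsing : ({v} : Finset V) ⊆ nb G W u := by simpa using hvu'
    rcases (hpos x hx).eq_or_lt with h1 | h1
    · have hL : ({v, x} : Finset V) ⊆ nb G W u := by rw [hnu]
      have hl : ∀ y ∈ ({v, x} : Finset V), nb G W y = {u} := by
        intro y hy; simp only [mem_insert, mem_singleton] at hy
        rcases hy with rfl | rfl
        · exact hv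
        · exact hleaf y hx h1.symm
      have b1 := hcls _ (by simp) hL hl
      rw [card_pair hxv.symm] at b1
      have b2 := hpair v hvu' hvu'' 3 (by omega)
      have b3 := hpair x hx (hleafne x hx h1.symm) 3 (by omega)
      refine (ph_le_of_cover (cov _ (by simp) hL hl) (cu b1 (cu b2 b3))).trans ?_
      norm_num; linarith
    · have b1 := hcls {v} (by simp) hsing (by simpa using hv)
      rw [card_singleton] at b1
      have b2 := hpair v hvu' hvu'' 3 (by omega)
      by_cases hxu : x = u'
      · rcases (show 2 ≤ #(nb G W x) by omega).eq_or_lt with h2 | h2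
        -- Now `v, u, x, w` is a path component. If `u` is out, then `x` is in `F` and matched with
        -- its leaf `w`, so the class of `v` decides four vertices.
        · have hnx : nb G W x = {w, u} := by
            refine (eq_of_subset_of_card_le ?_ ?_).symm
            · intro y hy; simp only [mem_insert, mem_singleton] at hy
              rcases hy with rfl | rfl
              · exact mem_nb.2 ⟨hwW, hxu ▸ hwu'.symm⟩
              · exact mem_nb.2 ⟨huW, (mem_nb.1 hx).2.symm⟩
            · rw [card_pair hwu, ← h2]
          have hwx : w ≠ x := fun h => hwu'.ne (h.trans hxu)
          have hux : G.Adj u x := (mem_nb.1 hx).2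
          have b0 : (#(cls G W {v, x, w} ∅) : ℚ) ≤ Fz (#W - 4) := by
            refine cls_le hf _ _ {v, u, x, w} 4 ?_ ?_ (card_pos.2 ⟨v, by simp⟩)
            · intro z hz
              simp only [mem_insert, mem_singleton] at hz
              rcases hz with rfl | rfl | rfl | rfl
              · exact ⟨hvW, by simp⟩
              · exact ⟨huW, Or.inr (Or.inl ⟨v, by simp, hvu⟩)⟩
              · exact ⟨(mem_nb.1 hx).1, by simp⟩
              · exact ⟨hwW, by simp⟩
            · rw [card_insert_of_notMem (by simp [hvu.ne, hxv.symm, hwv.symm]),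
                card_insert_of_notMem (by simp [hux.ne, hwu.symm]), card_pair hwx.symm]
          have b3 := hpairF x hx 4 (by omega)
          refine (ph_le_of_cover (S := cls G W {v, x, w} ∅ ∪ (cls G W {u, v} ∅ ∪ cls G W {u, x} ∅))
            ?_ (cu b0 (cu b2 b3))).trans (by norm_num; linarith)
          intro F hF
          have hS := cov {v} (by simp) hsing (by simpa using hv) F hF
          simp only [mem_union] at hS ⊢
          rcases hS with h | h
          · left
            have huF : u ∉ F := cls_adj h (mem_singleton_self v) hvu (by simpa using hvu.ne.symm)
            have hu' : ∀ y ∈ W, G.Adj u y → y = v ∨ y = x := (nb_pair hnu).2.2.2.2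
            have hxF : x ∈ F := by
              rcases blocked hF huW huF with ⟨y, hy, z, hz, hne, h1, h2⟩ | ⟨y, hy, h1, z, hz, h2⟩
              · rcases hu' y (MD_sub hF hy) h1 with rfl | rfl
                · rcases hu' z (MD_sub hF hz) h2 with rfl | rfl
                  · exact absurd rfl hne
                  · exact hz
                · exact hy
              · rcases hu' y (MD_sub hF hy) h1 with rfl | rfl
                · exact absurd (hv' z (MD_sub hF hz) h2 ▸ hz) huF
                · exact hy
            rcases leaves_cover (L := {w}) (u := x) (by simp [hnx]) (by simp)
              (by simpa [hxu] using hw) hF with ⟨h', -⟩ | ⟨y, hy, h'⟩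
            · exact absurd hxF h'
            · rw [hnx] at hy
              simp only [mem_insert, mem_singleton] at hy
              rcases hy with rfl | rfl
              · exact cls_congr (cls_union h h') (by ext; simp [or_left_comm]) (by simp)
              · exact absurd (cls_in h' (by simp)) huF
          · exact Or.inr h
        · have b3 := hpairF x hx 5 (by omega)
          refine (ph_le_of_cover (cov {v} (by simp) hsing (by simpa using hv))
            (cu b1 (cu b2 b3))).trans (by norm_num; linarith)
      · have b3 := hpair x hx hxu 4 (by omega)
        refine (ph_le_of_cover (cov {v} (by simp) hsing (by simpa using hv))
          (cu b1 (cu b2 b3))).trans (by norm_num; linarith)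
  · obtain ⟨x, y, hxv, hyv, hxy, hnu⟩ : ∃ x y, x ≠ v ∧ y ≠ v ∧ x ≠ y ∧ nb G W u = {v, x, y} := by
      have : #((nb G W u).erase v) = 2 := by rw [card_erase_of_mem hvu', hd]
      obtain ⟨x, y, hxy, h⟩ := card_eq_two.1 this
      have h1 : x ∈ (nb G W u).erase v := by simp [h]
      have h2 : y ∈ (nb G W u).erase v := by simp [h]
      exact ⟨x, y, (mem_erase.1 h1).1, (mem_erase.1 h2).1, hxy, by rw [← insert_erase hvu', h]⟩
    have cov : ∀ x y, nb G W u = {v, x, y} → ∀ L : Finset V, v ∈ L → L ⊆ nb G W u →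
        (∀ y ∈ L, nb G W y = {u}) → ∀ F ∈ MD G W, F ∈ cls G W L ∅ ∪ (cls G W {u, v} ∅ ∪
        (cls G W {u, x} ∅ ∪ cls G W {u, y} ∅)) := by
      intro x y hnu L hvL hL hl F hF
      rcases leaves_cover hL ⟨v, hvL⟩ hl hF with ⟨-, h⟩ | ⟨z, hz, h⟩
      · exact mem_union_left _ h
      · rw [hnu] at hz
        simp only [mem_insert, mem_singleton] at hz
        rcases hz with rfl | rfl | rfl
        · exact mem_union_right _ (mem_union_left _ h)
        · exact mem_union_right _ (mem_union_right _ (mem_union_left _ h))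
        · exact mem_union_right _ (mem_union_right _ (mem_union_right _ h))
    have b2 := hpair v hvu' hvu'' 4 (by omega)
    have hsing : ({v} : Finset V) ⊆ nb G W u := by simpa using hvu'
    -- the case of exactly two leaves at `u`
    have two : ∀ x y, x ≠ v → nb G W u = {v, x, y} → #(nb G W x) = 1 → 1 < #(nb G W y) →
        (ph G W : ℚ) ≤ Dz #W := by
      intro x y hxv hnu h1 h2
      have hx : x ∈ nb G W u := by simp [hnu]
      have hy : y ∈ nb G W u := by simp [hnu]
      have hL : ({v, x} : Finset V) ⊆ nb G W u := by rw [hnu]; intro z; simp; tauto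
      have hl : ∀ y ∈ ({v, x} : Finset V), nb G W y = {u} := by
        intro y hy; simp only [mem_insert, mem_singleton] at hy
        rcases hy with rfl | rfl
        · exact hv
        · exact hleaf y hx h1
      have b1 := hcls _ (by simp) hL hl
      rw [card_pair hxv.symm] at b1
      have b3 := hpair x hx (hleafne x hx h1) 4 (by omega)
      have b4 := hpairF y hy 5 (by omega)
      refine (ph_le_of_cover (cov x y hnu _ (by simp) hL hl) (cu b1 (cu b2 (cu b3 b4)))).trans ?_
      norm_num; linarith
    have one : ∀ x y, nb G W u = {v, x, y} → 1 < #(nb G W x) → 1 < #(nb G W y) → x ≠ u' →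
        (ph G W : ℚ) ≤ Dz #W := by
      intro x y hnu h1 h2 hxu
      have hx : x ∈ nb G W u := by simp [hnu]
      have hy : y ∈ nb G W u := by simp [hnu]
      have b1 := hcls {v} (by simp) hsing (by simpa using hv)
      rw [card_singleton] at b1
      have b3 := hpair x hx hxu 5 (by omega)
      have b4 := hpairF y hy 5 (by omega)
      refine (ph_le_of_cover (cov x y hnu _ (by simp) hsing (by simpa using hv))
        (cu b1 (cu b2 (cu b3 b4)))).trans ?_
      norm_num; linarith
    have hx : x ∈ nb G W u := by simp [hnu]
    have hy : y ∈ nb G W u := by simp [hnu]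
    have hnu' : nb G W u = {v, y, x} := by rw [hnu, pair_comm x y]
    rcases (hpos x hx).eq_or_lt with h1 | h1 <;> rcases (hpos y hy).eq_or_lt with h2 | h2
    · have hl : ∀ z ∈ nb G W u, nb G W z = {u} := by
        intro z hz; refine hleaf z hz ?_
        rw [hnu] at hz; simp only [mem_insert, mem_singleton] at hz
        rcases hz with rfl | rfl | rfl
        · exact hv1
        · exact h1.symm
        · exact h2.symm
      have b1 := hcls _ hvu' (Subset.refl _) hl
      rw [hd] at b1
      have b3 := hpair x hx (hleafne x hx h1.symm) 4 (by omega)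
      have b4 := hpair y hy (hleafne y hy h2.symm) 4 (by omega)
      refine (ph_le_of_cover (cov x y hnu _ hvu' (Subset.refl _) hl)
        (cu b1 (cu b2 (cu b3 b4)))).trans ?_
      norm_num; linarith
    · exact two x y hxv hnu h1.symm h2
    · exact two y x hyv hnu' h2.symm h1
    · by_cases hxu : x = u'
      · exact one y x hnu' h2 h1 fun h => hxy (hxu.trans h.symm)
      · exact one x y hnu h1 h2 hxu

/-! ### Complete bipartite components and extremal graphs -/

/-- `A` and `B` are the parts of a complete bipartite component of the graph induced on `W`. -/
def Comp (G : SimpleGraph V) [DecidableRel G.Adj] (W A B : Finset V) : Prop :=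
  A ⊆ W ∧ B ⊆ W ∧ (∀ x ∈ A, nb G W x = B) ∧ (∀ y ∈ B, nb G W y = A)

/-- Every component of the graph induced on `W` is a four-cycle. -/
inductive C4s (G : SimpleGraph V) [DecidableRel G.Adj] : Finset V → Prop
  | nil : C4s G ∅
  | step {W A B : Finset V} : Comp G W A B → #A = 2 → #B = 2 → C4s G (W \ (A ∪ B)) → C4s G W

/-- The sizes of the parts of the exceptional component. -/
def Core (a b : ℕ) : Prop := (a = 1 ∧ b = 2) ∨ (a = 2 ∧ b = 3) ∨ (a = 3 ∧ b = 3)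

/-- The graph induced on `W` is extremal. -/
def Ext (G : SimpleGraph V) [DecidableRel G.Adj] (W : Finset V) : Prop :=
  C4s G W ∨ ∃ A B, Comp G W A B ∧ Core #A #B ∧ C4s G (W \ (A ∪ B))

lemma Comp.symm {W A B : Finset V} (h : Comp G W A B) : Comp G W B A :=
  ⟨h.2.1, h.1, h.2.2.2, h.2.2.1⟩

lemma Comp.adj {W A B : Finset V} (h : Comp G W A B) {x y : V} (hx : x ∈ A) (hy : y ∈ B) :
    G.Adj x y := by
  have := h.2.2.1 x hx
  rw [← this] at hy
  exact (mem_nb.1 hy).2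

lemma Comp.disjoint {W A B : Finset V} (h : Comp G W A B) : Disjoint A B := by
  rw [disjoint_left]
  intro x h1 h2
  exact (h.adj h1 h2).ne rfl

lemma Comp.sub {W A B : Finset V} (h : Comp G W A B) : A ∪ B ⊆ W := union_subset h.1 h.2.1

lemma Comp.closed {W A B : Finset V} (h : Comp G W A B) {x y : V} (hx : x ∈ A ∪ B) (hy : y ∈ W)
    (hxy : G.Adj x y) : y ∈ A ∪ B := by
  have hy' : y ∈ nb G W x := mem_nb.2 ⟨hy, hxy⟩
  rcases mem_union.1 hx with hx | hx
  · rw [h.2.2.1 x hx] at hy'; exact mem_union_right _ hy'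
  · rw [h.2.2.2 x hx] at hy'; exact mem_union_left _ hy'

lemma nb_sdiff_comp {W A B : Finset V} (h : Comp G W A B) {x : V} (hxW : x ∈ W) (hx : x ∉ A ∪ B) :
    nb G (W \ (A ∪ B)) x = nb G W x := by
  ext y
  simp only [mem_nb, mem_sdiff]
  constructor
  · rintro ⟨⟨h1, h2⟩, h3⟩; exact ⟨h1, h3⟩
  · rintro ⟨h1, h2⟩
    exact ⟨⟨h1, fun hy => hx (h.closed hy hxW h2.symm)⟩, h2⟩

lemma Comp.lift {W A B A' B' : Finset V} (h : Comp G W A B) (h' : Comp G (W \ (A ∪ B)) A' B') :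
    Comp G W A' B' := by
  refine ⟨h'.1.trans sdiff_subset, h'.2.1.trans sdiff_subset, fun x hx => ?_, fun x hx => ?_⟩
  · have := mem_sdiff.1 (h'.1 hx)
    rw [← nb_sdiff_comp h this.1 this.2, h'.2.2.1 x hx]
  · have := mem_sdiff.1 (h'.2.1 hx)
    rw [← nb_sdiff_comp h this.1 this.2, h'.2.2.2 x hx]

lemma Comp.restrict {W A B A' B' : Finset V} (h : Comp G W A B) (h' : Comp G W A' B')
    (hd : Disjoint (A ∪ B) (A' ∪ B')) : Comp G (W \ (A ∪ B)) A' B' := by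
  have hs : ∀ x ∈ A' ∪ B', x ∈ W \ (A ∪ B) := fun x hx =>
    mem_sdiff.2 ⟨h'.sub hx, fun h => disjoint_left.1 hd h hx⟩
  refine ⟨fun x hx => hs x (mem_union_left _ hx), fun x hx => hs x (mem_union_right _ hx),
    fun x hx => ?_, fun x hx => ?_⟩
  · have := mem_sdiff.1 (hs x (mem_union_left _ hx))
    rw [nb_sdiff_comp h this.1 this.2, h'.2.2.1 x hx]
  · have := mem_sdiff.1 (hs x (mem_union_right _ hx))
    rw [nb_sdiff_comp h this.1 this.2, h'.2.2.2 x hx]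

lemma Comp.card {W A B : Finset V} (h : Comp G W A B) : #(W \ (A ∪ B)) + (#A + #B) = #W := by
  rw [← card_union_of_disjoint h.disjoint, card_sdiff_add_card_eq_card h.sub]

lemma C4s.card {W : Finset V} (h : C4s G W) : #W % 4 = 0 := by
  induction h with
  | nil => rfl
  | step hc ha hb _ ih => have := hc.card; omega

lemma C4s.mem {W : Finset V} (h : C4s G W) {v : V} (hv : v ∈ W) :
    ∃ A B, Comp G W A B ∧ #A = 2 ∧ #B = 2 ∧ v ∈ A := by
  induction h with
  | nil => simp at hv
  | @step W A B hc ha hb _ ih =>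
    by_cases hvA : v ∈ A
    · exact ⟨A, B, hc, ha, hb, hvA⟩
    by_cases hvB : v ∈ B
    · exact ⟨B, A, hc.symm, hb, ha, hvB⟩
    obtain ⟨A', B', h1, h2, h3, h4⟩ := ih (mem_sdiff.2 ⟨hv, by simp [hvA, hvB]⟩)
    exact ⟨A', B', hc.lift h1, h2, h3, h4⟩

lemma Ext.step {W A B : Finset V} (h : Comp G W A B) (ha : #A = 2) (hb : #B = 2)
    (hE : Ext G (W \ (A ∪ B))) : Ext G W := by
  rcases hE with hE | ⟨A', B', hc, hcore, hE⟩
  · exact Or.inl (C4s.step h ha hb hE)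
  · refine Or.inr ⟨A', B', h.lift hc, hcore, ?_⟩
    have hd : Disjoint (A' ∪ B') (A ∪ B) := by
      rw [disjoint_left]; intro x h1 h2
      exact (mem_sdiff.1 (hc.sub h1)).2 h2
    refine C4s.step ((h.lift hc).restrict h hd) ha hb ?_
    rwa [sdiff_right_comm]

lemma Ext.c4s {W : Finset V} (h : Ext G W) (hW : #W % 4 = 0) : C4s G W := by
  rcases h with h | ⟨A, B, hc, hcore, h⟩
  · exact h
  · have := h.card; have := hc.card; unfold Core at hcore; omega

/-- The three possible cores have orders 3, 5 and 6, with distinct nonzero residues modulo 4, so the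
order alone determines the core. -/
lemma Ext.core {W : Finset V} (h : Ext G W) {a b : ℕ} (hab : Core a b) (hW : #W % 4 = (a + b) % 4) :
    ∃ A B, Comp G W A B ∧ #A = a ∧ #B = b ∧ C4s G (W \ (A ∪ B)) := by
  rcases h with h | ⟨A, B, hc, hcore, h⟩
  · have := h.card; unfold Core at hab; omega
  · have := h.card; have := hc.card; unfold Core at hcore hab
    exact ⟨A, B, hc, by omega, by omega, h⟩

/-- The conclusion of the main induction. -/
def Good (G : SimpleGraph V) [DecidableRel G.Adj] (W : Finset V) : Prop :=
  (ph G W : ℚ) ≤ Fz #W ∧ (Ext G W ∨ (ph G W : ℚ) < Kz #W)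

lemma Good.of_lt {W : Finset V} (h : (ph G W : ℚ) < Kz #W) : Good G W :=
  ⟨h.le.trans (Kz_le_Fz _), Or.inr h⟩

/-- The bound obtained from a complete bipartite component. -/
lemma comp_le {W A B : Finset V} (h : Comp G W A B) (hA : A.Nonempty) (hB : B.Nonempty) :
    (ph G W : ℚ) ≤ (#A * #B + 2) * ph G (W \ (A ∪ B)) := by
  have hz : ∀ I : Finset V, I ⊆ A ∪ B → (A ⊆ I ∨ (∃ y ∈ I, y ∈ B)) → (B ⊆ I ∨ (∃ x ∈ I, x ∈ A)) →
      (#(cls G W I ∅) : ℚ) ≤ ph G (W \ (A ∪ B)) := by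
    intro I hI h1 h2
    have hz : zone G W I ∅ = A ∪ B := by
      ext z
      rw [mem_zone]
      constructor
      · rintro ⟨hz, h | ⟨i, hi, hiz⟩ | h⟩
        · exact hI h
        · exact h.closed (hI hi) hz hiz
        · simp at h
      · intro hz
        refine ⟨h.sub hz, ?_⟩
        rcases mem_union.1 hz with hz | hz
        · rcases h1 with h1 | ⟨y, hy, hyB⟩
          · exact Or.inl (h1 hz)
          · exact Or.inr (Or.inl ⟨y, hy, (h.adj hz hyB).symm⟩)
        · rcases h2 with h1 | ⟨y, hy, hyA⟩
          · exact Or.inl (h1 hz)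
          · exact Or.inr (Or.inl ⟨y, hy, h.adj hyA hz⟩)
    have := card_cls_le_ph (G := G) W I ∅
    rw [hz] at this
    exact_mod_cast this
  have hcov : ∀ A B : Finset V, Comp G W A B → ∀ F ∈ MD G W, (∀ y ∈ B, y ∉ F) → F ∈ cls G W A ∅ := by
    intro A B h F hF hBF
    have hn : ∀ x ∈ A, ∀ z ∈ F, ¬ G.Adj x z := fun x hx z hz hxz => by
      have : z ∈ nb G W x := mem_nb.2 ⟨MD_sub hF hz, hxz⟩
      rw [h.2.2.1 x hx] at this
      exact hBF z this hz
    refine mem_cls.2 ⟨hF, fun x hx => mem_of_free hF (h.1 hx) (hn x hx), fun z hz _ =>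
      ⟨fun i hi => hn i hi z hz, by simp⟩⟩
  obtain ⟨x0, hx0⟩ := hA
  obtain ⟨y0, hy0⟩ := hB
  -- On the component, `F` is an edge, or it misses one part and then contains all of the other. The
  -- count is not sharp when a part is a single vertex; it is used only for C_4, K_{2,3} and
  -- K_{3,3}.
  have := ph_le_of_cover (W := W) (G := G)
    (S := A.biUnion (fun x => B.biUnion fun y => cls G W {x, y} ∅) ∪ (cls G W A ∅ ∪ cls G W B ∅)) ?_
    (cu (biUnion_le fun x hx => biUnion_le fun y hy => hz {x, y} ?_ (Or.inr ⟨y, by simp, hy⟩)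
      (Or.inr ⟨x, by simp, hx⟩)) (cu (hz A subset_union_left (Or.inl (Subset.refl _))
      (Or.inr ⟨x0, hx0, hx0⟩)) (hz B subset_union_right (Or.inr ⟨y0, hy0, hy0⟩)
      (Or.inl (Subset.refl _)))))
  · linarith
  · intro F hF
    simp only [mem_union, mem_biUnion]
    by_cases h1 : ∃ x ∈ A, x ∈ F
    · by_cases h2 : ∃ y ∈ B, y ∈ F
      · obtain ⟨x, hx, hxF⟩ := h1
        obtain ⟨y, hy, hyF⟩ := h2
        exact Or.inl ⟨x, hx, y, hy, pair_cls hF hxF hyF (h.adj hx hy)⟩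
      · push Not at h2
        exact Or.inr (Or.inl (hcov A B h F hF h2))
    · push Not at h1
      exact Or.inr (Or.inr (hcov B A h.symm F hF h1))
  · intro z; simp only [mem_insert, mem_singleton, mem_union]
    rintro (rfl | rfl)
    · exact Or.inl hx
    · exact Or.inr hy

/-- The induction hypothesis. -/
def IH (G : SimpleGraph V) [DecidableRel G.Adj] (W : Finset V) : Prop := ∀ W' ⊂ W, Good G W'

lemma IH.bdd {W : Finset V} (h : IH G W) : Bdd G Fz W := ⟨Fz_mono, fun W' h' => (h W' h').1⟩

lemma Fz_four (n : ℤ) : 6 * Fz (n - 4) = Fz n ∧ 6 * Kz (n - 4) = Kz n := by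
  simp only [Fz, Kz, quad_far n]; constructor <;> ring

lemma comp_ssubset {W A B : Finset V} (h : Comp G W A B) (hA : A.Nonempty) : W \ (A ∪ B) ⊂ W :=
  sdiff_ssubset h.sub (hA.mono subset_union_left)

lemma good_C4_comp {W A B : Finset V} (hI : IH G W) (h : Comp G W A B) (hA : #A = 2) (hB : #B = 2) :
    Good G W := by
  have hA0 : A.Nonempty := card_pos.1 (by omega)
  have h1 := comp_le h hA0 (card_pos.1 (by omega))
  rw [hA, hB] at h1
  obtain ⟨h2, h3⟩ := hI _ (comp_ssubset h hA0)
  have hc : (#(W \ (A ∪ B)) : ℤ) = #W - 4 := by have := h.card; omega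
  rw [hc] at h2 h3
  obtain ⟨e1, e2⟩ := Fz_four #W
  norm_num at h1
  refine ⟨by linarith, ?_⟩
  rcases h3 with h3 | h3
  · exact Or.inl (Ext.step h hA hB h3)
  · exact Or.inr (by linarith)

lemma core_numeric (n : ℤ) : 8 * Fz (n - 5) ≤ Fz n ∧ (n % 4 ≠ 1 → 8 * Fz (n - 5) < Kz n) ∧
    (n % 4 = 1 → 8 * Kz (n - 5) < Kz n) ∧
    (n % 4 = 2 → 11 * Fz (n - 6) ≤ Fz n ∧ 11 * Kz (n - 6) < Kz n) := by
  obtain ⟨s, hs, hc⟩ := quad_cases n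
  simp only [Fz, Kz, quad_far n]
  rcases hc with hc | hc | hc | hc <;> simp only [hc] <;>
    refine ⟨?_, ?_, ?_, ?_⟩ <;> norm_num <;> (try constructor) <;> linarith

lemma good_K23_comp {W A B : Finset V} (hI : IH G W) (h : Comp G W A B) (hA : #A = 2) (hB : #B = 3) :
    Good G W := by
  have hA0 : A.Nonempty := card_pos.1 (by omega)
  have h1 := comp_le h hA0 (card_pos.1 (by omega))
  rw [hA, hB] at h1
  obtain ⟨h2, h3⟩ := hI _ (comp_ssubset h hA0)
  have hcN := h.card
  have hc : (#(W \ (A ∪ B)) : ℤ) = #W - 5 := by omega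
  rw [hc] at h2 h3
  obtain ⟨e1, e2, e3, -⟩ := core_numeric #W
  norm_num at h1
  refine ⟨by linarith, ?_⟩
  by_cases hr : (#W : ℤ) % 4 = 1
  · rcases h3 with h3 | h3
    · exact Or.inl (Or.inr ⟨A, B, h, by unfold Core; omega, h3.c4s (by omega)⟩)
    · exact Or.inr (by linarith [e3 hr])
  · exact Or.inr (by linarith [e2 hr])

lemma good_K33_comp {W A B : Finset V} (hI : IH G W) (h : Comp G W A B) (hA : #A = 3) (hB : #B = 3)
    (hr : #W % 4 = 2) : Good G W := by
  have hA0 : A.Nonempty := card_pos.1 (by omega)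
  have h1 := comp_le h hA0 (card_pos.1 (by omega))
  rw [hA, hB] at h1
  obtain ⟨h2, h3⟩ := hI _ (comp_ssubset h hA0)
  have hcN := h.card
  have hc : (#(W \ (A ∪ B)) : ℤ) = #W - 6 := by omega
  rw [hc] at h2 h3
  obtain ⟨-, -, -, e⟩ := core_numeric #W
  obtain ⟨e1, e2⟩ := e (by omega)
  norm_num at h1
  refine ⟨by linarith, ?_⟩
  rcases h3 with h3 | h3
  · exact Or.inl (Or.inr ⟨A, B, h, by unfold Core; omega, h3.c4s (by omega)⟩)
  · exact Or.inr (by linarith)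

/-! ### The classes attached to a four-cycle -/

/-- `v, a, w, b` is a four-cycle of the graph induced on `W`. -/
structure IsC4 (G : SimpleGraph V) (W : Finset V) (v a w b : V) : Prop where
  hv : v ∈ W
  ha : a ∈ W
  hw : w ∈ W
  hb : b ∈ W
  va : G.Adj v a
  vb : G.Adj v b
  wa : G.Adj w a
  wb : G.Adj w b
  vw : v ≠ w
  ab : a ≠ b

namespace IsC4
variable {W : Finset V} {v a w b : V}

lemma rot (h : IsC4 G W v a w b) : IsC4 G W a v b w :=
  ⟨h.ha, h.hv, h.hb, h.hw, h.va.symm, h.wa.symm, h.vb.symm, h.wb.symm, h.ab, h.vw⟩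

lemma flip (h : IsC4 G W v a w b) : IsC4 G W w a v b :=
  ⟨h.hw, h.ha, h.hv, h.hb, h.wa, h.wb, h.va, h.vb, h.vw.symm, h.ab⟩

lemma flip' (h : IsC4 G W v a w b) : IsC4 G W v b w a :=
  ⟨h.hv, h.hb, h.hw, h.ha, h.vb, h.va, h.wb, h.wa, h.vw, h.ab.symm⟩

lemma nvw (h : IsC4 G W v a w b) (ht : TF G) : ¬ G.Adj v w := fun h' => ht v w a h' h.wa h.va

lemma nab (h : IsC4 G W v a w b) (ht : TF G) : ¬ G.Adj a b := h.rot.nvw ht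

lemma sub (h : IsC4 G W v a w b) : ({a, b} : Finset V) ⊆ nb G W v := by
  intro z; simp only [mem_insert, mem_singleton]
  rintro (rfl | rfl)
  · exact mem_nb.2 ⟨h.ha, h.va⟩
  · exact mem_nb.2 ⟨h.hb, h.vb⟩

lemma card_out (h : IsC4 G W v a w b) : #(nb G W v \ {a, b}) + 2 = #(nb G W v) := by
  rw [← card_pair h.ab, card_sdiff_add_card_eq_card h.sub]

lemma two_le (h : IsC4 G W v a w b) : 2 ≤ #(nb G W v) := by have := h.card_out; omega

lemma nb_eq (h : IsC4 G W v a w b) (h2 : #(nb G W v) = 2) : nb G W v = {a, b} :=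
  (eq_of_subset_of_card_le h.sub (by rw [card_pair h.ab, h2])).symm

/-- A set missing neither opposite pair contains one of `v, w` and one of `a, b`. These are always
adjacent, so they form a saturated edge. -/
lemma cover (h : IsC4 G W v a w b) {F : Finset V} (hF : F ∈ MD G W) :
    F ∈ cls G W {v, a} ∅ ∪ (cls G W {v, b} ∅ ∪ (cls G W {w, a} ∅ ∪ (cls G W {w, b} ∅ ∪
      (cls G W ∅ {a, b} ∪ cls G W ∅ {v, w})))) := by
  simp only [mem_union]
  have two : ∀ x y, x ∉ F → y ∉ F → F ∈ cls G W ∅ {x, y} := fun x y hx hy =>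
    out_cls hF (by simp [hx, hy])
  by_cases hv : v ∈ F
  · by_cases ha : a ∈ F
    · exact Or.inl (pair_cls hF hv ha h.va)
    by_cases hb : b ∈ F
    · exact Or.inr (Or.inl (pair_cls hF hv hb h.vb))
    exact Or.inr (Or.inr (Or.inr (Or.inr (Or.inl (two _ _ ha hb)))))
  by_cases hw : w ∈ F
  · by_cases ha : a ∈ F
    · exact Or.inr (Or.inr (Or.inl (pair_cls hF hw ha h.wa)))
    by_cases hb : b ∈ F
    · exact Or.inr (Or.inr (Or.inr (Or.inl (pair_cls hF hw hb h.wb))))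
    exact Or.inr (Or.inr (Or.inr (Or.inr (Or.inl (two _ _ ha hb)))))
  exact Or.inr (Or.inr (Or.inr (Or.inr (Or.inr (two _ _ hv hw)))))

lemma pair_le (h : IsC4 G W v a w b) {f : ℤ → ℚ} (hf : Bdd G f W) (ht : TF G) {p q : ℕ}
    (hp : #(nb G W v) = p + 2) (hq : #(nb G W a) = q + 2) :
    (#(cls G W {v, a} ∅) : ℚ) ≤ f (#W - (4 + p + q : ℕ)) :=
  DissociationSets.pair_le hf ht h.hv h.ha h.va _ (by omega)

/-- The parameters `p, q, r, s` count the neighbours outside the cycle. An edge class decides the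
four cycle vertices and the outer neighbours of its two ends. -/
lemma bound (h : IsC4 G W v a w b) {f : ℤ → ℚ} (hf : Bdd G f W) (ht : TF G) {p q r s : ℕ} {X Y : ℚ}
    (hp : #(nb G W v) = p + 2) (hq : #(nb G W w) = q + 2) (hr : #(nb G W a) = r + 2)
    (hs : #(nb G W b) = s + 2) (hX : (#(cls G W ∅ {a, b}) : ℚ) ≤ X)
    (hY : (#(cls G W ∅ {v, w}) : ℚ) ≤ Y) :
    (ph G W : ℚ) ≤ f (#W - (4 + p + r : ℕ)) + (f (#W - (4 + p + s : ℕ)) +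
      (f (#W - (4 + q + r : ℕ)) + (f (#W - (4 + q + s : ℕ)) + (X + Y)))) :=
  ph_le_of_cover (fun _ hF => h.cover hF) (cu (h.pair_le hf ht hp hr) (cu (h.flip'.pair_le hf ht hp hs)
    (cu (h.flip.pair_le hf ht hq hr) (cu (h.flip.flip'.pair_le hf ht hq hs) (cu hX hY)))))

/-- Outer neighbours. -/
lemma out_facts (h : IsC4 G W v a w b) (ht : TF G) {x : V} (hx : x ∈ nb G W v \ {a, b}) :
    x ∈ W ∧ G.Adj v x ∧ x ≠ v ∧ x ≠ w ∧ x ≠ a ∧ x ≠ b ∧ ¬ G.Adj a x ∧ ¬ G.Adj b x := by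
  simp only [mem_sdiff, mem_nb, mem_insert, mem_singleton, not_or] at hx
  obtain ⟨⟨h1, h2⟩, h3, h4⟩ := hx
  refine ⟨h1, h2, h2.ne.symm, ?_, h3, h4, fun h' => ht v a x h.va h' h2, fun h' => ht v b x h.vb h' h2⟩
  rintro rfl
  exact h.nvw ht h2

/-- Sets avoiding `a` and `b`, when `w` and `b` have degree two. -/
lemma avoid_of_deg_two (h : IsC4 G W v a w b) {f : ℤ → ℚ} (hf : Bdd G f W) (ht : TF G) {p : ℕ}
    (hp : #(nb G W v) = p + 2) (hw : #(nb G W w) = 2) (hb : #(nb G W b) = 2)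
    (hout : ∀ x ∈ nb G W v \ {a, b}, 2 ≤ #(nb G W x)) :
    (#(cls G W ∅ {a, b}) : ℚ) ≤ f (#W - (4 + p : ℕ)) + p * f (#W - (5 + p : ℕ)) := by
  have hw' := (nb_pair (h.flip.nb_eq hw)).2.2.2.2
  have hb' := (nb_pair (h.rot.flip.nb_eq hb)).2.2.2.2
  have hcard := h.card_out
  rw [hp] at hcard
  have hN := @out_facts V _ G _ W v a w b h ht
  have hQ : #({w, a, b} : Finset V) = 3 := by
    rw [card_insert_of_notMem (by simp [h.wa.ne, h.wb.ne]), card_pair h.ab]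
  have hvN : v ∉ nb G W v \ {a, b} := by simp [mem_nb]
  set N := nb G W v \ {a, b} with hNdef
  have cT : #(insert v ({w, a, b} ∪ N)) = 4 + p := by
    rw [card_insert_of_notMem (by simp [h.vw, h.va.ne, h.vb.ne, hvN]), card_union_of_disjoint, hQ]
    · omega
    · rw [disjoint_right]; intro x hx
      have := hN hx; simp [this]
  have zT : ∀ I : Finset V, v ∈ I → w ∈ I → ∀ z ∈ insert v ({w, a, b} ∪ N),
      z ∈ W ∧ (z ∈ I ∨ (∃ i ∈ I, G.Adj i z) ∨ z ∈ (∅ : Finset V)) := by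
    intro I hvI hwI z hz
    simp only [mem_insert, mem_union, mem_singleton] at hz
    rcases hz with rfl | (rfl | rfl | rfl) | hz
    · exact ⟨h.hv, Or.inl hvI⟩
    · exact ⟨h.hw, Or.inl hwI⟩
    · exact ⟨h.ha, Or.inr (Or.inl ⟨v, hvI, h.va⟩)⟩
    · exact ⟨h.hb, Or.inr (Or.inl ⟨v, hvI, h.vb⟩)⟩
    · exact ⟨(hN hz).1, Or.inr (Or.inl ⟨v, hvI, (hN hz).2.1⟩)⟩
  -- With `a` and `b` out, `w` has no neighbour left and is isolated in `F`. Then `b` can be blocked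
  -- only if `v` is in `F` too.
  have hsub : cls G W ∅ {a, b} ⊆ cls G W {v, w} ∅ ∪ N.biUnion (fun x => cls G W {v, x, w} ∅) := by
    intro F hF
    have hFM := cls_MD hF
    have haF : a ∉ F := cls_out hF (by simp) (by simp)
    have hbF : b ∉ F := cls_out hF (by simp) (by simp)
    have hwn : ∀ y ∈ F, ¬ G.Adj w y := fun y hy hwy => by
      rcases hw' y (MD_sub hFM hy) hwy with rfl | rfl
      · exact haF hy
      · exact hbF hy
    have hwF := mem_of_free hFM h.hw hwn
    have hws := single_cls hFM hwF hwn
    have hvF : v ∈ F := by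
      rcases blocked hFM h.hb hbF with ⟨y, hy, z, hz, hne, h1, h2⟩ | ⟨y, hy, h1, z, hz, h2⟩
      · rcases hb' y (MD_sub hFM hy) h1 with rfl | rfl
        · exact hy
        · rcases hb' z (MD_sub hFM hz) h2 with rfl | rfl
          · exact hz
          · exact absurd rfl hne
      · rcases hb' y (MD_sub hFM hy) h1 with rfl | rfl
        · exact hy
        · exact absurd h2 (hwn z hz)
    simp only [mem_union, mem_biUnion]
    rcases in_cases hFM hvF with h1 | ⟨x, hx, hxF, h1⟩
    · exact Or.inl (cls_congr (cls_union h1 hws) (by ext; simp) (by simp))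
    · refine Or.inr ⟨x, ?_, cls_congr (cls_union h1 hws) (by ext; simp) (by simp)⟩
      simp only [N, mem_sdiff, hx, true_and, mem_insert, mem_singleton, not_or]
      exact ⟨fun e => haF (e ▸ hxF), fun e => hbF (e ▸ hxF)⟩
  refine (by exact_mod_cast card_le_card hsub : (#(cls G W ∅ {a, b}) : ℚ) ≤ _).trans
    (cu (cls_le hf _ _ _ _ (zT _ (by simp) (by simp)) cT.ge (by omega)) ?_)
  rw [show (p : ℚ) = #N by rw [show #N = p by omega]]
  refine biUnion_le fun x hx => ?_
  obtain ⟨y, hy, hyv⟩ := card_two_le_exists (hout x hx) v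
  obtain ⟨hyW, hxy⟩ := mem_nb.1 hy
  obtain ⟨hxW, hvx, hxv, hxw, hxa, hxb, hax, hbx⟩ := hN hx
  refine cls_le hf _ _ (insert y (insert v ({w, a, b} ∪ N))) _ ?_ ?_ (card_pos.2 ⟨y, by simp⟩)
  · intro z hz
    rcases mem_insert.1 hz with rfl | hz
    · exact ⟨hyW, Or.inr (Or.inl ⟨x, by simp, hxy⟩)⟩
    · exact zT _ (by simp) (by simp) z hz
  · rw [card_insert_of_notMem, cT]
    · omega
    · simp only [mem_insert, mem_union, mem_singleton, not_or]
      refine ⟨hyv, ⟨?_, ?_, ?_⟩, ?_⟩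
      · rintro rfl
        rcases hw' x hxW hxy.symm with e | e
        · exact hxa e
        · exact hxb e
      · rintro rfl; exact hax hxy.symm
      · rintro rfl; exact hbx hxy.symm
      · intro hyN; exact ht v x y hvx hxy (hN hyN).2.1

/-- Sets avoiding `a` and `b`, when `b` has degree two. -/
lemma avoid_cover (h : IsC4 G W v a w b) (hb : #(nb G W b) = 2) {F : Finset V}
    (hF : F ∈ cls G W ∅ {a, b}) : F ∈ cls G W {v, w} ∅ ∨
      (∃ x ∈ nb G W v \ {a, b}, F ∈ cls G W {v, x} ∅) ∨
      ∃ x ∈ nb G W w \ {a, b}, F ∈ cls G W {w, x} ∅ := by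
  have hb' := (nb_pair (h.rot.flip.nb_eq hb)).2.2.2.2
  have hFM := cls_MD hF
  have haF : a ∉ F := cls_out hF (by simp) (by simp)
  have hbF : b ∉ F := cls_out hF (by simp) (by simp)
  have key : ∀ y z : V, y ∈ F → z ∈ F → G.Adj y z → ∃ x ∈ nb G W y \ {a, b}, F ∈ cls G W {y, x} ∅ := by
    intro y z hy hz hyz
    refine ⟨z, ?_, pair_cls hFM hy hz hyz⟩
    simp only [mem_sdiff, mem_nb, mem_insert, mem_singleton, not_or]
    exact ⟨⟨MD_sub hFM hz, hyz⟩, fun e => haF (e ▸ hz), fun e => hbF (e ▸ hz)⟩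
  by_cases h1 : v ∈ F ∧ ∃ z ∈ F, G.Adj v z
  · obtain ⟨hvF, z, hz, hvz⟩ := h1
    exact Or.inr (Or.inl (key v z hvF hz hvz))
  by_cases h2 : w ∈ F ∧ ∃ z ∈ F, G.Adj w z
  · obtain ⟨hwF, z, hz, hwz⟩ := h2
    exact Or.inr (Or.inr (key w z hwF hz hwz))
  push Not at h1 h2
  have hvw : v ∈ F ∧ w ∈ F := by
    rcases blocked hFM h.hb hbF with ⟨y, hy, z, hz, hne, h3, h4⟩ | ⟨y, hy, h3, z, hz, h4⟩
    · rcases hb' y (MD_sub hFM hy) h3 with rfl | rfl <;>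
      rcases hb' z (MD_sub hFM hz) h4 with rfl | rfl
      · exact absurd rfl hne
      · exact ⟨hy, hz⟩
      · exact ⟨hz, hy⟩
      · exact absurd rfl hne
    · rcases hb' y (MD_sub hFM hy) h3 with rfl | rfl
      · exact absurd h4 (h1 hy z hz)
      · exact absurd h4 (h2 hy z hz)
  exact Or.inl (cls_congr (cls_union (single_cls hFM hvw.1 (h1 hvw.1))
    (single_cls hFM hvw.2 (h2 hvw.2))) (by ext; simp) (by simp))

lemma iso_le (h : IsC4 G W v a w b) {f : ℤ → ℚ} (hf : Bdd G f W) (ht : TF G) {k : ℕ}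
    (hk : k ≤ 4 + #((nb G W v \ {a, b}) ∪ (nb G W w \ {a, b}))) :
    (#(cls G W {v, w} ∅) : ℚ) ≤ f (#W - k) := by
  refine cls_le hf _ _ ({v, w, a, b} ∪ ((nb G W v \ {a, b}) ∪ (nb G W w \ {a, b}))) k ?_ ?_
    (card_pos.2 ⟨v, by simp⟩)
  · intro z hz
    rcases mem_union.1 hz with hz | hz
    · simp only [mem_insert, mem_singleton] at hz
      rcases hz with rfl | rfl | rfl | rfl
      · exact ⟨h.hv, by simp⟩
      · exact ⟨h.hw, by simp⟩
      · exact ⟨h.ha, Or.inr (Or.inl ⟨v, by simp, h.va⟩)⟩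
      · exact ⟨h.hb, Or.inr (Or.inl ⟨v, by simp, h.vb⟩)⟩
    · rcases mem_union.1 hz with hz | hz
      · exact ⟨(h.out_facts ht hz).1, Or.inr (Or.inl ⟨v, by simp, (h.out_facts ht hz).2.1⟩)⟩
      · exact ⟨(h.flip.out_facts ht hz).1,
          Or.inr (Or.inl ⟨w, by simp, (h.flip.out_facts ht hz).2.1⟩)⟩
  · rw [card_union_of_disjoint, card_insert_of_notMem (by simp [h.vw, h.va.ne, h.vb.ne]),
      card_insert_of_notMem (by simp [h.wa.ne, h.wb.ne]), card_pair h.ab]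
    · omega
    · rw [disjoint_right]; intro x hx
      rcases mem_union.1 hx with hx | hx
      · have := h.out_facts ht hx; simp [this]
      · have := h.flip.out_facts ht hx; simp [this]

lemma out_lump (h : IsC4 G W v a w b) {f : ℤ → ℚ} (hf : Bdd G f W) (ht : TF G) {p k : ℕ}
    (hp : #(nb G W v) = p + 2) {X : Finset V} (hX : X ⊆ nb G W v \ {a, b})
    (hk : ∀ x ∈ X, k ≤ #(nb G W x)) :
    (#(X.biUnion fun x => cls G W {v, x} ∅) : ℚ) ≤ #X * f (#W - (2 + p + k : ℕ)) := by
  refine biUnion_le fun x hx => ?_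
  have := h.out_facts ht (hX hx)
  exact DissociationSets.pair_le hf ht h.hv this.1 this.2.1 _ (by have := hk x hx; omega)

/-- Sets avoiding `a` and `b`, when `b` has degree two. -/
lemma avoid_le (h : IsC4 G W v a w b) {f : ℤ → ℚ} (hf : Bdd G f W) (ht : TF G) {p q k : ℕ}
    (hp : #(nb G W v) = p + 2) (hq : #(nb G W w) = q + 2) (hb : #(nb G W b) = 2)
    (hov : ∀ x ∈ nb G W v \ {a, b}, 2 ≤ #(nb G W x))
    (how : ∀ x ∈ nb G W w \ {a, b}, 2 ≤ #(nb G W x)) {C : Finset V}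
    (hC : C = (nb G W v \ {a, b}) ∩ (nb G W w \ {a, b})) (hk : ∀ x ∈ C, k ≤ #(nb G W x)) :
    (#(cls G W ∅ {a, b}) : ℚ) ≤ f (#W - (4 + p + q - #C : ℕ)) +
      ((#C * f (#W - (2 + p + k : ℕ)) + (p - #C : ℕ) * f (#W - (2 + p + 2 : ℕ))) +
      (#C * f (#W - (2 + q + k : ℕ)) + (q - #C : ℕ) * f (#W - (2 + q + 2 : ℕ)))) := by
  have c1 := h.card_out
  have c2 := h.flip.card_out
  have c3 := card_union_add_card_inter (nb G W v \ {a, b}) (nb G W w \ {a, b})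
  have hCv : C ⊆ nb G W v \ {a, b} := hC ▸ inter_subset_left
  have hCw : C ⊆ nb G W w \ {a, b} := hC ▸ inter_subset_right
  have d1 := card_sdiff_of_subset hCv
  have d2 := card_sdiff_of_subset hCw
  rw [← hC] at c3
  have c4 : 4 + p + q - #C ≤ 4 + #((nb G W v \ {a, b}) ∪ (nb G W w \ {a, b})) := by omega
  set Nv := nb G W v \ {a, b}
  set Nw := nb G W w \ {a, b}
  -- The common outer neighbours `C` are kept apart: each of them shrinks the zone of the isolated
  -- pair by one, but its matched classes profit from the separate degree bound `k`.
  have hsub : cls G W ∅ {a, b} ⊆ cls G W {v, w} ∅ ∪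
      ((C.biUnion (fun x => cls G W {v, x} ∅) ∪ (Nv \ C).biUnion (fun x => cls G W {v, x} ∅)) ∪
      (C.biUnion (fun x => cls G W {w, x} ∅) ∪ (Nw \ C).biUnion (fun x => cls G W {w, x} ∅))) := by
    intro F hF
    simp only [mem_union, mem_biUnion, mem_sdiff]
    rcases h.avoid_cover hb hF with h1 | ⟨x, hx, h1⟩ | ⟨x, hx, h1⟩
    · exact Or.inl h1
    · by_cases hxC : x ∈ C
      · exact Or.inr (Or.inl (Or.inl ⟨x, hxC, h1⟩))
      · exact Or.inr (Or.inl (Or.inr ⟨x, ⟨hx, hxC⟩, h1⟩))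
    · by_cases hxC : x ∈ C
      · exact Or.inr (Or.inr (Or.inl ⟨x, hxC, h1⟩))
      · exact Or.inr (Or.inr (Or.inr ⟨x, ⟨hx, hxC⟩, h1⟩))
  have e1 : p - #C = #(Nv \ C) := by omega
  have e2 : q - #C = #(Nw \ C) := by omega
  rw [e1, e2]
  exact (by exact_mod_cast card_le_card hsub : (#(cls G W ∅ {a, b}) : ℚ) ≤ _).trans
    (cu (h.iso_le hf ht (k := 4 + p + q - #C) c4) (cu
      (cu (h.out_lump hf ht hp hCv hk) (h.out_lump hf ht hp sdiff_subset
        fun x hx => hov x (mem_sdiff.1 hx).1))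
      (cu (h.flip.out_lump hf ht hq hCw hk) (h.flip.out_lump hf ht hq sdiff_subset
        fun x hx => how x (mem_sdiff.1 hx).1))))

/-- Sets avoiding `v` and `w`, when `b` has degree two. -/
lemma avoid_single (h : IsC4 G W v a w b) {F : Finset V} (hb : #(nb G W b) = 2)
    (hF : F ∈ cls G W ∅ {v, w}) : F ∈ cls G W {b} ∅ := by
  have hb' := (nb_pair (h.rot.flip.nb_eq hb)).2.2.2.2
  have hFM := cls_MD hF
  have hn : ∀ y ∈ F, ¬ G.Adj b y := fun y hy hby => by
    rcases hb' y (MD_sub hFM hy) hby with rfl | rfl <;>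
    exact cls_out hF (by simp) (by simp) hy
  exact single_cls hFM (mem_of_free hFM h.hb hn) hn

lemma avoid_single_le (h : IsC4 G W v a w b) {f : ℤ → ℚ} (hf : Bdd G f W) (hb : #(nb G W b) = 2) :
    (#(cls G W ∅ {v, w}) : ℚ) ≤ f (#W - 3) :=
  (by exact_mod_cast card_le_card fun F hF => h.avoid_single hb hF :
    (#(cls G W ∅ {v, w}) : ℚ) ≤ #(cls G W {b} ∅)).trans (single_le hf h.hb 3 (by omega))

lemma avoid_pair_le (h : IsC4 G W v a w b) {f : ℤ → ℚ} (hf : Bdd G f W) (ht : TF G)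
    (ha : #(nb G W a) = 2) (hb : #(nb G W b) = 2) : (#(cls G W ∅ {v, w}) : ℚ) ≤ f (#W - 4) := by
  have hsub : cls G W ∅ {v, w} ⊆ cls G W {a, b} ∅ := fun F hF =>
    cls_congr (cls_union (h.flip'.avoid_single ha hF) (h.avoid_single hb hF)) (by ext; simp) (by simp)
  exact (by exact_mod_cast card_le_card hsub :
    (#(cls G W ∅ {v, w}) : ℚ) ≤ #(cls G W {a, b} ∅)).trans (h.rot.iso_le hf ht (k := 4) (by omega))

end IsC4

/-! ### Numerical inequalities for four-cycles with a vertex of degree two or a leaf neighbour -/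

/-- Truncation of the parameter `p` at `3`. -/
lemma Fz_cap (p : ℕ) : ∃ p' ≤ 3, p' ≤ p ∧ (p' < 3 → p' = p) ∧ (1 ≤ p → 1 ≤ p') ∧
    ∀ m j l : ℤ, j = m - p → l = m - p' → p * Fz j ≤ p' * Fz l := by
  rcases le_or_gt p 3 with h | h
  · exact ⟨p, h, le_rfl, fun _ => rfl, id, fun m j l h1 h2 => by rw [h1, h2]⟩
  · refine ⟨3, le_rfl, h.le, by omega, by omega, fun m j l h1 h2 => ?_⟩
    exact Fz_lump m le_rfl h.le h1 h2

lemma leaf_num (n : ℤ) (p : ℕ) (h1 : 1 ≤ p) (h3 : p ≤ 3) :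
    Fz (n - 2) + (p * Fz (n - (3 + p : ℕ)) + 2 * Fz (n - (4 + p : ℕ))) < Kz n := by
  obtain ⟨s, hs, hc⟩ := quad_cases n
  interval_cases p <;> simp only [Nat.reduceAdd, Nat.cast_ofNat, Nat.cast_one, Fz, Kz, quad_far n] <;>
  rcases hc with hc | hc | hc | hc <;> simp only [hc] <;> linarith

lemma deg_two_num (n : ℤ) (p q : ℕ) (h : p ≤ 3) (h' : q ≤ 3) (h0 : p ≠ 0 ∨ q ≠ 0) :
    Fz (n - (4 + p + q : ℕ)) + (Fz (n - (4 + p : ℕ)) + (Fz (n - (4 + q : ℕ)) + (Fz (n - 4) +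
      ((Fz (n - (4 + p : ℕ)) + p * Fz (n - (5 + p : ℕ))) +
      (Fz (n - (4 + q : ℕ)) + q * Fz (n - (5 + q : ℕ))))))) < Kz n := by
  obtain ⟨s, hs, hc⟩ := quad_cases n
  interval_cases p <;> interval_cases q <;>
  simp only [Nat.reduceAdd, Nat.cast_ofNat, Nat.cast_one, Nat.cast_zero, Fz, Kz, quad_far n] <;>
  first
  | (exfalso; omega)
  | (rcases hc with hc | hc | hc | hc <;> simp only [hc] <;> linarith)

/-- Here `u` is a lower bound for the number of distinct outer neighbours of `v` and `w`. It may be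
taken at least two because one common outer neighbour and no other is treated separately. -/
lemma opposite_num (n : ℤ) (p q u : ℕ) (h1 : 1 ≤ p) (h : p ≤ 3) (h1' : 1 ≤ q) (h' : q ≤ 3)
    (hu : u = max (max p q) 2) :
    2 * Fz (n - (4 + p : ℕ)) + 2 * Fz (n - (4 + q : ℕ)) + Fz (n - 4) + Fz (n - (4 + u : ℕ)) +
      p * Fz (n - (4 + p : ℕ)) + q * Fz (n - (4 + q : ℕ)) < Kz n := by
  obtain ⟨s, hs, hc⟩ := quad_cases n
  subst hu
  interval_cases p <;> interval_cases q <;>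
  simp only [max_def, Nat.reduceLeDiff, if_true, if_false, Nat.reduceAdd, Nat.cast_ofNat, Nat.cast_one, Fz, Kz,
    quad_far n] <;>
  (rcases hc with hc | hc | hc | hc <;> simp only [hc] <;> linarith)

/-- At residue 2 the first inequality of the last group is an equality, so strictness must come from
the structure of the graph (`good_one_tight`). The second one would fail with `Fz (n - 5)` in place
of `Lz (n - 5)`. -/
lemma misc_num (n : ℤ) :
    4 * Fz (n - 5) + Fz (n - 4) + Fz (n - 5) + 2 * Fz (n - 6) < Kz n ∧
    2 * Fz (n - 7) + 2 * Fz (n - 5) + Fz (n - 3) + Fz (n - 5) + 2 * Fz (n - 6) < Kz n ∧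
    2 * Fz (n - 7) + 2 * Fz (n - 5) + Fz (n - 3) + Fz (n - 6) + 2 * Fz (n - 5) < Kz n ∧
    (n % 4 ≠ 2 →
      2 * Fz (n - 6) + 2 * Fz (n - 5) + Fz (n - 3) + Fz (n - 5) + 2 * Fz (n - 6) < Kz n ∧
      2 * Fz (n - 6) + 2 * Fz (n - 5) + Fz (n - 3) + Fz (n - 6) + 2 * Fz (n - 5) < Kz n) ∧
    (n % 4 = 2 →
      2 * Fz (n - 6) + 2 * Fz (n - 5) + Fz (n - 3) + Fz (n - 5) + 2 * Fz (n - 6) ≤ Kz n ∧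
      2 * Fz (n - 6) + 2 * Fz (n - 5) + Fz (n - 3) + Fz (n - 6) + 2 * Lz (n - 5) < Kz n ∧
      2 * Fz (n - 6) + 2 * Fz (n - 5) + Fz (n - 3) + Fz (n - 5) + 2 * Fz (n - 7) < Kz n ∧
      2 * Fz (n - 6) + 2 * Fz (n - 5) + Fz (n - 3) + Fz (n - 6) + 2 * Fz (n - 6) < Kz n) := by
  obtain ⟨s, hs, hc⟩ := quad_cases n
  simp only [Fz, Kz, Lz, quad_far n]
  rcases hc with hc | hc | hc | hc <;> simp only [hc] <;>
    refine ⟨?_, ?_, ?_, fun h => ⟨?_, ?_⟩, fun h => ⟨?_, ?_, ?_, ?_⟩⟩ <;>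
    first
    | (exfalso; revert h; norm_num; done)
    | linarith

lemma Kz_eq_Fz {n : ℤ} (h : n % 4 ≠ 0) : Kz n = Fz n := by
  simp [Kz, Fz, quad, h]

lemma one_num (n : ℤ) (p q c : ℕ) (h1 : 1 ≤ p) (h : p ≤ 2) (h1' : 1 ≤ q) (h' : q ≤ 2)
    (h11 : p ≠ 1 ∨ q ≠ 1) (hc1 : c ≤ p) (hc2 : c ≤ q) :
    Fz (n - (5 + p : ℕ)) + Fz (n - (5 + q : ℕ)) + Fz (n - (4 + p : ℕ)) + Fz (n - (4 + q : ℕ)) +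
      Fz (n - 3) + Fz (n - (4 + p + q - c : ℕ)) +
      c * Fz (n - (5 + p : ℕ)) + (p - c : ℕ) * Fz (n - (4 + p : ℕ)) +
      c * Fz (n - (5 + q : ℕ)) + (q - c : ℕ) * Fz (n - (4 + q : ℕ)) < Kz n := by
  obtain ⟨s, hs, hc⟩ := quad_cases n
  interval_cases p <;> interval_cases q <;> interval_cases c <;>
  simp only [Nat.reduceAdd, Nat.reduceSub, Nat.cast_ofNat, Nat.cast_one, Nat.cast_zero, Fz, Kz, quad_far n] <;>
  first
  | (exfalso; omega)
  | (rcases hc with hc | hc | hc | hc <;> simp only [hc] <;> linarith)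

lemma one_num_large (n : ℤ) (p q : ℕ) (h1 : 1 ≤ p) (h : p ≤ 3) (h1' : 1 ≤ q) (h' : q ≤ 3)
    (h11 : p = 3 ∨ q = 3) :
    Fz (n - (5 + p : ℕ)) + Fz (n - (5 + q : ℕ)) + Fz (n - (4 + p : ℕ)) + Fz (n - (4 + q : ℕ)) +
      Fz (n - 3) + Fz (n - 7) + p * Fz (n - (4 + p : ℕ)) + q * Fz (n - (4 + q : ℕ)) < Kz n := by
  obtain ⟨s, hs, hc⟩ := quad_cases n
  interval_cases p <;> interval_cases q <;>
  simp only [Nat.reduceAdd, Nat.cast_ofNat, Nat.cast_one, Fz, Kz, quad_far n] <;>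
  first
  | (exfalso; omega)
  | (rcases hc with hc | hc | hc | hc <;> simp only [hc] <;> linarith)

lemma Fz_sub {n : ℤ} {k l : ℕ} (h : l ≤ k) : Fz (n - (k : ℤ)) ≤ Fz (n - (l : ℤ)) := Fz_mono (by omega)

/-! ### Four-cycles with a vertex of degree two -/

/-- No vertex of a four-cycle has a neighbour of degree one. -/
def NoLeaf (G : SimpleGraph V) [DecidableRel G.Adj] (W : Finset V) : Prop :=
  ∀ v a w b, IsC4 G W v a w b → ∀ x ∈ nb G W v \ {a, b}, 2 ≤ #(nb G W x)

namespace IsC4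
variable {W : Finset V} {v a w b : V}

lemma lt_of_leaf (h : IsC4 G W v a w b) (hf : Bdd G Fz W) (ht : TF G) {x : V}
    (hx : x ∈ nb G W v \ {a, b}) (h1 : ¬ 2 ≤ #(nb G W x)) : (ph G W : ℚ) < Kz #W := by
  have hpos : ∀ y ∈ nb G W v, 1 ≤ #(nb G W y) := fun y hy =>
    card_pos.2 ⟨v, mem_nb.2 ⟨h.hv, (mem_nb.1 hy).2.symm⟩⟩
  obtain ⟨hxW, hvx, -⟩ := h.out_facts ht hx
  set L := (nb G W v).filter (fun x => #(nb G W x) = 1) with hL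
  have hxL : x ∈ L := mem_filter.2 ⟨mem_nb.2 ⟨hxW, hvx⟩, by
    have := hpos x (mem_nb.2 ⟨hxW, hvx⟩); omega⟩
  have hl := leaves_le hf ht (k := 2) h.hv (L := L) (filter_subset _ _) ⟨x, hxL⟩
    (fun y hy => nb_eq_single h.hv (mem_nb.1 (mem_filter.1 hy).1).2.symm (mem_filter.1 hy).2)
    (fun y hy hyL => by
      have := hpos y hy
      have : #(nb G W y) ≠ 1 := fun h => hyL (mem_filter.2 ⟨hy, h⟩)
      omega)
  have hl1 : 1 ≤ #L := card_pos.2 ⟨x, hxL⟩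
  have hLs : L ⊆ nb G W v \ {a, b} := by
    intro y hy
    obtain ⟨hy, hy1⟩ := mem_filter.1 hy
    refine mem_sdiff.2 ⟨hy, ?_⟩
    simp only [mem_insert, mem_singleton, not_or]
    constructor
    · rintro rfl; have := h.rot.two_le; omega
    · rintro rfl; have := h.rot.flip.two_le; omega
  have hl2 := card_le_card hLs
  have hl3 := h.card_out
  obtain ⟨p, hp⟩ : ∃ p, #(nb G W v) = p + 2 := ⟨_, hl3.symm⟩
  rw [hp] at hl
  generalize #L = l at *
  generalize hm : (#W : ℤ) = n at *
  obtain ⟨p', h3, hpp, -, hp1, hcap⟩ := Fz_cap p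
  have hnum := leaf_num n p' (hp1 (by omega)) h3
  have c1 := hcap (n - 3) (n - (3 + p : ℕ)) (n - (3 + p' : ℕ)) (by push_cast; ring) (by push_cast; ring)
  have c2 : Fz (n - (4 + p : ℕ)) ≤ Fz (n - (4 + p' : ℕ)) := Fz_sub (by omega)
  have c3 : Fz (n - (1 + l : ℕ)) ≤ Fz (n - 2) := Fz_mono (by omega)
  have c4 : Fz (n - (4 + p : ℕ)) ≤ Fz (n - (3 + p : ℕ)) := Fz_sub (by omega)
  rw [show 1 + (p + 2) = 3 + p by ring, show 2 + (p + 2) = 4 + p by ring, Nat.cast_sub (by omega)] at hl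
  push_cast at hl c1 c2 c3 c4 hnum
  -- The cycle vertices `a` and `b` are no leaves, so at most `p` neighbours of `v` are. The bound
  -- of a leaf class is at least that of another edge class, so `l = p` is the worst case.
  have hlp : (l : ℚ) ≤ p := by exact_mod_cast (by omega : l ≤ p)
  nlinarith [mul_le_mul_of_nonneg_left c4 (sub_nonneg.2 hlp)]

/-- As `w` and `b` are adjacent and of degree two, `avoid_of_deg_two` applies to both opposite
pairs. The count is strict unless there are no outer neighbours at all, and then the cycle is a
component. -/
lemma good_deg_two (h : IsC4 G W v a w b) (hI : IH G W) (ht : TF G) (hnl : NoLeaf G W)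
    (hw : #(nb G W w) = 2) (hb : #(nb G W b) = 2) : Good G W := by
  obtain ⟨p, hp⟩ : ∃ p, #(nb G W v) = p + 2 := ⟨_, h.card_out.symm⟩
  obtain ⟨q, hq⟩ : ∃ q, #(nb G W a) = q + 2 := ⟨_, h.rot.card_out.symm⟩
  by_cases h0 : p = 0 ∧ q = 0
  · obtain ⟨rfl, rfl⟩ := h0
    refine good_C4_comp hI (A := {v, w}) (B := {a, b}) ⟨?_, ?_, ?_, ?_⟩ (card_pair h.vw)
      (card_pair h.ab)
    · intro z hz; simp only [mem_insert, mem_singleton] at hz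
      rcases hz with rfl | rfl
      · exact h.hv
      · exact h.hw
    · intro z hz; simp only [mem_insert, mem_singleton] at hz
      rcases hz with rfl | rfl
      · exact h.ha
      · exact h.hb
    · intro z hz; simp only [mem_insert, mem_singleton] at hz
      rcases hz with rfl | rfl
      · exact h.nb_eq hp
      · exact h.flip.nb_eq hw
    · intro z hz; simp only [mem_insert, mem_singleton] at hz
      rcases hz with rfl | rfl
      · exact h.rot.nb_eq hq
      · exact h.rot.flip.nb_eq hb
  refine Good.of_lt ?_
  have hf := hI.bdd
  have hX := h.avoid_of_deg_two hf ht hp hw hb (hnl _ _ _ _ h)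
  have hY := h.rot.avoid_of_deg_two hf ht hq hb hw (hnl _ _ _ _ h.rot)
  have hB := h.bound hf ht hp (q := 0) hw hq (s := 0) hb hX hY
  generalize hm : (#W : ℤ) = n at *
  obtain ⟨p', p3, pp, pe, p1, pc⟩ := Fz_cap p
  obtain ⟨q', q3, qq, qe, q1, qc⟩ := Fz_cap q
  have hnum := deg_two_num n p' q' p3 q3 (by omega)
  have c1 := pc (n - 5) (n - (5 + p : ℕ)) (n - (5 + p' : ℕ)) (by push_cast; ring) (by push_cast; ring)
  have c2 := qc (n - 5) (n - (5 + q : ℕ)) (n - (5 + q' : ℕ)) (by push_cast; ring) (by push_cast; ring)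
  have c3 : Fz (n - (4 + p : ℕ)) ≤ Fz (n - (4 + p' : ℕ)) := Fz_sub (by omega)
  have c4 : Fz (n - (4 + q : ℕ)) ≤ Fz (n - (4 + q' : ℕ)) := Fz_sub (by omega)
  have c5 : Fz (n - (4 + p + q : ℕ)) ≤ Fz (n - (4 + p' + q' : ℕ)) := Fz_sub (by omega)
  simp only [Nat.add_zero] at hB
  push_cast at *
  linarith

/-- The delicate case is that `v` and `w` have just one outer neighbour, and the same one. If its
degree is two, a K_{2,3} component splits off; a larger degree improves its matched classes enough.
-/
lemma good_opposite (h : IsC4 G W v a w b) (hI : IH G W) (ht : TF G) (hnl : NoLeaf G W)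
    (ha : #(nb G W a) = 2) (hb : #(nb G W b) = 2) (hv : #(nb G W v) ≠ 2) (hw : #(nb G W w) ≠ 2) :
    Good G W := by
  obtain ⟨p, hp⟩ : ∃ p, #(nb G W v) = p + 2 := ⟨_, h.card_out.symm⟩
  obtain ⟨q, hq⟩ : ∃ q, #(nb G W w) = q + 2 := ⟨_, h.flip.card_out.symm⟩
  have hf := hI.bdd
  have hY := h.avoid_pair_le hf ht ha hb
  have hC2 : #((nb G W v \ {a, b}) ∩ (nb G W w \ {a, b})) ≤ #(nb G W v \ {a, b}) := card_le_card inter_subset_left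
  have hC3 : #((nb G W v \ {a, b}) ∩ (nb G W w \ {a, b})) ≤ #(nb G W w \ {a, b}) := card_le_card inter_subset_right
  have hc1 := h.card_out
  have hc2 := h.flip.card_out
  have hX := fun k => h.avoid_le hf ht (k := k) hp hq hb (hnl _ _ _ _ h) (hnl _ _ _ _ h.flip) rfl
  set C := (nb G W v \ {a, b}) ∩ (nb G W w \ {a, b}) with hC
  have hCv : ∀ x ∈ C, x ∈ nb G W v \ {a, b} := fun x hx => (mem_inter.1 hx).1
  have hCw : ∀ x ∈ C, x ∈ nb G W w \ {a, b} := fun x hx => (mem_inter.1 hx).2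
  by_cases h1 : p = 1 ∧ q = 1 ∧ #C = 1
  · obtain ⟨rfl, rfl, hC1⟩ := h1
    obtain ⟨c, hc⟩ := card_eq_one.1 hC1
    have hcC : c ∈ C := by simp [hc]
    obtain ⟨hcW, hvc, hcv, hcw, hca, hcb, -, -⟩ := h.out_facts ht (hCv c hcC)
    have hwc := (h.flip.out_facts ht (hCw c hcC)).2.1
    by_cases hc2 : #(nb G W c) = 2
    · have hnb : ∀ x, IsC4 G W x a (if x = v then w else v) b → c ∈ nb G W x → #(nb G W x) = 1 + 2 →
          nb G W x = {a, b, c} := by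
        intro x hx hcx h3
        refine (eq_of_subset_of_card_le ?_ ?_).symm
        · intro z hz; simp only [mem_insert, mem_singleton] at hz
          rcases hz with rfl | rfl | rfl
          · exact mem_nb.2 ⟨hx.ha, hx.va⟩
          · exact mem_nb.2 ⟨hx.hb, hx.vb⟩
          · exact hcx
        · rw [h3, card_insert_of_notMem (by simp [h.ab, hca.symm]), card_pair hcb.symm]
      refine good_K23_comp hI (A := {v, w}) (B := {a, b, c}) ⟨?_, ?_, ?_, ?_⟩ (card_pair h.vw) ?_
      · intro z hz; simp only [mem_insert, mem_singleton] at hz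
        rcases hz with rfl | rfl
        · exact h.hv
        · exact h.hw
      · intro z hz; simp only [mem_insert, mem_singleton] at hz
        rcases hz with rfl | rfl | rfl
        · exact h.ha
        · exact h.hb
        · exact hcW
      · intro z hz; simp only [mem_insert, mem_singleton] at hz
        rcases hz with rfl | rfl
        · exact hnb _ (by simpa using h) (mem_nb.2 ⟨hcW, hvc⟩) hp
        · exact hnb _ (by simpa [h.vw.symm] using h.flip) (mem_nb.2 ⟨hcW, hwc⟩) hq
      · intro z hz; simp only [mem_insert, mem_singleton] at hz
        rcases hz with rfl | rfl | rfl
        · exact h.rot.nb_eq ha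
        · exact h.rot.flip.nb_eq hb
        · refine (eq_of_subset_of_card_le ?_ ?_).symm
          · intro y hy; simp only [mem_insert, mem_singleton] at hy
            rcases hy with rfl | rfl
            · exact mem_nb.2 ⟨h.hv, hvc.symm⟩
            · exact mem_nb.2 ⟨h.hw, hwc.symm⟩
          · rw [hc2, card_pair h.vw]
      · rw [card_insert_of_notMem (by simp [h.ab, hca.symm]), card_pair hcb.symm]
    · have hX := hX 3 (fun x hx => by
        have h2 := hnl _ _ _ _ h x (hCv x hx)
        rw [hc, mem_singleton] at hx; subst hx; omega)
      have hB := h.bound hf ht hp hq (r := 0) ha (s := 0) hb hX hY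
      rw [hC1] at hB
      have := (misc_num #W).1
      refine Good.of_lt ?_
      norm_num at hB
      linarith
  · have hX := hX 2 (fun x hx => hnl _ _ _ _ h x (hCv x hx))
    have hB := h.bound hf ht hp hq (r := 0) ha (s := 0) hb hX hY
    refine Good.of_lt ?_
    generalize hm : (#W : ℤ) = n at *
    generalize #C = c at *
    obtain ⟨p', p3, pp, pe, p1, pc⟩ := Fz_cap p
    obtain ⟨q', q3, qq, qe, q1, qc⟩ := Fz_cap q
    have hnum := opposite_num n p' q' _ (p1 (by omega)) p3 (q1 (by omega)) q3 rfl
    have c1 := pc (n - 4) (n - (4 + p : ℕ)) (n - (4 + p' : ℕ)) (by push_cast; ring) (by push_cast; ring)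
    have c2 := qc (n - 4) (n - (4 + q : ℕ)) (n - (4 + q' : ℕ)) (by push_cast; ring) (by push_cast; ring)
    have c3 : Fz (n - (4 + p : ℕ)) ≤ Fz (n - (4 + p' : ℕ)) := Fz_sub (by omega)
    have c4 : Fz (n - (4 + q : ℕ)) ≤ Fz (n - (4 + q' : ℕ)) := Fz_sub (by omega)
    have c5 : Fz (n - (4 + p + q - c : ℕ)) ≤ Fz (n - (4 + max (max p' q') 2 : ℕ)) := Fz_sub (by omega)
    rw [show 2 + p + 2 = 4 + p by ring, show 2 + q + 2 = 4 + q by ring, Nat.cast_sub (show c ≤ p by omega),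
      Nat.cast_sub (show c ≤ q by omega)] at hB
    simp only [Nat.add_zero] at hB
    push_cast at *
    linarith

end IsC4

/-- A class whose complement contains a vertex of degree at most one. -/
lemma cls_le_low {W : Finset V} (hf : Bdd G Fz W) (ht : TF G) {w z : V} (hw : w ∈ W)
    (I O T : Finset V) (k : ℕ) (hwz : ∀ y ∈ W, G.Adj w y → y ∉ zone G W I O → y = z)
    (hT : ∀ z ∈ T, z ∈ W ∧ (z ∈ I ∨ (∃ i ∈ I, G.Adj i z) ∨ z ∈ O)) (hk : k ≤ #T)
    (hI : w ∉ I) (hI' : ∀ i ∈ I, ¬ G.Adj i w) (hO : w ∉ O) :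
    (#(cls G W I O) : ℚ) ≤ Lz (#W - k) := by
  have hz : w ∈ W \ zone G W I O := by
    refine mem_sdiff.2 ⟨hw, fun h => ?_⟩
    rcases (mem_zone.1 h).2 with h | ⟨i, hi, h⟩ | h
    · exact hI h
    · exact hI' i hi h
    · exact hO h
  calc (#(cls G W I O) : ℚ) ≤ ph G (W \ zone G W I O) := by exact_mod_cast card_cls_le_ph W I O
    _ ≤ Lz #(W \ zone G W I O) := low_degree_le (hf.subset sdiff_subset) ht hz
        (card_le_one.2 fun x hx y hy => by
          obtain ⟨hx, hwx⟩ := mem_nb.1 hx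
          obtain ⟨hy, hwy⟩ := mem_nb.1 hy
          rw [mem_sdiff] at hx hy
          rw [hwz x hx.1 hwx hx.2, hwz y hy.1 hwy hy.2])
    _ ≤ _ := Lz_mono (card_sdiff_zone hT hk)

/-- No four-cycle has two opposite vertices of degree two. -/
def NoOpposite (G : SimpleGraph V) [DecidableRel G.Adj] (W : Finset V) : Prop :=
  ∀ v a w b, IsC4 G W v a w b → #(nb G W a) = 2 → #(nb G W b) ≠ 2

/-- An extremal graph of residue three has no other leaves than those of the path on three
vertices. -/
lemma Ext.path_of_leaves {M : Finset V} (hE : Ext G M) (hM : #M % 4 = 3) {x y : V} (hx : x ∈ M)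
    (hy : y ∈ M) (hxy : x ≠ y) (hx1 : #(nb G M x) = 1) (hy1 : #(nb G M y) = 1) :
    ∃ z, z ∈ M ∧ G.Adj x z ∧ G.Adj y z ∧ nb G M z = {x, y} := by
  obtain ⟨A, B, hc, hA, hB, hC⟩ := hE.core (a := 1) (b := 2) (by unfold Core; omega) (by omega)
  obtain ⟨z, hz⟩ := card_eq_one.1 hA
  have key : ∀ x ∈ M, #(nb G M x) = 1 → x ∈ B := by
    intro x hx h1
    by_contra hxB
    by_cases hxA : x ∈ A
    · rw [hc.2.2.1 x hxA] at h1; omega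
    · have hxM : x ∈ M \ (A ∪ B) := by simp [hx, hxA, hxB]
      obtain ⟨A', B', hc', hA', hB', hx'⟩ := hC.mem hxM
      have := (hc.lift hc').2.2.1 x hx'
      rw [this] at h1; omega
  have hxB := key x hx hx1
  have hyB := key y hy hy1
  have hBeq : B = {x, y} := by
    refine (eq_of_subset_of_card_le ?_ ?_).symm
    · intro u hu; simp only [mem_insert, mem_singleton] at hu
      rcases hu with rfl | rfl <;> assumption
    · rw [hB, card_pair hxy]
  have hzA : z ∈ A := by simp [hz]
  exact ⟨z, hc.1 hzA, (hc.adj hzA hxB).symm, (hc.adj hzA hyB).symm, by rw [hc.2.2.1 z hzA, hBeq]⟩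

namespace IsC4
variable {W : Finset V} {v a w b : V}

lemma nb_of_out {c : V} (hc : nb G W v \ {a, b} = {c}) :
    ∀ y ∈ W, G.Adj v y → y = a ∨ y = b ∨ y = c := by
  intro y hy hvy
  by_contra hcon
  push Not at hcon
  have : y ∈ nb G W v \ {a, b} := by simp [mem_nb, hy, hvy, hcon]
  rw [hc, mem_singleton] at this
  exact hcon.2.2 this

/-- The plain count gives equality. One term comes from the graph `M` left by deleting `b, v, w`, of
residue 3, and the count is strict if `M` is not extremal. If it is, then `a` and `c`, of degree one
in `M`, are the ends of its path component, with centre `z`. Neither `b`, `v` nor `w` is adjacent to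
`z`. When `v` and `w` are isolated in `F`, the vertices `a` and `c` are out, so `z` is isolated in
`F` and the zone gains a sixth vertex. -/
lemma good_one_tight (h : IsC4 G W v a w b) (hI : IH G W) (ht : TF G)
    (hb : #(nb G W b) = 2) (hr : #W % 4 = 2) (hv : #(nb G W v) = 3) (hw : #(nb G W w) = 3)
    (ha : #(nb G W a) = 3) {c : V} (hcv : nb G W v \ {a, b} = {c}) (hcw : nb G W w \ {a, b} = {c})
    (hc3 : #(nb G W c) = 3) : (ph G W : ℚ) < Kz #W := by
  have hf := hI.bdd
  obtain ⟨-, -, -, -, hmisc⟩ := misc_num #W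
  obtain ⟨m1, -, -, m4⟩ := hmisc (by omega)
  have hcN : c ∈ nb G W v \ {a, b} := by simp [hcv]
  have hcN' : c ∈ nb G W w \ {a, b} := by simp [hcw]
  obtain ⟨hcW, hvc, hcv', hcw', hca, hcb, hac, hbc⟩ := h.out_facts ht hcN
  have hwc := (h.flip.out_facts ht hcN').2.1
  have l1 : (#(cls G W {v, c} ∅) : ℚ) ≤ Fz (#W - 6) :=
    DissociationSets.pair_le hf ht h.hv hcW hvc 6 (by omega)
  have l2 : (#(cls G W {w, c} ∅) : ℚ) ≤ Fz (#W - 6) :=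
    DissociationSets.pair_le hf ht h.hw hcW hwc 6 (by omega)
  have hXof : ∀ x : ℚ, (#(cls G W {v, w} ∅) : ℚ) ≤ x →
      (#(cls G W ∅ {a, b}) : ℚ) ≤ x + (Fz (#W - 6) + Fz (#W - 6)) := by
    intro x hx
    have hsub : cls G W ∅ {a, b} ⊆ cls G W {v, w} ∅ ∪ (cls G W {v, c} ∅ ∪ cls G W {w, c} ∅) := by
      intro F hF
      simp only [mem_union]
      rcases h.avoid_cover hb hF with h1 | ⟨x, hx, h1⟩ | ⟨x, hx, h1⟩
      · exact Or.inl h1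
      · rw [hcv, mem_singleton] at hx; subst hx; exact Or.inr (Or.inl h1)
      · rw [hcw, mem_singleton] at hx; subst hx; exact Or.inr (Or.inr h1)
    exact (by exact_mod_cast card_le_card hsub : (#(cls G W ∅ {a, b}) : ℚ) ≤ _).trans
      (cu hx (cu l1 l2))
  have hiso5 : (#(cls G W {v, w} ∅) : ℚ) ≤ Fz (#W - 5) :=
    h.iso_le hf ht (k := 5) (by rw [hcv, hcw]; simp)
  have hnv := nb_of_out hcv
  have hnw := nb_of_out hcw
  have hnb := (nb_pair (h.rot.flip.nb_eq hb)).2.2.2.2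
  -- the class of `b`
  have hcard3 : #({b, v, w} : Finset V) = 3 := by
    rw [card_insert_of_notMem (by simp [h.vb.ne.symm, h.wb.ne.symm]), card_pair h.vw]
  have hsubW : ({b, v, w} : Finset V) ⊆ W := by
    intro z hz; simp only [mem_insert, mem_singleton] at hz
    rcases hz with rfl | rfl | rfl
    exacts [h.hb, h.hv, h.hw]
  have hY : (#(cls G W ∅ {v, w}) : ℚ) ≤ ph G (W \ {b, v, w}) := by
    have h1 := card_le_card fun F hF => h.avoid_single hb hF
    have h2 := card_cls_le_ph (G := G) W {b} ∅
    have hz : zone G W {b} ∅ = {b, v, w} := by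
      ext z
      simp only [mem_zone, mem_singleton, exists_eq_left, notMem_empty, or_false, mem_insert]
      constructor
      · rintro ⟨hz, h1 | h1⟩
        · exact Or.inl h1
        · exact Or.inr (hnb z hz h1)
      · rintro (rfl | rfl | rfl)
        · exact ⟨h.hb, Or.inl rfl⟩
        · exact ⟨h.hv, Or.inr h.vb.symm⟩
        · exact ⟨h.hw, Or.inr h.wb.symm⟩
    rw [hz] at h2
    exact_mod_cast h1.trans h2
  set M := W \ {b, v, w} with hM
  have hMc : #M + 3 = #W := by rw [← hcard3]; exact card_sdiff_add_card_eq_card hsubW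
  have hMW : M ⊂ W := sdiff_ssubset hsubW ⟨b, by simp⟩
  obtain ⟨hM1, hM2⟩ := hI M hMW
  have hMcz : (#M : ℤ) = #W - 3 := by omega
  rw [hMcz] at hM1 hM2
  rcases hM2 with hE | hlt
  · have hdeg : ∀ x ∈ M, #(nb G W x) = 3 → ¬ G.Adj b x → G.Adj x v → G.Adj x w → #(nb G M x) = 1 := by
      intro x hx hx3 hbx hxv hxw
      have : nb G M x = nb G W x \ {v, w} := by
        ext y
        simp only [mem_nb, M, mem_sdiff, mem_insert, mem_singleton, not_or]
        constructor
        · rintro ⟨⟨h1, h2⟩, h3⟩; exact ⟨⟨h1, h3⟩, h2.2⟩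
        · rintro ⟨⟨h1, h2⟩, h3⟩
          exact ⟨⟨h1, fun e => hbx (e ▸ h2.symm), h3⟩, h2⟩
      have h2 : ({v, w} : Finset V) ⊆ nb G W x := by
        intro y hy; simp only [mem_insert, mem_singleton] at hy
        rcases hy with rfl | rfl
        · exact mem_nb.2 ⟨h.hv, hxv⟩
        · exact mem_nb.2 ⟨h.hw, hxw⟩
      rw [this, card_sdiff_of_subset h2, hx3, card_pair h.vw]
    have haM : a ∈ M := by simp [M, h.ha, h.ab, h.va.ne.symm, h.wa.ne.symm]
    have hcM : c ∈ M := by simp [M, hcW, hcb, hcv', hcw']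
    have ha1 := hdeg a haM ha (fun e => h.nab ht e.symm) h.va.symm h.wa.symm
    have hc1 := hdeg c hcM hc3 hbc hvc.symm hwc.symm
    obtain ⟨z, hzM, haz, hcz, hnz⟩ := hE.path_of_leaves (by omega) haM hcM hca.symm ha1 hc1
    have hzW := (mem_sdiff.1 hzM).1
    have hzQ := (mem_sdiff.1 hzM).2
    simp only [mem_insert, mem_singleton, not_or] at hzQ
    have hiso6 : (#(cls G W {v, w} ∅) : ℚ) ≤ Fz (#W - 6) := by
      have hsub : cls G W {v, w} ∅ ⊆ cls G W {v, w, z} ∅ := by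
        intro F hF
        have hFM := cls_MD hF
        have haF : a ∉ F := cls_adj hF (x := v) (by simp) h.va (by simp [h.va.ne.symm, h.wa.ne.symm])
        have hcF : c ∉ F := cls_adj hF (x := v) (by simp) hvc (by simp [hcv', hcw'])
        have hzn : ∀ y ∈ F, ¬ G.Adj z y := by
          intro y hy hzy
          have hyW := MD_sub hFM hy
          by_cases hyM : y ∈ M
          · have : y ∈ nb G M z := mem_nb.2 ⟨hyM, hzy⟩
            rw [hnz] at this
            simp only [mem_insert, mem_singleton] at this
            rcases this with rfl | rfl
            · exact haF hy
            · exact hcF hy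
          · have hy3 : y = b ∨ y = v ∨ y = w := by
              by_contra hcon
              push Not at hcon
              exact hyM (mem_sdiff.2 ⟨hyW, by simp [hcon]⟩)
            rcases hy3 with rfl | rfl | rfl
            · rcases hnb z hzW hzy.symm with e | e
              · exact hzQ.2.1 e
              · exact hzQ.2.2 e
            · exact ht y a z h.va haz hzy.symm
            · exact ht y a z h.wa haz hzy.symm
        exact cls_congr (cls_union hF (single_cls hFM (mem_of_free hFM hzW hzn) hzn))
          (by ext; simp) (by simp)
      refine (by exact_mod_cast card_le_card hsub : (#(cls G W {v, w} ∅) : ℚ) ≤ _).trans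
        (cls_le hf _ _ {z, c, v, w, a, b} 6 ?_ ?_ (card_pos.2 ⟨v, by simp⟩))
      · intro y hy
        simp only [mem_insert, mem_singleton] at hy
        rcases hy with rfl | rfl | rfl | rfl | rfl | rfl
        · exact ⟨hzW, by simp⟩
        · exact ⟨hcW, Or.inr (Or.inl ⟨v, by simp, hvc⟩)⟩
        · exact ⟨h.hv, by simp⟩
        · exact ⟨h.hw, by simp⟩
        · exact ⟨h.ha, Or.inr (Or.inl ⟨v, by simp, h.va⟩)⟩
        · exact ⟨h.hb, Or.inr (Or.inl ⟨v, by simp, h.vb⟩)⟩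
      · rw [card_insert_of_notMem (by simp [hcz.ne.symm, hzQ, haz.ne.symm]),
          card_insert_of_notMem (by simp [hcv', hcw', hca, hcb]),
          card_insert_of_notMem (by simp [h.vw, h.va.ne, h.vb.ne]),
          card_insert_of_notMem (by simp [h.wa.ne, h.wb.ne]), card_pair h.ab]
    have hB := h.bound hf ht (p := 1) hv (q := 1) hw (r := 1) ha (s := 0) hb (hXof _ hiso6) (hY.trans hM1)
    norm_num at hB
    linarith
  · have hB := h.bound hf ht (p := 1) hv (q := 1) hw (r := 1) ha (s := 0) hb (hXof _ hiso5) hY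
    rw [Kz_eq_Fz (n := (#W : ℤ) - 3) (by omega)] at hlt
    norm_num at hB
    linarith

/-- Sets avoiding `v` and `w` contain `b` isolated, and sets avoiding `a` and `b` are described by
`avoid_cover`. The critical case has one outer neighbour at each of `v`, `w` and `a`, at residue 2.
There distinct outer neighbours of `v` and `w` call for `Lz`, and a common one of degree three for
`good_one_tight`. -/
lemma good_one (h : IsC4 G W v a w b) (hI : IH G W) (ht : TF G) (hnl : NoLeaf G W)
    (hno : NoOpposite G W) (hb : #(nb G W b) = 2) (hv : #(nb G W v) ≠ 2) (hw : #(nb G W w) ≠ 2)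
    (ha : #(nb G W a) ≠ 2) : (ph G W : ℚ) < Kz #W := by
  obtain ⟨p, hp⟩ : ∃ p, #(nb G W v) = p + 2 := ⟨_, h.card_out.symm⟩
  obtain ⟨q, hq⟩ : ∃ q, #(nb G W w) = q + 2 := ⟨_, h.flip.card_out.symm⟩
  obtain ⟨r, hr⟩ : ∃ q, #(nb G W a) = q + 2 := ⟨_, h.rot.card_out.symm⟩
  have hf := hI.bdd
  have hY := h.avoid_single_le hf hb
  have hC2 : #((nb G W v \ {a, b}) ∩ (nb G W w \ {a, b})) ≤ #(nb G W v \ {a, b}) := card_le_card inter_subset_left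
  have hC3 : #((nb G W v \ {a, b}) ∩ (nb G W w \ {a, b})) ≤ #(nb G W w \ {a, b}) := card_le_card inter_subset_right
  have hc1 := h.card_out
  have hc2 := h.flip.card_out
  have hCeq : ∀ c, (nb G W v \ {a, b}) ∩ (nb G W w \ {a, b}) = {c} → p = 1 → q = 1 →
      nb G W v \ {a, b} = {c} ∧ nb G W w \ {a, b} = {c} := by
    intro c hc h1 h2
    constructor
    · refine (eq_of_subset_of_card_le ?_ ?_).symm
      · rw [← hc]; exact inter_subset_left
      · rw [card_singleton]; omega
    · refine (eq_of_subset_of_card_le ?_ ?_).symm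
      · rw [← hc]; exact inter_subset_right
      · rw [card_singleton]; omega
  have hX := fun k => h.avoid_le hf ht (k := k) hp hq hb (hnl _ _ _ _ h) (hnl _ _ _ _ h.flip) rfl
  set C := (nb G W v \ {a, b}) ∩ (nb G W w \ {a, b}) with hC
  have hCv : ∀ x ∈ C, x ∈ nb G W v \ {a, b} := fun x hx => (mem_inter.1 hx).1
  have hCw : ∀ x ∈ C, x ∈ nb G W w \ {a, b} := fun x hx => (mem_inter.1 hx).2
  -- If `x` had degree two, then `v, b, w, x` would be a four-cycle with opposite vertices `b` and
  -- `x` of degree two.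
  have hC3' : ∀ x ∈ C, 3 ≤ #(nb G W x) := by
    intro x hx
    obtain ⟨hxW, hvx, hxv, hxw, hxa, hxb, -, -⟩ := h.out_facts ht (hCv x hx)
    have hwx := (h.flip.out_facts ht (hCw x hx)).2.1
    have h4 : IsC4 G W v b w x := ⟨h.hv, h.hb, h.hw, hxW, h.vb, hvx, h.wb, hwx, h.vw, hxb.symm⟩
    have h5 := hno _ _ _ _ h4 hb
    have h6 := h4.rot.flip.two_le
    omega
  have hX3 := hX 3 hC3'
  have hB := h.bound hf ht hp hq hr (s := 0) hb hX3 hY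
  obtain ⟨-, m2, m3, m4, m5⟩ := misc_num #W
  by_cases h11 : p = 1 ∧ q = 1
  · obtain ⟨rfl, rfl⟩ := h11
    have hCc : #C = 0 ∨ #C = 1 := by omega
    rcases (show 1 ≤ r by omega).eq_or_lt with rfl | hr2
    · by_cases hres : #W % 4 = 2
      · obtain ⟨m51, m53, m54, m55⟩ := m5 (by omega)
        rcases hCc with hC0 | hC1
        · obtain ⟨v', hv'⟩ := card_eq_one.1 (show #(nb G W v \ {a, b}) = 1 by omega)
          obtain ⟨w', hw'⟩ := card_eq_one.1 (show #(nb G W w \ {a, b}) = 1 by omega)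
          have hne : v' ≠ w' := by
            rintro rfl
            have : v' ∈ C := by rw [hC, hv', hw']; simp
            rw [card_eq_zero.1 hC0] at this
            simp at this
          -- Matching `v` with `v'` decides `a` and `b`, so `w` survives with at most the neighbour
          -- `w'`. The remaining graph has a vertex of degree at most one and obeys `Lz`.
          have lump : ∀ v a w b v' w', IsC4 G W v a w b → nb G W v \ {a, b} = {v'} →
              nb G W w \ {a, b} = {w'} → v' ≠ w' → #(nb G W v) = 3 →
              (#(cls G W {v, v'} ∅) : ℚ) ≤ Lz (#W - 5) := by
            intro v a w b v' w' h hv' hw' hne h3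
            have hm : v' ∈ nb G W v \ {a, b} := by simp [hv']
            obtain ⟨hvW', hvv', hvv, hvw, hva, hvb, -, -⟩ := h.out_facts ht hm
            have hnw := nb_of_out hw'
            have h2 := hnl _ _ _ _ h v' hm
            refine cls_le_low hf ht (w := w) (z := w') h.hw _ _ (nb G W v ∪ nb G W v') 5 ?_ ?_ ?_ ?_ ?_
              (by simp)
            · intro y hy hwy hyz
              rcases hnw y hy hwy with rfl | rfl | rfl
              · exact absurd (mem_zone.2 ⟨hy, Or.inr (Or.inl ⟨v, by simp, h.va⟩)⟩) hyz
              · exact absurd (mem_zone.2 ⟨hy, Or.inr (Or.inl ⟨v, by simp, h.vb⟩)⟩) hyz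
              · rfl
            · intro z hz
              rcases mem_union.1 hz with hz | hz <;> rw [mem_nb] at hz
              · exact ⟨hz.1, Or.inr (Or.inl ⟨v, by simp, hz.2⟩)⟩
              · exact ⟨hz.1, Or.inr (Or.inl ⟨v', by simp, hz.2⟩)⟩
            · rw [card_union_of_disjoint]
              · omega
              · rw [disjoint_left]
                intro z h1 h2
                exact ht v z v' (mem_nb.1 h1).2 (mem_nb.1 h2).2.symm hvv'
            · simp [h.vw.symm, hvw.symm]
            · intro i hi
              simp only [mem_insert, mem_singleton] at hi
              rcases hi with rfl | rfl
              · exact h.nvw ht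
              · intro e
                rcases hnw i hvW' e.symm with e | e | e
                · exact hva e
                · exact hvb e
                · exact hne e
          have l1 := lump v a w b v' w' h hv' hw' hne hp
          have l2 := lump w a v b w' v' h.flip hw' hv' hne.symm hq
          have l0 : (#(cls G W {v, w} ∅) : ℚ) ≤ Fz (#W - 6) :=
            h.iso_le hf ht (k := 6) (by rw [hv', hw', ← insert_eq, card_pair hne])
          have hsub : cls G W ∅ {a, b} ⊆ cls G W {v, w} ∅ ∪ (cls G W {v, v'} ∅ ∪ cls G W {w, w'} ∅) := by
            intro F hF
            simp only [mem_union]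
            rcases h.avoid_cover hb hF with h1 | ⟨x, hx, h1⟩ | ⟨x, hx, h1⟩
            · exact Or.inl h1
            · rw [hv', mem_singleton] at hx; subst hx; exact Or.inr (Or.inl h1)
            · rw [hw', mem_singleton] at hx; subst hx; exact Or.inr (Or.inr h1)
          have hX' := (by exact_mod_cast card_le_card hsub : (#(cls G W ∅ {a, b}) : ℚ) ≤ _).trans
            (cu l0 (cu l1 l2))
          have hB := h.bound hf ht hp hq hr (s := 0) hb hX' hY
          norm_num at hB
          linarith
        · obtain ⟨c, hc⟩ := card_eq_one.1 hC1
          obtain ⟨hcv, hcw⟩ := hCeq c hc rfl rfl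
          have h3 := hC3' c (by simp [hc])
          rcases h3.eq_or_lt with h3 | h4
          · exact h.good_one_tight hI ht hb hres hp hq hr hcv hcw h3.symm
          · have hX4 := hX 4 (fun x hx => by
              rw [hc, mem_singleton] at hx; subst hx; omega)
            have hB := h.bound hf ht hp hq hr (s := 0) hb hX4 hY
            rw [hC1] at hB
            norm_num at hB
            linarith
      · obtain ⟨m41, m42⟩ := m4 (by omega)
        rcases hCc with hC0 | hC1
        · rw [hC0] at hB; norm_num at hB; linarith
        · rw [hC1] at hB; norm_num at hB; linarith
    · have e1 : Fz (#W - (4 + 1 + r : ℕ)) ≤ Fz (#W - 7) := Fz_mono (by omega)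
      rcases hCc with hC0 | hC1
      · rw [hC0] at hB; norm_num at hB e1; linarith
      · rw [hC1] at hB; norm_num at hB e1; linarith
  · generalize hm : (#W : ℤ) = n at *
    generalize #C = c at *
    have e1 : Fz (n - (4 + p + r : ℕ)) ≤ Fz (n - (5 + p : ℕ)) := Fz_sub (by omega)
    have e2 : Fz (n - (4 + q + r : ℕ)) ≤ Fz (n - (5 + q : ℕ)) := Fz_sub (by omega)
    rw [show 2 + p + 3 = 5 + p by ring, show 2 + q + 3 = 5 + q by ring,
      show 2 + p + 2 = 4 + p by ring, show 2 + q + 2 = 4 + q by ring] at hB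
    simp only [Nat.add_zero] at hB
    -- For at most two outer neighbours on each side the number `c` of common ones is kept exactly.
    -- If a side has three or more, the better degree bound for common neighbours can be given up.
    by_cases hs : p ≤ 2 ∧ q ≤ 2
    · have := one_num n p q c (by omega) hs.1 (by omega) hs.2 (by omega) (by omega) (by omega)
      linarith
    · obtain ⟨p', p3, pp, pe, p1, pc⟩ := Fz_cap p
      obtain ⟨q', q3, qq, qe, q1, qc⟩ := Fz_cap q
      have hnum := one_num_large n p' q' (p1 (by omega)) p3 (q1 (by omega)) q3 (by omega)
      have c1 := pc (n - 4) (n - (4 + p : ℕ)) (n - (4 + p' : ℕ)) (by push_cast; ring) (by push_cast; ring)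
      have c2 := qc (n - 4) (n - (4 + q : ℕ)) (n - (4 + q' : ℕ)) (by push_cast; ring) (by push_cast; ring)
      have c3 : Fz (n - (4 + p : ℕ)) ≤ Fz (n - (4 + p' : ℕ)) := Fz_sub (by omega)
      have c4 : Fz (n - (4 + q : ℕ)) ≤ Fz (n - (4 + q' : ℕ)) := Fz_sub (by omega)
      have c5 : Fz (n - (4 + p + q - c : ℕ)) ≤ Fz (n - 7) := Fz_mono (by omega)
      have c6 : Fz (n - (5 + p : ℕ)) ≤ Fz (n - (4 + p : ℕ)) := Fz_sub (by omega)
      have c7 : Fz (n - (5 + q : ℕ)) ≤ Fz (n - (4 + q : ℕ)) := Fz_sub (by omega)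
      have c8 : Fz (n - (5 + p : ℕ)) ≤ Fz (n - (5 + p' : ℕ)) := Fz_sub (by omega)
      have c9 : Fz (n - (5 + q : ℕ)) ≤ Fz (n - (5 + q' : ℕ)) := Fz_sub (by omega)
      rw [Nat.cast_sub (show c ≤ p by omega), Nat.cast_sub (show c ≤ q by omega)] at hB
      have d6 := mul_le_mul_of_nonneg_left c6 (Nat.cast_nonneg (α := ℚ) c)
      have d7 := mul_le_mul_of_nonneg_left c7 (Nat.cast_nonneg (α := ℚ) c)
      linarith

end IsC4

/-! ### Four-cycles all of whose vertices have degree at least three -/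

lemma heavy_num (n : ℤ) {i j k l : ℕ} {X Y : ℚ} (hi : 1 ≤ i) (hj : 1 ≤ j) (hk : 1 ≤ k) (hl : 1 ≤ l)
    (hi' : i ≤ 2) (hj' : j ≤ 2) (hk' : k ≤ 2) (hl' : l ≤ 2)
    (hX : X ≤ Fz (n - 2)) (hY : Y ≤ Fz (n - 2))
    (hX2 : n % 4 = 2 → X < Kz (n - 2)) (hY2 : n % 4 = 2 → Y < Kz (n - 2))
    (hX1 : i = 1 ∨ j = 1 → X ≤ Lz (n - 2)) (hY1 : k = 1 ∨ l = 1 → Y ≤ Lz (n - 2))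
    (hX11 : n % 4 = 2 ∨ n % 4 = 3 → i = 1 → j = 1 → X ≤ Dz (n - 2))
    (hY11 : n % 4 = 2 ∨ n % 4 = 3 → k = 1 → l = 1 → Y ≤ Dz (n - 2))
    (h1 : n % 4 = 1 → i = 1 → j = 1 → k = 1 → l = 1 → X < Fz (n - 2))
    (h2 : n % 4 = 2 → i = 1 → j = 1 → k = 1 → l = 1 → False)
    (h3 : n % 4 = 3 → i = 2 → j = 2 → k = 2 → l = 2 → X < Fz (n - 2)) :
    Fz (n - (4 + i + k : ℕ)) + (Fz (n - (4 + i + l : ℕ)) + (Fz (n - (4 + j + k : ℕ)) +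
      (Fz (n - (4 + j + l : ℕ)) + (X + Y)))) < Kz n := by
  -- The numbers `i, j, k, l` of outer neighbours are truncated at two. At residue 2 with all of
  -- them equal to two, the terms are 4 · 11/216 from the edges and less than 22/27 from each
  -- avoiding class, and 4 · 11/216 + 2 · 22/27 = 11/6. This determines the entry 22/27 of `Kz` as
  -- the largest possible.
  obtain ⟨s, hs, hc⟩ := quad_cases n
  interval_cases i <;> interval_cases j <;> interval_cases k <;> interval_cases l <;>
  simp only [Nat.reduceAdd, Nat.cast_ofNat, Nat.reduceEqDiff, or_true, or_false, true_implies, false_implies,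
    implies_true, Fz, Kz, Lz, Dz, quad_far n] at * <;>
  rcases hc with hc | hc | hc | hc <;>
  simp only [hc, true_implies, false_implies, Int.reduceEq, or_true, or_false] at * <;> linarith

/-- In the second inequality one edge class must be bounded by `Kz (n - 6)`: with `Fz (n - 6)` the
left side would be 2/3 + 32/27, which exceeds 11/6. This is why a special four-cycle needs a
remainder that is not a union of four-cycles. -/
lemma heavy_num_two (n : ℤ) (h : n % 4 = 2) :
    (∀ Z Y, Z ≤ Fz (n - 5) + 2 * Fz (n - 6) → Y ≤ Dz (n - 2) → 4 * Fz (n - 6) + (Z + Y) < Kz n) ∧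
    Kz (n - 6) + 3 * Fz (n - 6) + 2 * Dz (n - 2) ≤ Kz n ∧
    4 * Fz (n - 6) + 2 * (Fz (n - 5) + 2 * Fz (n - 6)) + Fz (n - 8) < Kz n ∧
    4 * Fz (n - 6) + (Fz (n - 5) + 2 * Fz (n - 6)) + (Fz (n - 5) + 2 * Fz (n - 7)) + 2 * Fz (n - 7)
      < Kz n ∧ 3 * Fz (n - 8) ≤ 2 * Fz (n - 7) := by
  obtain ⟨s, hs, hc⟩ := quad_cases n
  simp only [Fz, Kz, Dz, quad_far n]
  rcases hc with hc | hc | hc | hc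
  · omega
  · omega
  · simp only [hc]
    refine ⟨?_, ?_, ?_, ?_, ?_⟩ <;> intros <;> linarith
  · omega

lemma heavy_num_three (n : ℤ) (h : n % 4 = 3) :
    Fz (n - 5) + 2 * Fz (n - 6) ≤ Dz (n - 2) ∧
    4 * Fz (n - 6) + (Fz (n - 5) + 2 * Fz (n - 6) + Lz (n - 2)) < Kz n := by
  obtain ⟨s, hs, hc⟩ := quad_cases n
  simp only [Fz, Kz, Dz, Lz, quad_far n]
  rcases hc with hc | hc | hc | hc
  · omega
  · omega
  · omega
  · simp only [hc]
    refine ⟨?_, ?_⟩ <;> linarith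

/-- All vertices on four-cycles have degree at least three. -/
def Heavy (G : SimpleGraph V) [DecidableRel G.Adj] (W : Finset V) : Prop :=
  ∀ v a w b, IsC4 G W v a w b → 3 ≤ #(nb G W v)

namespace IsC4
variable {W : Finset V} {v a w b : V}

lemma nb_out : nb G (W \ {a, b}) v = nb G W v \ {a, b} := by
  ext z; simp only [mem_nb, mem_sdiff]; constructor
  · rintro ⟨⟨h1, h2⟩, h3⟩; exact ⟨⟨h1, h3⟩, h2⟩
  · rintro ⟨⟨h1, h2⟩, h3⟩; exact ⟨⟨h1, h3⟩, h2⟩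

lemma card_sdiff_pair (h : IsC4 G W v a w b) : #(W \ {a, b}) + 2 = #W := by
  rw [← card_pair h.ab]
  refine card_sdiff_add_card_eq_card ?_
  intro z hz; simp only [mem_insert, mem_singleton] at hz
  rcases hz with rfl | rfl
  exacts [h.ha, h.hb]

lemma mem_sdiff_pair (h : IsC4 G W v a w b) : v ∈ W \ {a, b} := by
  simp [h.hv, h.va.ne, h.vb.ne]

lemma cls_le_ph (h : IsC4 G W v a w b) : (#(cls G W ∅ {a, b}) : ℚ) ≤ ph G (W \ {a, b}) := by
  refine mod_cast ph_out_le {a, b} ?_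
  intro z hz; simp only [mem_insert, mem_singleton] at hz
  rcases hz with rfl | rfl
  exacts [h.ha, h.hb]

lemma sdiff_ssubset (h : IsC4 G W v a w b) : W \ {a, b} ⊂ W :=
  Finset.ssubset_iff_subset_ne.2 ⟨sdiff_subset, fun e => by
    have := h.ha; rw [← e] at this; simp at this⟩

/-- A complete bipartite component containing `v` after the removal of `a` and `b`. -/
lemma of_comp (h : IsC4 G W v a w b) (ht : TF G) {A B : Finset V} (hc : Comp G (W \ {a, b}) A B)
    (hv : v ∈ A) (hA : 2 ≤ #A) (hB : 2 ≤ #B) :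
    ∃ x y u, IsC4 G W x v y u ∧ #(nb G W x) = #A := by
  obtain ⟨u, hu, huv⟩ := card_two_le_exists hA v
  obtain ⟨x, hx⟩ := card_pos.1 (show 0 < #B by omega)
  obtain ⟨y, hy, hyx⟩ := card_two_le_exists hB x
  have hW : ∀ z ∈ A ∪ B, z ∈ W := fun z hz => (mem_sdiff.1 (hc.sub hz)).1
  refine ⟨x, y, u, ⟨hW _ (by simp [hx]), hW _ (by simp [hv]), hW _ (by simp [hy]),
    hW _ (by simp [hu]), (hc.adj hv hx).symm, (hc.adj hu hx).symm, (hc.adj hv hy).symm,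
    (hc.adj hu hy).symm, hyx.symm, huv.symm⟩, ?_⟩
  -- A vertex of `B` is adjacent to `v`, hence to neither `a` nor `b`, and keeps its degree when
  -- these are restored.
  rw [← hc.2.2.2 x hx]
  congr 1
  ext z
  simp only [mem_nb, mem_sdiff, mem_insert, mem_singleton, not_or]
  have hvx := hc.adj hv hx
  constructor
  · rintro ⟨hz, hxz⟩
    refine ⟨⟨hz, ?_, ?_⟩, hxz⟩
    · rintro rfl; exact ht v z x h.va hxz.symm hvx
    · rintro rfl; exact ht v z x h.vb hxz.symm hvx
  · rintro ⟨⟨h1, -⟩, h2⟩; exact ⟨h1, h2⟩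

/-- An extremal graph `W \ {a, b}` would be a union of four-cycles here. By `of_comp`, the one
through `v` would give a four-cycle of `W` with a vertex of degree two. -/
lemma out_lt_two (h : IsC4 G W v a w b) (hI : IH G W) (ht : TF G) (hH : Heavy G W)
    (hr : #W % 4 = 2) : (#(cls G W ∅ {a, b}) : ℚ) < Kz (#W - 2) := by
  have hcard := h.card_sdiff_pair
  have hcz : (#(W \ {a, b}) : ℤ) = #W - 2 := by omega
  rcases (hI _ h.sdiff_ssubset).2 with hE | hlt
  · obtain ⟨A, B, hc, hA, hB, hv⟩ := (hE.c4s (by omega)).mem h.mem_sdiff_pair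
    obtain ⟨x, y, u, h4, h5⟩ := h.of_comp ht hc hv (by omega) (by omega)
    have := hH _ _ _ _ h4
    omega
  · rw [hcz] at hlt
    exact h.cls_le_ph.trans_lt hlt

/-- An extremal graph `W \ {a, b}` would have only components K_{2,3} and C_4, and the one through
`v` would give a four-cycle of `W` with a vertex of degree at most three. -/
lemma out_lt_three (h : IsC4 G W v a w b) (hI : IH G W) (ht : TF G)
    (hH : ∀ v a w b, IsC4 G W v a w b → 4 ≤ #(nb G W v))
    (hr : #W % 4 = 3) : (#(cls G W ∅ {a, b}) : ℚ) < Fz (#W - 2) := by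
  have hcard := h.card_sdiff_pair
  have hcz : (#(W \ {a, b}) : ℤ) = #W - 2 := by omega
  rcases (hI _ h.sdiff_ssubset).2 with hE | hlt
  · obtain ⟨A, B, hc, hA, hB, hC⟩ := hE.core (a := 2) (b := 3) (by unfold Core; omega) (by omega)
    have key : ∀ A B, Comp G (W \ {a, b}) A B → 2 ≤ #A → 2 ≤ #B → #A ≤ 3 → v ∉ A := by
      intro A B hc hA hB hA3 hv
      obtain ⟨x, y, u, h4, h5⟩ := h.of_comp ht hc hv (by omega) (by omega)
      have := hH _ _ _ _ h4
      omega
    have hv : v ∈ (W \ {a, b}) \ (A ∪ B) := by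
      refine mem_sdiff.2 ⟨h.mem_sdiff_pair, ?_⟩
      rw [mem_union, not_or]
      exact ⟨key A B hc (by omega) (by omega) (by omega), key B A hc.symm (by omega) (by omega) (by omega)⟩
    obtain ⟨A', B', hc', hA', hB', hv'⟩ := hC.mem hv
    exact absurd hv' (key A' B' (hc.lift hc') (by omega) (by omega) (by omega))
  · rw [hcz, Kz_eq_Fz (by omega)] at hlt
    exact h.cls_le_ph.trans_lt hlt

/-- In `W \ {a, b}` both `v` and `w` are leaves. If this graph were extremal, they would be the ends
of its path component; its centre `z` would have degree two in `W` and lie on the four-cycle `z, v,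
a, w`. -/
lemma out_lt_one (h : IsC4 G W v a w b) (hI : IH G W) (ht : TF G) (hH : Heavy G W)
    (hr : #W % 4 = 1) (hv : #(nb G W v) = 3) (hw : #(nb G W w) = 3) :
    (#(cls G W ∅ {a, b}) : ℚ) < Fz (#W - 2) := by
  have hcard := h.card_sdiff_pair
  have hcz : (#(W \ {a, b}) : ℤ) = #W - 2 := by omega
  rcases (hI _ h.sdiff_ssubset).2 with hE | hlt
  · have c1 := h.card_out
    have c2 := h.flip.card_out
    obtain ⟨z, hz, hvz, hwz, hnz⟩ := hE.path_of_leaves (by omega) h.mem_sdiff_pair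
      h.flip.mem_sdiff_pair h.vw (by rw [nb_out]; omega) (by rw [nb_out]; omega)
    obtain ⟨hzW, hzab⟩ := mem_sdiff.1 hz
    simp only [mem_insert, mem_singleton, not_or] at hzab
    have h4 : IsC4 G W z v a w := ⟨hzW, h.hv, h.ha, h.hw, hvz.symm, hwz.symm, h.va.symm, h.wa.symm,
      hzab.1, h.vw⟩
    have := hH _ _ _ _ h4
    have e : nb G W z = nb G (W \ {a, b}) z := by
      ext y
      simp only [mem_nb, mem_sdiff, mem_insert, mem_singleton, not_or]
      constructor
      · rintro ⟨hy, hzy⟩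
        refine ⟨⟨hy, ?_, ?_⟩, hzy⟩
        · rintro rfl; exact ht v y z h.va hzy.symm hvz
        · rintro rfl; exact ht v y z h.vb hzy.symm hvz
      · rintro ⟨⟨h1, -⟩, h2⟩; exact ⟨h1, h2⟩
    rw [e, hnz, card_pair h.vw] at this
    omega
  · rw [hcz, Kz_eq_Fz (by omega)] at hlt
    exact h.cls_le_ph.trans_lt hlt

lemma out_le (h : IsC4 G W v a w b) (hI : IH G W) :
    (#(cls G W ∅ {a, b}) : ℚ) ≤ Fz (#W - 2) := by
  have hcard := h.card_sdiff_pair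
  have := (hI _ h.sdiff_ssubset).1
  rw [show (#(W \ {a, b}) : ℤ) = #W - 2 by omega] at this
  exact h.cls_le_ph.trans this

lemma out_le_low (h : IsC4 G W v a w b) (hI : IH G W) (ht : TF G) (hv : #(nb G W v) = 3) :
    (#(cls G W ∅ {a, b}) : ℚ) ≤ Lz (#W - 2) := by
  have hcard := h.card_sdiff_pair
  have c1 := h.card_out
  have := low_degree_le (hI.bdd.subset sdiff_subset) ht h.mem_sdiff_pair (by rw [nb_out]; omega)
  rw [show (#(W \ {a, b}) : ℤ) = #W - 2 by omega] at this
  exact h.cls_le_ph.trans this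

lemma out_le_two (h : IsC4 G W v a w b) (hI : IH G W) (ht : TF G) {v' w' : V}
    (hv : nb G W v \ {a, b} = {v'}) (hw : nb G W w \ {a, b} = {w'}) (hne : v' ≠ w')
    (hr : #W % 4 = 2 ∨ #W % 4 = 3) : (#(cls G W ∅ {a, b}) : ℚ) ≤ Dz (#W - 2) := by
  have hcard := h.card_sdiff_pair
  have hv' := h.out_facts ht (x := v') (by simp [hv])
  have := two_leaves_le (hI.bdd.subset sdiff_subset) ht h.mem_sdiff_pair h.flip.mem_sdiff_pair
    (by rw [nb_out, hv]) (by rw [nb_out, hw]) hne hv'.2.2.2.1.symm (by omega)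
  rw [show (#(W \ {a, b}) : ℤ) = #W - 2 by omega] at this
  exact h.cls_le_ph.trans this

/-- If the common outer neighbour `c` is out, then `v` and `w` are both isolated in `F`. If it is
in, it is matched with one of them, unless both are out. Sets of the last kind avoid the whole cycle
and are left to the other avoiding class. -/
lemma out_le_common (h : IsC4 G W v a w b) {f : ℤ → ℚ} (hf : Bdd G f W) (ht : TF G) {c : V}
    (hv : nb G W v \ {a, b} = {c}) (hw : nb G W w \ {a, b} = {c}) {k : ℕ} (hk : k ≤ #(nb G W c)) :
    (#(cls G W ∅ {a, b} \ cls G W ∅ {v, w}) : ℚ) ≤ f (#W - 5) + 2 * f (#W - (3 + k : ℕ)) := by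
  have hcN : c ∈ nb G W v \ {a, b} := by simp [hv]
  have hcN' : c ∈ nb G W w \ {a, b} := by simp [hw]
  obtain ⟨hcW, hvc, hcv', hcw', hca, hcb, hac, hbc⟩ := h.out_facts ht hcN
  have hwc := (h.flip.out_facts ht hcN').2.1
  have c1 := h.card_out
  have c2 := h.flip.card_out
  rw [hv, card_singleton] at c1
  rw [hw, card_singleton] at c2
  have hnv := nb_of_out hv
  have hnw := nb_of_out hw
  have hsub : cls G W ∅ {a, b} \ cls G W ∅ {v, w} ⊆
      cls G W {v, w} ∅ ∪ (cls G W {v, c} ∅ ∪ cls G W {w, c} ∅) := by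
    intro F hF
    obtain ⟨hF, hF'⟩ := mem_sdiff.1 hF
    have hFM := cls_MD hF
    have haF : a ∉ F := cls_out hF (by simp) (by simp)
    have hbF : b ∉ F := cls_out hF (by simp) (by simp)
    simp only [mem_union]
    by_cases hcF : c ∈ F
    · by_cases hvF : v ∈ F
      · exact Or.inr (Or.inl (pair_cls hFM hvF hcF hvc))
      by_cases hwF : w ∈ F
      · exact Or.inr (Or.inr (pair_cls hFM hwF hcF hwc))
      exact absurd (out_cls hFM (by simp [hvF, hwF])) hF'
    · have hn : ∀ y ∈ F, ¬ G.Adj v y := fun y hy hvy => by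
        rcases hnv y (MD_sub hFM hy) hvy with rfl | rfl | rfl <;> contradiction
      have hn' : ∀ y ∈ F, ¬ G.Adj w y := fun y hy hvy => by
        rcases hnw y (MD_sub hFM hy) hvy with rfl | rfl | rfl <;> contradiction
      exact Or.inl (cls_congr (cls_union (single_cls hFM (mem_of_free hFM h.hv hn) hn)
        (single_cls hFM (mem_of_free hFM h.hw hn') hn')) (by ext; simp) (by simp))
  have := (by exact_mod_cast card_le_card hsub :
    (#(cls G W ∅ {a, b} \ cls G W ∅ {v, w}) : ℚ) ≤ _).trans (cu
    (h.iso_le hf ht (k := 5) (by rw [hv, hw]; simp))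
    (cu (DissociationSets.pair_le hf ht h.hv hcW hvc (3 + k) (by omega))
      (DissociationSets.pair_le hf ht h.hw hcW hwc (3 + k) (by omega))))
  push_cast at *
  linarith

lemma bound_of_cover (h : IsC4 G W v a w b) {S : Finset (Finset V)} {X x1 x2 x3 x4 : ℚ}
    (h1 : (#(cls G W {v, a} ∅) : ℚ) ≤ x1) (h2 : (#(cls G W {v, b} ∅) : ℚ) ≤ x2)
    (h3 : (#(cls G W {w, a} ∅) : ℚ) ≤ x3) (h4 : (#(cls G W {w, b} ∅) : ℚ) ≤ x4)
    (hS : cls G W ∅ {a, b} ∪ cls G W ∅ {v, w} ⊆ S) (hX : (#S : ℚ) ≤ X) :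
    (ph G W : ℚ) ≤ x1 + (x2 + (x3 + (x4 + X))) := by
  refine ph_le_of_cover (fun F hF => ?_) (cu h1 (cu h2 (cu h3 (cu h4 hX))))
  have := h.cover hF
  simp only [mem_union] at this ⊢
  have hS' := @hS F
  rw [mem_union] at hS'
  clear * - this hS'
  tauto

end IsC4

/-- When `v` and `w` become leaves at the same vertex, `two_leaves_le` does not apply. This lets the
bound of `out_le_common` take the place of `Dz`. -/
lemma common_le_Dz (n : ℤ) (h : n % 4 = 2 ∨ n % 4 = 3) : Fz (n - 5) + 2 * Fz (n - 6) ≤ Dz (n - 2) := by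
  obtain ⟨s, hs, hc⟩ := quad_cases n
  simp only [Fz, Dz, quad_far n]
  rcases hc with hc | hc | hc | hc
  · omega
  · omega
  · simp only [hc]; linarith
  · simp only [hc]; linarith

/-- `v` and `w` have exactly one neighbour besides `a` and `b`, and it is the same. -/
def Common (G : SimpleGraph V) [DecidableRel G.Adj] (W : Finset V) (v a w b : V) : Prop :=
  ∃ c, nb G W v \ {a, b} = {c} ∧ nb G W w \ {a, b} = {c}

namespace IsC4
variable {W : Finset V} {v a w b : V}

lemma Common.card (h : IsC4 G W v a w b) (hc : Common G W v a w b) :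
    #(nb G W v) = 3 ∧ #(nb G W w) = 3 := by
  obtain ⟨c, h1, h2⟩ := hc
  have c1 := h.card_out
  have c2 := h.flip.card_out
  rw [h1, card_singleton] at c1
  rw [h2, card_singleton] at c2
  omega

lemma le_of_not_common (h : IsC4 G W v a w b) (hI : IH G W) (ht : TF G)
    (hv : #(nb G W v) = 3) (hw : #(nb G W w) = 3) (hc : ¬ Common G W v a w b)
    (hr : #W % 4 = 2 ∨ #W % 4 = 3) : (#(cls G W ∅ {a, b}) : ℚ) ≤ Dz (#W - 2) := by
  have c1 := h.card_out
  have c2 := h.flip.card_out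
  obtain ⟨v', hv'⟩ := card_eq_one.1 (show #(nb G W v \ {a, b}) = 1 by omega)
  obtain ⟨w', hw'⟩ := card_eq_one.1 (show #(nb G W w \ {a, b}) = 1 by omega)
  exact h.out_le_two hI ht hv' hw' (fun e => hc ⟨v', hv', e ▸ hw'⟩) hr

lemma common_le (h : IsC4 G W v a w b) (hf : Bdd G Fz W) (ht : TF G) (hH : Heavy G W)
    (hc : Common G W v a w b) :
    (#(cls G W ∅ {a, b} \ cls G W ∅ {v, w}) : ℚ) ≤ Fz (#W - 5) + 2 * Fz (#W - 6) := by
  obtain ⟨c, h1, h2⟩ := hc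
  have e1 := h.out_facts ht (x := c) (by simp [h1])
  have e2 := h.flip.out_facts ht (x := c) (by simp [h2])
  have := hH c v a w ⟨e1.1, h.hv, h.ha, h.hw, e1.2.1.symm, e2.2.1.symm, h.va.symm, h.wa.symm,
    e1.2.2.2.2.1, h.vw⟩
  simpa using h.out_le_common hf ht h1 h2 (k := 3) this

/-- The families `S` and `T` may be smaller than the two avoiding classes, so that sets avoiding the
whole cycle can be counted once only. Everything else is the input of `heavy_num`, with the numbers
of outer neighbours truncated at two. -/
lemma lt_of_bounds (h : IsC4 G W v a w b) (hI : IH G W) (ht : TF G) (hH : Heavy G W)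
    {S T : Finset (Finset V)} (hS : S ⊆ cls G W ∅ {a, b}) (hT : T ⊆ cls G W ∅ {v, w})
    (hST : cls G W ∅ {a, b} ∪ cls G W ∅ {v, w} ⊆ S ∪ T)
    (hS1 : #W % 4 = 2 ∨ #W % 4 = 3 → #(nb G W v) = 3 → #(nb G W w) = 3 → (#S : ℚ) ≤ Dz (#W - 2))
    (hT1 : #W % 4 = 2 ∨ #W % 4 = 3 → #(nb G W a) = 3 → #(nb G W b) = 3 → (#T : ℚ) ≤ Dz (#W - 2))
    (h2 : #W % 4 = 2 → #(nb G W v) = 3 → #(nb G W w) = 3 → #(nb G W a) = 3 → #(nb G W b) = 3 → False)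
    (h3 : #W % 4 = 3 → #(nb G W v) = 3 ∨ (#(cls G W ∅ {a, b}) : ℚ) < Fz (#W - 2)) :
    (ph G W : ℚ) < Kz #W := by
  have hf := hI.bdd
  obtain ⟨p, hp⟩ : ∃ p, #(nb G W v) = p + 2 := ⟨_, h.card_out.symm⟩
  obtain ⟨q, hq⟩ : ∃ q, #(nb G W w) = q + 2 := ⟨_, h.flip.card_out.symm⟩
  obtain ⟨r, hr⟩ : ∃ r, #(nb G W a) = r + 2 := ⟨_, h.rot.card_out.symm⟩
  obtain ⟨s, hs⟩ : ∃ s, #(nb G W b) = s + 2 := ⟨_, h.rot.flip.card_out.symm⟩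
  have hp1 := hH _ _ _ _ h
  have hq1 := hH _ _ _ _ h.flip
  have hr1 := hH _ _ _ _ h.rot
  have hs1 := hH _ _ _ _ h.rot.flip
  have hSX : (#S : ℚ) ≤ #(cls G W ∅ {a, b}) := by exact_mod_cast card_le_card hS
  have hTX : (#T : ℚ) ≤ #(cls G W ∅ {v, w}) := by exact_mod_cast card_le_card hT
  have hB := h.bound_of_cover (h.pair_le hf ht hp hr) (h.flip'.pair_le hf ht hp hs)
    (h.flip.pair_le hf ht hq hr) (h.flip.flip'.pair_le hf ht hq hs) hST (cu le_rfl le_rfl)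
  refine hB.trans_lt (lt_of_le_of_lt ?_ (heavy_num #W (i := min p 2) (j := min q 2) (k := min r 2)
    (l := min s 2) (X := #S) (Y := #T) (by omega) (by omega) (by omega) (by omega) (by omega)
    (by omega) (by omega) (by omega) (hSX.trans (h.out_le hI)) (hTX.trans (h.rot.out_le hI))
    (fun e => hSX.trans_lt (h.out_lt_two hI ht hH (by omega)))
    (fun e => hTX.trans_lt (h.rot.out_lt_two hI ht hH (by omega))) ?_ ?_ ?_ ?_ ?_ ?_ ?_))
  · gcongr <;> exact Fz_sub (by omega)
  · rintro (e | e)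
    · exact hSX.trans (h.out_le_low hI ht (by omega))
    · have := h.flip.flip'.out_le_low hI ht (by omega)
      rw [pair_comm] at this
      exact hSX.trans this
  · rintro (e | e)
    · exact hTX.trans (h.rot.out_le_low hI ht (by omega))
    · have := h.rot.flip.flip'.out_le_low hI ht (by omega)
      rw [pair_comm] at this
      exact hTX.trans this
  · intro e e1 e2; exact hS1 (by omega) (by omega) (by omega)
  · intro e e1 e2; exact hT1 (by omega) (by omega) (by omega)
  · intro e e1 e2 e3 e4
    exact hSX.trans_lt (h.out_lt_one hI ht hH (by omega) (by omega) (by omega))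
  · intro e e1 e2 e3 e4; exact h2 (by omega) (by omega) (by omega) (by omega) (by omega)
  · intro e e1 e2 e3 e4
    exact hSX.trans_lt ((h3 (by omega)).resolve_left (by omega))

lemma heavy_one_common (h : IsC4 G W v a w b) (hI : IH G W) (ht : TF G) (hH : Heavy G W)
    (hc : Common G W v a w b) (hc' : ¬ Common G W a v b w) : (ph G W : ℚ) < Kz #W := by
  have hf := hI.bdd
  obtain ⟨hv, hw⟩ := Common.card h hc
  have hX := h.common_le hf ht hH hc
  have hcov : cls G W ∅ {a, b} ∪ cls G W ∅ {v, w} ⊆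
      (cls G W ∅ {a, b} \ cls G W ∅ {v, w}) ∪ cls G W ∅ {v, w} := by
    rw [sdiff_union_self_eq_union]
  by_cases hall : #W % 4 = 2 ∧ #(nb G W a) = 3 ∧ #(nb G W b) = 3
  · obtain ⟨hr, ha, hb⟩ := hall
    have hY := h.rot.le_of_not_common hI ht ha hb hc' (by omega)
    have hB := h.bound_of_cover (h.pair_le hf ht hv ha) (h.flip'.pair_le hf ht hv hb)
      (h.flip.pair_le hf ht hw ha) (h.flip.flip'.pair_le hf ht hw hb) hcov (cu le_rfl le_rfl)
    have := (heavy_num_two #W (by omega)).1 _ _ hX hY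
    norm_num at hB
    linarith
  · exact h.lt_of_bounds hI ht hH sdiff_subset le_rfl hcov
      (fun e _ _ => hX.trans (common_le_Dz _ (by omega)))
      (fun e e1 e2 => h.rot.le_of_not_common hI ht e1 e2 hc' (by omega))
      (fun e _ _ e1 e2 => hall ⟨e, e1, e2⟩) (fun _ => Or.inl hv)

/-- A four-cycle in a heavy graph gives a strict bound, apart from two situations in residue two. -/
lemma heavy_lt (h : IsC4 G W v a w b) (hI : IH G W) (ht : TF G) (hH : Heavy G W)
    (h3 : #W % 4 = 3 → #(nb G W v) = 3 ∨ (#(cls G W ∅ {a, b}) : ℚ) < Fz (#W - 2))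
    (h2 : #W % 4 = 2 → (Common G W v a w b ∧ Common G W a v b w) ∨
      (#(nb G W v) = 3 ∧ #(nb G W w) = 3 ∧ #(nb G W a) = 3 ∧ #(nb G W b) = 3 ∧
        ¬ Common G W v a w b ∧ ¬ Common G W a v b w) → False) : (ph G W : ℚ) < Kz #W := by
  have hf := hI.bdd
  by_cases hc : Common G W v a w b <;> by_cases hc' : Common G W a v b w
  · obtain ⟨hv, hw⟩ := Common.card h hc
    obtain ⟨ha, hb⟩ := Common.card h.rot hc'
    by_cases hr : #W % 4 = 3
    · have hX := h.common_le hf ht hH hc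
      have hB := h.bound_of_cover (h.pair_le hf ht hv ha) (h.flip'.pair_le hf ht hv hb)
        (h.flip.pair_le hf ht hw ha) (h.flip.flip'.pair_le hf ht hw hb)
        (S := (cls G W ∅ {a, b} \ cls G W ∅ {v, w}) ∪ cls G W ∅ {v, w})
        (by rw [sdiff_union_self_eq_union]) (cu hX (h.rot.out_le_low hI ht ha))
      have := (heavy_num_three #W (by omega)).2
      norm_num at hB
      linarith
    · exact h.lt_of_bounds hI ht hH le_rfl le_rfl le_rfl (fun e => (h2 (by omega) (Or.inl ⟨hc, hc'⟩)).elim)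
        (fun e => (h2 (by omega) (Or.inl ⟨hc, hc'⟩)).elim)
        (fun e => (h2 (by omega) (Or.inl ⟨hc, hc'⟩)).elim) h3
  · exact h.heavy_one_common hI ht hH hc hc'
  · exact h.rot.heavy_one_common hI ht hH hc' hc
  · exact h.lt_of_bounds hI ht hH le_rfl le_rfl le_rfl
      (fun e e1 e2 => h.le_of_not_common hI ht e1 e2 hc (by omega))
      (fun e e1 e2 => h.rot.le_of_not_common hI ht e1 e2 hc' (by omega))
      (fun e e1 e2 e3 e4 => h2 e (Or.inr ⟨e1, e2, e3, e4, hc, hc'⟩)) h3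

end IsC4

/-! ### Residue two: common outer neighbours on both sides -/

namespace IsC4
variable {W : Finset V} {v a w b : V}

/-- A set avoiding the four-cycle contains the outer neighbour `c` together with a neighbour of it. -/
lemma avoid_all (h : IsC4 G W v a w b) {c : V} (hc : nb G W v \ {a, b} = {c})
    {F : Finset V} (hF : F ∈ cls G W ∅ {v, a, w, b}) : ∃ x ∈ nb G W c, c ∈ F ∧ x ∈ F := by
  have hFM := cls_MD hF
  have hout : ∀ y ∈ ({v, a, w, b} : Finset V), y ∉ F := fun y hy => cls_out hF hy (by simp)
  have key : ∀ y ∈ F, G.Adj v y → y = c := by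
    intro y hy hvy
    rcases nb_of_out hc y (MD_sub hFM hy) hvy with rfl | rfl | rfl
    · exact absurd hy (hout _ (by simp))
    · exact absurd hy (hout _ (by simp))
    · rfl
  rcases blocked hFM h.hv (hout _ (by simp)) with ⟨y, hy, z, hz, hne, h1, h2⟩ | ⟨y, hy, h1, z, hz, h2⟩
  · exact absurd ((key y hy h1).trans (key z hz h2).symm) hne
  · obtain rfl := key y hy h1
    exact ⟨z, mem_nb.2 ⟨MD_sub hFM hz, h2⟩, hy, hz⟩

lemma avoid_all_le (h : IsC4 G W v a w b) {f : ℤ → ℚ} (hf : Bdd G f W) (ht : TF G) {c : V} {m : ℕ}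
    (hc : nb G W v \ {a, b} = {c}) (hc' : nb G W w \ {a, b} = {c}) (hm : #(nb G W c) = m + 2) :
    (#(cls G W ∅ {v, a, w, b}) : ℚ) ≤ m * f (#W - (5 + m : ℕ)) := by
  obtain ⟨hcW, hvc, hcv, hcw, hca, hcb, hac, hbc⟩ := h.out_facts ht (x := c) (by simp [hc])
  have hwc := (h.flip.out_facts ht (x := c) (by simp [hc'])).2.1
  have hsub : ({v, w} : Finset V) ⊆ nb G W c := by
    intro y hy; simp only [mem_insert, mem_singleton] at hy
    rcases hy with rfl | rfl
    · exact mem_nb.2 ⟨h.hv, hvc.symm⟩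
    · exact mem_nb.2 ⟨h.hw, hwc.symm⟩
  have hcard : #(nb G W c \ {v, w}) = m := by
    rw [card_sdiff_of_subset hsub, hm, card_pair h.vw]; omega
  have hcov : cls G W ∅ {v, a, w, b} ⊆
      (nb G W c \ {v, w}).biUnion fun x => cls G W {c, x} {v, a, w, b} := by
    intro F hF
    obtain ⟨x, hx, hcF, hxF⟩ := h.avoid_all hc hF
    have hout : ∀ y ∈ ({v, a, w, b} : Finset V), y ∉ F := fun y hy => cls_out hF hy (by simp)
    refine mem_biUnion.2 ⟨x, mem_sdiff.2 ⟨hx, ?_⟩,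
      cls_congr (cls_union (pair_cls (cls_MD hF) hcF hxF (mem_nb.1 hx).2) hF) (by simp) (by simp)⟩
    simp only [mem_insert, mem_singleton, not_or]
    exact ⟨fun e => hout v (by simp) (e ▸ hxF), fun e => hout w (by simp) (e ▸ hxF)⟩
  have hle : (#(cls G W ∅ {v, a, w, b}) : ℚ) ≤
      #((nb G W c \ {v, w}).biUnion fun x => cls G W {c, x} {v, a, w, b}) := by exact_mod_cast (card_le_card hcov)
  rw [← hcard]
  refine hle.trans (biUnion_le fun x hx => cls_le hf _ _ ({c, a, b} ∪ nb G W c) _ ?_ ?_ (card_pos.2 ⟨c, by simp⟩))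
  · intro z hz
    simp only [mem_union, mem_insert, mem_singleton] at hz
    rcases hz with (rfl | rfl | rfl) | hz
    · exact ⟨hcW, by simp⟩
    · exact ⟨h.ha, by simp⟩
    · exact ⟨h.hb, by simp⟩
    · exact ⟨(mem_nb.1 hz).1, Or.inr (Or.inl ⟨c, by simp, (mem_nb.1 hz).2⟩)⟩
  · rw [card_union_of_disjoint, card_insert_of_notMem (by simp [hca, hcb]), card_pair h.ab]
    · omega
    · rw [disjoint_left]; intro y hy
      simp only [mem_insert, mem_singleton] at hy
      rcases hy with rfl | rfl | rfl
      · simp [mem_nb]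
      · exact fun hy => hac (mem_nb.1 hy).2.symm
      · exact fun hy => hbc (mem_nb.1 hy).2.symm

/-- Both avoiding classes are reduced to the sets meeting the cycle, and those missing it entirely
are counted separately by `Q`. -/
lemma both_common_bound (h : IsC4 G W v a w b) {f : ℤ → ℚ} (hf : Bdd G f W) (ht : TF G)
    {c e : V} (hcv : nb G W v \ {a, b} = {c}) (hcw : nb G W w \ {a, b} = {c})
    (hea : nb G W a \ {v, w} = {e}) (heb : nb G W b \ {v, w} = {e}) {k l : ℕ}
    (hk : k ≤ #(nb G W c)) (hl : l ≤ #(nb G W e)) {Q : ℚ}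
    (hQ : (#(cls G W ∅ {v, a, w, b}) : ℚ) ≤ Q) :
    (ph G W : ℚ) ≤ 4 * f (#W - 6) + (f (#W - 5) + 2 * f (#W - (3 + k : ℕ))) +
      (f (#W - 5) + 2 * f (#W - (3 + l : ℕ))) + Q := by
  obtain ⟨hv, hw⟩ := Common.card h ⟨c, hcv, hcw⟩
  obtain ⟨ha, hb⟩ := Common.card h.rot ⟨e, hea, heb⟩
  have hcov : cls G W ∅ {a, b} ∪ cls G W ∅ {v, w} ⊆
      (cls G W ∅ {a, b} \ cls G W ∅ {v, w}) ∪ ((cls G W ∅ {v, w} \ cls G W ∅ {a, b}) ∪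
        cls G W ∅ {v, a, w, b}) := by
    intro F hF
    simp only [mem_union, mem_sdiff] at hF ⊢
    by_cases h1 : F ∈ cls G W ∅ {a, b} <;> by_cases h2 : F ∈ cls G W ∅ {v, w}
    · exact Or.inr (Or.inr (cls_congr (cls_union h1 h2) (by simp) (by ext; simp; clear * -; tauto)))
    · exact Or.inl ⟨h1, h2⟩
    · exact Or.inr (Or.inl ⟨h2, h1⟩)
    · simp [h1, h2] at hF
  have hB := h.bound_of_cover (h.pair_le hf ht hv ha) (h.flip'.pair_le hf ht hv hb)
    (h.flip.pair_le hf ht hw ha) (h.flip.flip'.pair_le hf ht hw hb) hcov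
    (cu (h.out_le_common hf ht hcv hcw hk) (cu (h.rot.out_le_common hf ht hea heb hl) hQ))
  push_cast at hB ⊢
  linarith

lemma both_common_lt (h : IsC4 G W v a w b) (hf : Bdd G Fz W) (ht : TF G)
    {c e : V} (hcv : nb G W v \ {a, b} = {c}) (hcw : nb G W w \ {a, b} = {c})
    (hea : nb G W a \ {v, w} = {e}) (heb : nb G W b \ {v, w} = {e}) (hr : #W % 4 = 2)
    (hc : 4 ≤ #(nb G W c)) (he : 3 ≤ #(nb G W e)) : (ph G W : ℚ) < Kz #W := by
  obtain ⟨m, hm⟩ : ∃ m, #(nb G W c) = m + 2 := ⟨#(nb G W c) - 2, by omega⟩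
  have hQ := h.avoid_all_le hf ht hcv hcw hm
  have hB := h.both_common_bound hf ht hcv hcw hea heb hc he hQ
  obtain ⟨-, -, -, h1, h2⟩ := heavy_num_two #W (by omega)
  have hQ' : (m : ℚ) * Fz (#W - (5 + m : ℕ)) ≤ 2 * Fz (#W - 7) := by
    rcases (show 2 ≤ m by omega).eq_or_lt with rfl | h3
    · norm_num
    · refine le_trans ?_ h2
      exact Fz_lump (#W - 5) le_rfl h3 (by push_cast; ring) (by ring)
  norm_num at hB
  norm_num at hQ'
  linarith

/-- If `c` or `e` has degree at least four, the count is strict. If both are cubic and adjacent, the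
six vertices form a K_{3,3} component. If they are not adjacent, a set avoiding the cycle contains
both, each matched with its only neighbour off the cycle, so that eight vertices are decided at
once. -/
lemma both_common_good (h : IsC4 G W v a w b) (hI : IH G W) (ht : TF G) (hH : Heavy G W)
    (hC : Common G W v a w b) (hC' : Common G W a v b w) (hr : #W % 4 = 2) : Good G W := by
  have hf := hI.bdd
  obtain ⟨c, hcv, hcw⟩ := hC
  obtain ⟨e, hea, heb⟩ := hC'
  obtain ⟨hv, hw⟩ := Common.card h ⟨c, hcv, hcw⟩
  obtain ⟨ha, hb⟩ := Common.card h.rot ⟨e, hea, heb⟩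
  obtain ⟨hcW, hvc, hc_v, hc_w, hc_a, hc_b, hac, hbc⟩ := h.out_facts ht (x := c) (by simp [hcv])
  have hwc := (h.flip.out_facts ht (x := c) (by simp [hcw])).2.1
  obtain ⟨heW, hae, he_a, he_b, he_v, he_w, hve, hwe⟩ := h.rot.out_facts ht (x := e) (by simp [hea])
  have hbe := (h.rot.flip.out_facts ht (x := e) (by simp [heb])).2.1
  have hce : c ≠ e := by rintro rfl; exact hac hae
  have hc3 := hH c v a w ⟨hcW, h.hv, h.ha, h.hw, hvc.symm, hwc.symm, h.va.symm, h.wa.symm, hc_a, h.vw⟩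
  have he3 := hH e a v b ⟨heW, h.ha, h.hv, h.hb, hae.symm, hbe.symm, h.va, h.vb, he_v, h.ab⟩
  rcases hc3.eq_or_lt with hc3 | hc4
  swap
  · exact Good.of_lt (h.both_common_lt hf ht hcv hcw hea heb hr hc4 he3)
  rcases he3.eq_or_lt with he3 | he4
  swap
  · exact Good.of_lt (h.rot.both_common_lt hf ht hea heb hcv hcw hr he4 hc3.le)
  have three : ∀ x y z u : V, #(nb G W u) = 3 → x ∈ nb G W u → y ∈ nb G W u → z ∈ nb G W u →
      x ≠ y → x ≠ z → y ≠ z → nb G W u = {x, y, z} := by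
    intro x y z u h3 hx hy hz h1 h2 h4
    refine (eq_of_subset_of_card_le ?_ ?_).symm
    · intro t ht; simp only [mem_insert, mem_singleton] at ht
      rcases ht with rfl | rfl | rfl <;> assumption
    · rw [h3, card_insert_of_notMem (by simp [h1, h2]), card_pair h4]
  have mW := fun (x y : V) (hy : y ∈ W) (hxy : G.Adj x y) => (mem_nb.2 ⟨hy, hxy⟩ : y ∈ nb G W x)
  by_cases hadj : G.Adj c e
  · refine good_K33_comp hI (A := {v, w, e}) (B := {a, b, c}) ⟨?_, ?_, ?_, ?_⟩ ?_ ?_ hr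
    · intro z hz; simp only [mem_insert, mem_singleton] at hz
      rcases hz with rfl | rfl | rfl
      exacts [h.hv, h.hw, heW]
    · intro z hz; simp only [mem_insert, mem_singleton] at hz
      rcases hz with rfl | rfl | rfl
      exacts [h.ha, h.hb, hcW]
    · intro z hz; simp only [mem_insert, mem_singleton] at hz
      rcases hz with rfl | rfl | rfl
      · exact three _ _ _ _ hv (mW _ _ h.ha h.va) (mW _ _ h.hb h.vb) (mW _ _ hcW hvc) h.ab hc_a.symm hc_b.symm
      · exact three _ _ _ _ hw (mW _ _ h.ha h.wa) (mW _ _ h.hb h.wb) (mW _ _ hcW hwc) h.ab hc_a.symm hc_b.symm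
      · exact three _ _ _ _ he3.symm (mW _ _ h.ha hae.symm) (mW _ _ h.hb hbe.symm) (mW _ _ hcW hadj.symm)
          h.ab hc_a.symm hc_b.symm
    · intro z hz; simp only [mem_insert, mem_singleton] at hz
      rcases hz with rfl | rfl | rfl
      · exact three _ _ _ _ ha (mW _ _ h.hv h.va.symm) (mW _ _ h.hw h.wa.symm) (mW _ _ heW hae) h.vw he_v.symm he_w.symm
      · exact three _ _ _ _ hb (mW _ _ h.hv h.vb.symm) (mW _ _ h.hw h.wb.symm) (mW _ _ heW hbe) h.vw he_v.symm he_w.symm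
      · exact three _ _ _ _ hc3.symm (mW _ _ h.hv hvc.symm) (mW _ _ h.hw hwc.symm) (mW _ _ heW hadj)
          h.vw he_v.symm he_w.symm
    · rw [card_insert_of_notMem (by simp [h.vw, he_v.symm]), card_pair he_w.symm]
    · rw [card_insert_of_notMem (by simp [h.ab, hc_a.symm]), card_pair hc_b.symm]
  refine Good.of_lt ?_
  have hQ : (#(cls G W ∅ {v, a, w, b}) : ℚ) ≤ Fz (#W - 8) := by
    rcases (cls G W ∅ {v, a, w, b}).eq_empty_or_nonempty with h0 | ⟨F, hF⟩
    · rw [h0]; simpa using (Fz_pos _).le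
    have hrot : ∀ F, F ∈ cls G W ∅ {v, a, w, b} → F ∈ cls G W ∅ {a, v, b, w} := fun F hF =>
      cls_congr hF rfl (by ext; simp; clear * -; tauto)
    have hQF : ∀ F ∈ cls G W ∅ {v, a, w, b}, v ∉ F ∧ a ∉ F ∧ w ∉ F ∧ b ∉ F := fun F hF =>
      ⟨cls_out hF (by simp) (by simp), cls_out hF (by simp) (by simp), cls_out hF (by simp) (by simp),
        cls_out hF (by simp) (by simp)⟩
    obtain ⟨x, hx, hcF, hxF⟩ := h.avoid_all hcv hF
    obtain ⟨y, hy, heF, hyF⟩ := h.rot.avoid_all hea (hrot F hF)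
    obtain ⟨f1, f2, f3, f4⟩ := hQF F hF
    have hx4 : x ≠ v ∧ x ≠ a ∧ x ≠ w ∧ x ≠ b := by
      refine ⟨?_, ?_, ?_, ?_⟩ <;> (rintro rfl; contradiction)
    have hy4 : y ≠ v ∧ y ≠ a ∧ y ≠ w ∧ y ≠ b := by
      refine ⟨?_, ?_, ?_, ?_⟩ <;> (rintro rfl; contradiction)
    obtain ⟨hxW, hcx⟩ := mem_nb.1 hx
    obtain ⟨hyW, hey⟩ := mem_nb.1 hy
    have hnc := three _ _ _ _ hc3.symm (mW _ _ h.hv hvc.symm) (mW _ _ h.hw hwc.symm) hx h.vw hx4.1.symm hx4.2.2.1.symm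
    have hne := three _ _ _ _ he3.symm (mW _ _ h.ha hae.symm) (mW _ _ h.hb hbe.symm) hy h.ab hy4.2.1.symm hy4.2.2.2.symm
    have hxy : x ≠ y := by
      rintro rfl
      exact hce ((mem_MD.1 (cls_MD hF)).2.1.eq hxF hcF heF hcx.symm hey.symm)
    have hxe : x ≠ e := by rintro rfl; exact hadj hcx
    have hyc : y ≠ c := by rintro rfl; exact hadj hey.symm
    have hcov : cls G W ∅ {v, a, w, b} ⊆ cls G W {c, x, e, y} {v, a, w, b} := by
      intro F hF
      obtain ⟨x', hx', hcF, hxF⟩ := h.avoid_all hcv hF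
      obtain ⟨y', hy', heF, hyF⟩ := h.rot.avoid_all hea (hrot F hF)
      obtain ⟨f1, f2, f3, f4⟩ := hQF F hF
      have ex : x' = x := by
        rw [hnc] at hx'; simp only [mem_insert, mem_singleton] at hx'
        rcases hx' with rfl | rfl | rfl
        · exact absurd hxF f1
        · exact absurd hxF f3
        · rfl
      have ey : y' = y := by
        rw [hne] at hy'; simp only [mem_insert, mem_singleton] at hy'
        rcases hy' with rfl | rfl | rfl
        · exact absurd hyF f2
        · exact absurd hyF f4
        · rfl
      rw [ex] at hxF
      rw [ey] at hyF
      exact cls_congr (cls_union (cls_union (pair_cls (cls_MD hF) hcF hxF hcx)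
        (pair_cls (cls_MD hF) heF hyF hey)) hF) (by ext; simp; clear * -; tauto) (by simp)
    refine (by exact_mod_cast card_le_card hcov : (#(cls G W ∅ {v, a, w, b}) : ℚ) ≤ _).trans
      (cls_le hf _ _ {x, y, c, e, v, w, a, b} 8 ?_ ?_ (card_pos.2 ⟨x, by simp⟩))
    · intro z hz; simp only [mem_insert, mem_singleton] at hz
      rcases hz with rfl | rfl | rfl | rfl | rfl | rfl | rfl | rfl
      · exact ⟨hxW, by simp⟩
      · exact ⟨hyW, by simp⟩
      · exact ⟨hcW, by simp⟩
      · exact ⟨heW, by simp⟩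
      · exact ⟨h.hv, by simp⟩
      · exact ⟨h.hw, by simp⟩
      · exact ⟨h.ha, by simp⟩
      · exact ⟨h.hb, by simp⟩
    · rw [card_insert_of_notMem (by simp [hxy, hx4, hxe, hcx.ne.symm]),
        card_insert_of_notMem (by simp [hy4, hyc, hey.ne.symm]),
        card_insert_of_notMem (by simp [hce, hc_v, hc_w, hc_a, hc_b]),
        card_insert_of_notMem (by simp [he_v, he_w, he_a, he_b]),
        card_insert_of_notMem (by simp [h.vw, h.va.ne, h.vb.ne]),
        card_insert_of_notMem (by simp [h.wa.ne, h.wb.ne]), card_pair h.ab]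
  have hB := h.both_common_bound hf ht hcv hcw hea heb hc3.le he3.le hQ
  obtain ⟨-, -, h1, -⟩ := heavy_num_two #W (by omega)
  norm_num at hB
  linarith

end IsC4

/-! ### Residue two: special four-cycles -/

namespace IsC4
variable {W : Finset V} {v a w b : V}

/-- All four vertices have degree three and opposite vertices have distinct outer neighbours. -/
def Special (G : SimpleGraph V) [DecidableRel G.Adj] (W : Finset V) (v a w b : V) : Prop :=
  #(nb G W v) = 3 ∧ #(nb G W w) = 3 ∧ #(nb G W a) = 3 ∧ #(nb G W b) = 3 ∧
    ¬ Common G W v a w b ∧ ¬ Common G W a v b w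

lemma pair_special (h : IsC4 G W v a w b) (ht : TF G) {v' a' : V}
    (hv : nb G W v \ {a, b} = {v'}) (ha : nb G W a \ {v, w} = {a'}) :
    #(cls G W {v, a} ∅) ≤ ph G (W \ {v, a, w, b, v', a'}) ∧ #(W \ {v, a, w, b, v', a'}) + 6 = #W := by
  obtain ⟨v1, v2, v3, v4, v5, v6, v7, v8⟩ := h.out_facts ht (x := v') (by simp [hv])
  obtain ⟨a1, a2, a3, a4, a5, a6, a7, a8⟩ := h.rot.out_facts ht (x := a') (by simp [ha])
  have hz : zone G W {v, a} ∅ = {v, a, w, b, v', a'} := by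
    ext z
    simp only [mem_zone, mem_insert, mem_singleton, exists_eq_or_imp, exists_eq_left, notMem_empty,
      or_false]
    constructor
    · rintro ⟨hz, (rfl | rfl) | hz' | hz'⟩
      · simp
      · simp
      · rcases nb_of_out hv z hz hz' with rfl | rfl | rfl <;> simp
      · rcases nb_of_out ha z hz hz' with rfl | rfl | rfl <;> simp
    · rintro (rfl | rfl | rfl | rfl | rfl | rfl)
      exacts [⟨h.hv, by simp⟩, ⟨h.ha, by simp⟩, ⟨h.hw, by simp [h.wa.symm]⟩, ⟨h.hb, by simp [h.vb]⟩,
        ⟨v1, by simp [v2]⟩, ⟨a1, by simp [a2]⟩]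
  have h1 := card_cls_le_ph (G := G) W {v, a} ∅
  rw [hz] at h1
  refine ⟨h1, ?_⟩
  have hc : #({v, a, w, b, v', a'} : Finset V) = 6 := by
    have : v' ≠ a' := by rintro rfl; exact v7 a2
    rw [card_insert_of_notMem (by simp [h.va.ne, h.vw, h.vb.ne, v3.symm, a5.symm]),
      card_insert_of_notMem (by simp [h.wa.ne.symm, h.ab, v5.symm, a3.symm]),
      card_insert_of_notMem (by simp [h.wb.ne, v4.symm, a6.symm]),
      card_insert_of_notMem (by simp [v6.symm, a4.symm]), card_pair this]
  rw [← hc]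
  refine card_sdiff_add_card_eq_card ?_
  rw [← hz]
  exact filter_subset _ _

/-- The two vertex sets differ only in that the first contains `b'` and the second `a'`. Let `b', x,
d, y` be the four-cycle through `b'` in the first. In the second, `x` and `y` lose `b'` but still
have degree two, so both are adjacent to `a'`. Then `x, b', y, a'` is a four-cycle in which `x` and
`y` have the common outer neighbour `d`, contrary to `Special`. -/
lemma not_both_c4s (h : IsC4 G W v a w b) (ht : TF G)
    (hS : ∀ v a w b, IsC4 G W v a w b → Special G W v a w b) {v' a' b' : V}
    (hv : nb G W v \ {a, b} = {v'}) (ha : nb G W a \ {v, w} = {a'}) (hb : nb G W b \ {v, w} = {b'})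
    (hab : a' ≠ b') (h1 : C4s G (W \ {v, a, w, b, v', a'})) (h2 : C4s G (W \ {v, b, w, a, v', b'})) :
    False := by
  obtain ⟨v1, v2, v3, v4, v5, v6, v7, v8⟩ := h.out_facts ht (x := v') (by simp [hv])
  obtain ⟨a1, a2, a3, a4, a5, a6, a7, a8⟩ := h.rot.out_facts ht (x := a') (by simp [ha])
  obtain ⟨b1, b2, b3, b4, b5, b6, b7, b8⟩ := h.rot.flip.out_facts ht (x := b') (by simp [hb])
  have hbv : b' ≠ v' := by rintro rfl; exact b7 v2
  obtain ⟨A, B, hc, hA, hB, hbA⟩ := h1.mem (v := b') (by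
    simp [b1, b5, b4, b6, b3, hbv, hab.symm])
  obtain ⟨d, hd, hdb⟩ := card_two_le_exists hA.ge b'
  have hAeq : A = {b', d} := by
    refine (eq_of_subset_of_card_le ?_ ?_).symm
    · intro z hz; simp only [mem_insert, mem_singleton] at hz
      rcases hz with rfl | rfl <;> assumption
    · rw [hA, card_pair hdb.symm]
  have key : ∀ x ∈ B, x ∈ W ∧ x ≠ a' ∧ G.Adj x b' ∧ G.Adj x d ∧ G.Adj x a' := by
    intro x hx
    have hxW := mem_sdiff.1 (hc.2.1 hx)
    have hxb := (hc.adj hbA hx).symm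
    have hxd := (hc.adj hd hx).symm
    obtain ⟨hxW, hx2⟩ := hxW
    simp only [mem_insert, mem_singleton, not_or] at hx2
    obtain ⟨A', B', hc', hA', hB', hxA'⟩ := h2.mem (v := x) (by simp [hxW, hx2, hxb.ne])
    refine ⟨hxW, hx2.2.2.2.2.2, hxb, hxd, ?_⟩
    by_contra hxa
    have hsub : B' ⊆ {d} := by
      intro y hy
      have hxy := hc'.adj hxA' hy
      obtain ⟨hyW, hy2⟩ := mem_sdiff.1 (hc'.2.1 hy)
      simp only [mem_insert, mem_singleton, not_or] at hy2
      have hya : y ≠ a' := by rintro rfl; exact hxa hxy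
      have : y ∈ nb G (W \ {v, a, w, b, v', a'}) x := mem_nb.2 ⟨by simp [hyW, hy2, hya], hxy⟩
      rw [hc.2.2.2 x hx, hAeq] at this
      simp only [mem_insert, mem_singleton] at this
      rw [mem_singleton]
      exact this.resolve_left hy2.2.2.2.2.2
    have := card_le_card hsub
    rw [card_singleton] at this
    omega
  obtain ⟨x, y, hxy, hBeq⟩ := card_eq_two.1 hB
  have kx := key x (by simp [hBeq])
  have ky := key y (by simp [hBeq])
  have h4 : IsC4 G W x b' y a' := ⟨kx.1, b1, ky.1, a1, kx.2.2.1, kx.2.2.2.2, ky.2.2.1, ky.2.2.2.2,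
    hxy, hab.symm⟩
  obtain ⟨s1, s2, -, -, s3, -⟩ := hS _ _ _ _ h4
  have hda : d ≠ a' := by
    rintro rfl
    have := (mem_sdiff.1 (hc.1 hd)).2
    simp at this
  have hdW : d ∈ W := (mem_sdiff.1 (hc.1 hd)).1
  have out : ∀ x y, IsC4 G W x b' y a' → #(nb G W x) = 3 → G.Adj x d → nb G W x \ {b', a'} = {d} := by
    intro x y h4 h3 hxd
    have c1 := h4.card_out
    refine (eq_of_subset_of_card_le ?_ (by rw [card_singleton]; omega)).symm
    simp [mem_nb, hdW, hxd, hdb, hda]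
  exact s3 ⟨d, out x y h4 s1 kx.2.2.2.1, out y x h4.flip s2 ky.2.2.2.1⟩

lemma special_lt (h : IsC4 G W v a w b) (hI : IH G W) (ht : TF G)
    (hS : Special G W v a w b) (hr : #W % 4 = 2)
    (hlt : (#(cls G W {v, a} ∅) : ℚ) < Kz (#W - 6)) : (ph G W : ℚ) < Kz #W := by
  obtain ⟨hv, hw, ha, hb, hC, hC'⟩ := hS
  have hf := hI.bdd
  have hB := h.bound_of_cover le_rfl (h.flip'.pair_le hf ht hv hb)
    (h.flip.pair_le hf ht hw ha) (h.flip.flip'.pair_le hf ht hw hb) le_rfl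
    (cu (h.le_of_not_common hI ht hv hw hC (by omega)) (h.rot.le_of_not_common hI ht ha hb hC' (by omega)))
  obtain ⟨-, h1, -⟩ := heavy_num_two #W (by omega)
  norm_num at hB
  linarith

/-- The remainder of the edge class of `v` and `a` has order divisible by 4. Unless it is a union of
four-cycles, the gap in `Kz` makes the total strict. The same holds for `v` and `b`, and the two
remainders cannot both be exceptional. -/
lemma all_special_lt (h : IsC4 G W v a w b) (hI : IH G W) (ht : TF G)
    (hS : ∀ v a w b, IsC4 G W v a w b → Special G W v a w b) (hr : #W % 4 = 2) :
    (ph G W : ℚ) < Kz #W := by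
  have hSh := hS _ _ _ _ h
  obtain ⟨hv, hw, ha, hb, hC, hC'⟩ := hSh
  have c1 := h.card_out
  have c2 := h.rot.card_out
  have c3 := h.rot.flip.card_out
  obtain ⟨v', hv'⟩ := card_eq_one.1 (show #(nb G W v \ {a, b}) = 1 by omega)
  obtain ⟨a', ha'⟩ := card_eq_one.1 (show #(nb G W a \ {v, w}) = 1 by omega)
  obtain ⟨b', hb'⟩ := card_eq_one.1 (show #(nb G W b \ {v, w}) = 1 by omega)
  have hab : a' ≠ b' := fun e => hC' ⟨a', ha', e ▸ hb'⟩
  have key : ∀ {a b a' : V}, IsC4 G W v a w b → nb G W v \ {a, b} = {v'} → nb G W a \ {v, w} = {a'} →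
      (ph G W : ℚ) < Kz #W ∨ C4s G (W \ {v, a, w, b, v', a'}) := by
    intro a b a' h hv' ha'
    obtain ⟨l1, l2⟩ := h.pair_special ht hv' ha'
    have hss : W \ {v, a, w, b, v', a'} ⊂ W := Finset.ssubset_iff_subset_ne.2 ⟨sdiff_subset, fun e => by
      rw [e] at l2; omega⟩
    rcases (hI _ hss).2 with hE | hlt
    · exact Or.inr (hE.c4s (by omega))
    · refine Or.inl (h.special_lt hI ht (hS _ _ _ _ h) hr ?_)
      rw [show (#(W \ {v, a, w, b, v', a'}) : ℤ) = #W - 6 by omega] at hlt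
      exact lt_of_le_of_lt (by exact_mod_cast l1) hlt
  rcases key h hv' ha' with h1 | h1
  · exact h1
  rcases key h.flip' (by rw [pair_comm, hv']) hb' with h2 | h2
  · exact h2
  exact (h.not_both_c4s ht hS hv' ha' hb' hab h1 h2).elim

end IsC4

/-- The four-cycle has to be chosen: at residue 2 a non-special one if there is any, at the other
residues one with a cubic vertex if there is any. If there is none with a cubic vertex,
`out_lt_three` supplies the strictness required at residue 3. -/
lemma heavy_good {W : Finset V} (hI : IH G W) (ht : TF G) (hH : Heavy G W) {v a w b : V}
    (h : IsC4 G W v a w b) : Good G W := by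
  by_cases hr2 : #W % 4 = 2
  · by_cases hS : ∀ v a w b, IsC4 G W v a w b → IsC4.Special G W v a w b
    · exact Good.of_lt (h.all_special_lt hI ht hS hr2)
    · push Not at hS
      obtain ⟨v, a, w, b, h, hS⟩ := hS
      by_cases hC : Common G W v a w b ∧ Common G W a v b w
      · exact h.both_common_good hI ht hH hC.1 hC.2 hr2
      · exact Good.of_lt (h.heavy_lt hI ht hH (by omega) fun _ e => e.elim hC hS)
  by_cases h3 : ∀ v a w b, IsC4 G W v a w b → 4 ≤ #(nb G W v)
  · exact Good.of_lt (h.heavy_lt hI ht hH (fun hr => Or.inr (h.out_lt_three hI ht h3 hr))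
      fun e => absurd e hr2)
  · push Not at h3
    obtain ⟨v, a, w, b, h, h3⟩ := h3
    have := hH _ _ _ _ h
    exact Good.of_lt (h.heavy_lt hI ht hH (fun _ => Or.inl (by omega)) fun e => absurd e hr2)

/-! ### Base cases and the main induction -/

lemma ph_le_one {W : Finset V} (h : Diss G W) : ph G W ≤ 1 := by
  refine card_le_one.2 fun F hF F' hF' => ?_
  have key : ∀ F ∈ MD G W, F = W := by
    intro F hF
    obtain ⟨h1, -, h3⟩ := mem_MD.1 hF
    refine h1.antisymm fun y hy => ?_
    by_contra hyF
    exact h3 y hy hyF (h.mono (insert_subset hy h1))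
  rw [key F hF, key F' hF']

/-- A triangle-free graph on three vertices that is not itself a dissociation set is a path. In the
upper bound this is where the core P_3 enters. -/
lemma good_three {W : Finset V} (ht : TF G) (hW : #W = 3) : Ext G W ∨ ph G W ≤ 1 := by
  by_cases hD : Diss G W
  · exact Or.inr (ph_le_one hD)
  rw [diss_iff] at hD
  push Not at hD
  obtain ⟨x, hx, y, hy, z, hz, hxy, hxz, hyz⟩ := hD
  have hWeq : W = {x, y, z} := by
    refine (eq_of_subset_of_card_le ?_ ?_).symm
    · intro t ht; simp only [mem_insert, mem_singleton] at ht
      rcases ht with rfl | rfl | rfl <;> assumption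
    · rw [hW, card_insert_of_notMem (by simp [hxy.ne, hxz.ne]), card_pair hyz]
  have hn : ¬ G.Adj y z := fun h => ht y z x h hxz.symm hxy.symm
  refine Or.inl (Or.inr ⟨{x}, {y, z}, ⟨by simpa, ?_, ?_, ?_⟩, ?_, ?_⟩)
  · intro t ht; simp only [mem_insert, mem_singleton] at ht
    rcases ht with rfl | rfl <;> assumption
  · intro t ht; rw [mem_singleton] at ht; subst ht
    ext u; rw [mem_nb, hWeq]; simp only [mem_insert, mem_singleton]
    constructor
    · rintro ⟨rfl | h | h, h'⟩
      · exact absurd h' (G.loopless.irrefl _)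
      · exact Or.inl h
      · exact Or.inr h
    · rintro (rfl | rfl)
      exacts [⟨by simp, hxy⟩, ⟨by simp, hxz⟩]
  · have aux : ∀ t s, (t = y ∧ s = z) ∨ (t = z ∧ s = y) → ∀ u, u ∈ W → G.Adj t u → u = x := by
      rintro t s h u hu htu
      rw [hWeq] at hu; simp only [mem_insert, mem_singleton] at hu
      rcases hu with rfl | rfl | rfl
      · rfl
      · rcases h with ⟨rfl, rfl⟩ | ⟨rfl, rfl⟩
        · exact absurd htu (G.loopless.irrefl _)
        · exact absurd htu.symm hn
      · rcases h with ⟨rfl, rfl⟩ | ⟨rfl, rfl⟩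
        · exact absurd htu hn
        · exact absurd htu (G.loopless.irrefl _)
    intro t ht; simp only [mem_insert, mem_singleton] at ht
    ext u; rw [mem_nb, mem_singleton]
    constructor
    · rintro ⟨hu, htu⟩
      rcases ht with rfl | rfl
      · exact aux t z (by simp) u hu htu
      · exact aux t y (by simp) u hu htu
    · rintro rfl
      rcases ht with rfl | rfl
      exacts [⟨hx, hxy.symm⟩, ⟨hx, hxz.symm⟩]
  · rw [card_singleton, card_pair hyz]; unfold Core; omega
  · rw [show W \ ({x} ∪ {y, z}) = ∅ by rw [hWeq]; ext; simp; clear * -; tauto]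
    exact C4s.nil

lemma good_noC4 {W : Finset V} (ht : TF G) (hc : NoC4 G W) : Good G W := by
  have hB := noC4_le ht W hc
  by_cases h4 : 4 ≤ #W
  · exact Good.of_lt (hB.trans_lt (Bz_lt_Kz (by omega)))
  have h : #W = 0 ∨ #W = 1 ∨ #W = 2 ∨ #W = 3 := by omega
  rcases h with h | h | h | h
  · rw [h] at hB
    refine ⟨by rw [h]; norm_num [Bz, Fz, quad] at hB ⊢; exact hB, Or.inl (Or.inl ?_)⟩
    rw [card_eq_zero.1 h]; exact C4s.nil
  · refine Good.of_lt ?_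
    rw [h] at hB ⊢
    norm_num [Bz, Kz, quad] at hB ⊢
    have : (ph G W : ℚ) ≤ 1 := by exact_mod_cast hB
    linarith
  · refine Good.of_lt ?_
    rw [h] at hB ⊢
    norm_num [Bz, Kz, quad] at hB ⊢
    have : (ph G W : ℚ) ≤ 1 := by exact_mod_cast hB
    linarith
  · refine ⟨?_, (good_three ht h).imp_right fun h1 => ?_⟩
    · rw [h] at hB ⊢
      norm_num [Bz, Fz, quad] at hB ⊢
      exact hB
    · have : (ph G W : ℚ) ≤ 1 := by exact_mod_cast h1
      rw [h]
      norm_num [Kz, quad]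
      linarith

/-- Each exclusion prepares the next: leaves at four-cycles, then two adjacent vertices of degree
two on one, then two opposite ones, then a single one. What is left is heavy. -/
theorem good (ht : TF G) (W : Finset V) : Good G W := by
  induction W using Finset.strongInduction with
  | H W ih =>
    have hI : IH G W := ih
    by_cases hc : NoC4 G W
    · exact good_noC4 ht hc
    have hC4 : ∃ v a w b, IsC4 G W v a w b := by
      unfold NoC4 at hc
      push Not at hc
      obtain ⟨v, hv, w, hw, a, ha, b, hb, hvw, h1, h2, h3, h4, hab⟩ := hc
      exact ⟨v, a, w, b, hv, ha, hw, hb, h1, h3, h2, h4, hvw, hab⟩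
    by_cases hnl : NoLeaf G W
    swap
    · unfold NoLeaf at hnl
      push Not at hnl
      obtain ⟨v, a, w, b, h, x, hx, h1⟩ := hnl
      exact Good.of_lt (h.lt_of_leaf hI.bdd ht hx (by omega))
    by_cases h2 : ∃ v a w b, IsC4 G W v a w b ∧ #(nb G W w) = 2 ∧ #(nb G W b) = 2
    · obtain ⟨v, a, w, b, h, hw, hb⟩ := h2
      exact h.good_deg_two hI ht hnl hw hb
    push Not at h2
    by_cases hno : NoOpposite G W
    swap
    · unfold NoOpposite at hno
      push Not at hno
      obtain ⟨v, a, w, b, h, ha, hb⟩ := hno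
      exact h.good_opposite hI ht hnl ha hb (fun e => h2 _ _ _ _ h.flip e hb) (fun e => h2 _ _ _ _ h e hb)
    by_cases hH : Heavy G W
    · obtain ⟨v, a, w, b, h⟩ := hC4
      exact heavy_good hI ht hH h
    · unfold Heavy at hH
      push Not at hH
      obtain ⟨b, v, a, w, h, hb⟩ := hH
      have hb2 : #(nb G W b) = 2 := by have := h.two_le; omega
      have h' : IsC4 G W v a w b := h.rot.flip'
      exact Good.of_lt (h'.good_one hI ht hnl hno hb2 (fun e => h2 _ _ _ _ h'.flip e hb2)
        (fun e => h2 _ _ _ _ h' e hb2) (fun e => hno _ _ _ _ h' e hb2))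

/-! ### Translation to the original definitions -/

lemma isDissociationSet_iff {F : Finset V} : IsDissociationSet G F ↔ Diss G F := by
  classical
  unfold IsDissociationSet
  rw [diss_iff]
  -- Quantifying over the instances makes the equivalence independent of the classical ones used in
  -- `IsDissociationSet`.
  have h1 : ∀ (_ : Fintype (F : Set V)) (_ : DecidableRel (G.induce (F : Set V)).Adj),
      ((G.induce (F : Set V)).maxDegree ≤ 1 ↔ ∀ v, (G.induce (F : Set V)).degree v ≤ 1) := by
    intro _ _
    exact ⟨fun h v => ((G.induce (F : Set V)).degree_le_maxDegree v).trans h,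
      fun h => (G.induce (F : Set V)).maxDegree_le_of_forall_degree_le _ h⟩
  refine Iff.trans (h1 _ _) ?_
  constructor
  · intro h x hx y hy z hz hxy hxz
    have := card_le_one.1 (h ⟨x, hx⟩) ⟨y, hy⟩ (by simpa using hxy) ⟨z, hz⟩ (by simpa using hxz)
    simpa using this
  · rintro h ⟨x, hx⟩
    refine card_le_one.2 ?_
    rintro ⟨y, hy⟩ hy' ⟨z, hz⟩ hz'
    simp only [SimpleGraph.mem_neighborFinset, SimpleGraph.comap_adj, Function.Embedding.subtype_apply] at hy' hz'
    exact Subtype.ext (h x hx y hy z hz hy' hz')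

/-- Dissociation is hereditary, so maximality under inclusion can be tested by adding single
vertices. -/
lemma phi_eq [Fintype V] : phi G = ph G univ := by
  unfold phi ph
  rw [← Set.ncard_coe_finset]
  congr 1
  ext F
  simp only [maximalDissociationSets, Set.mem_ofPred_eq, mem_coe, mem_MD, subset_univ, true_and, mem_univ,
    forall_true_left]
  constructor
  · rintro ⟨h1, h2⟩
    refine ⟨isDissociationSet_iff.1 h1, fun y hy hD => hy ?_⟩
    exact h2 (isDissociationSet_iff.2 hD) (subset_insert _ _) (mem_insert_self _ _)
  · rintro ⟨h1, h2⟩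
    refine ⟨isDissociationSet_iff.2 h1, fun F' hF' hle y hy => ?_⟩
    by_contra hyF
    exact h2 y hyF ((isDissociationSet_iff.1 hF').mono (insert_subset hy hle))

/-! ### Extremal graphs attain the bound -/

/-- Maximal dissociation sets of a union of components. -/
lemma ph_mul_le {U W : Finset V} (hU : U ⊆ W) (hcl : ∀ x ∈ U, ∀ y ∈ W, G.Adj x y → y ∈ U) :
    ph G U * ph G (W \ U) ≤ ph G W := by
  unfold ph
  rw [← card_product]
  refine card_le_card_of_injOn (fun p => p.1 ∪ p.2) ?_ ?_
  · rintro ⟨F, F'⟩ h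
    obtain ⟨hF, hF'⟩ := mem_product.1 h
    obtain ⟨a1, a2, a3⟩ := mem_MD.1 hF
    obtain ⟨b1, b2, b3⟩ := mem_MD.1 hF'
    simp only at *
    have hcl' : ∀ x ∈ W \ U, ∀ y ∈ W, G.Adj x y → y ∈ W \ U := fun x hx y hy hxy =>
      mem_sdiff.2 ⟨hy, fun hyU => (mem_sdiff.1 hx).2 (hcl y hyU x (mem_sdiff.1 hx).1 hxy.symm)⟩
    have hb : ∀ x ∈ F', x ∉ U := fun x hx => (mem_sdiff.1 (b1 hx)).2
    refine mem_MD.2 ⟨union_subset (a1.trans hU) (b1.trans sdiff_subset), diss_iff.2 ?_, ?_⟩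
    · intro x hx y hy z hz hxy hxz
      have hW : ∀ t ∈ F ∪ F', t ∈ W := fun t ht =>
        (union_subset (a1.trans hU) (b1.trans sdiff_subset)) ht
      have inF : ∀ t ∈ F ∪ F', t ∈ U → t ∈ F := fun t ht htU =>
        (mem_union.1 ht).resolve_right fun h => hb t h htU
      have inF' : ∀ t ∈ F ∪ F', t ∉ U → t ∈ F' := fun t ht htU =>
        (mem_union.1 ht).resolve_left fun h => htU (a1 h)
      rcases mem_union.1 hx with hx | hx
      · exact a2.eq hx (inF y hy (hcl x (a1 hx) y (hW y hy) hxy))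
          (inF z hz (hcl x (a1 hx) z (hW z hz) hxz)) hxy hxz
      · exact b2.eq hx (inF' y hy (mem_sdiff.1 (hcl' x (b1 hx) y (hW y hy) hxy)).2)
          (inF' z hz (mem_sdiff.1 (hcl' x (b1 hx) z (hW z hz) hxz)).2) hxy hxz
    · intro y hy hyF hD
      rw [mem_union, not_or] at hyF
      by_cases hyU : y ∈ U
      · exact a3 y hyU hyF.1 (hD.mono (insert_subset_insert _ subset_union_left))
      · exact b3 y (mem_sdiff.2 ⟨hy, hyU⟩) hyF.2 (hD.mono (insert_subset_insert _ subset_union_right))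
  · rintro ⟨F, F'⟩ h ⟨E, E'⟩ h' heq
    obtain ⟨hF, hF'⟩ := mem_product.1 h
    obtain ⟨hE, hE'⟩ := mem_product.1 h'
    have aux : ∀ F F' : Finset V, F ∈ MD G U → F' ∈ MD G (W \ U) →
        F = (F ∪ F') ∩ U ∧ F' = (F ∪ F') \ U := by
      intro F F' hF hF'
      have h1 := MD_sub hF
      have h2 := MD_sub hF'
      constructor
      · ext z; simp only [mem_inter, mem_union]
        exact ⟨fun h => ⟨Or.inl h, h1 h⟩, fun h => h.1.resolve_right fun h' => (mem_sdiff.1 (h2 h')).2 h.2⟩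
      · ext z; simp only [mem_sdiff, mem_union]
        exact ⟨fun h => ⟨Or.inr h, (mem_sdiff.1 (h2 h)).2⟩, fun h => h.1.resolve_left fun h' => h.2 (h1 h')⟩
    obtain ⟨e1, e2⟩ := aux F F' hF hF'
    obtain ⟨e3, e4⟩ := aux E E' hE hE'
    simp only at heq
    rw [Prod.mk.injEq]
    exact ⟨by rw [e1, e3, heq], by rw [e2, e4, heq]⟩

lemma Comp.not_adj {W A B : Finset V} (h : Comp G W A B) {x y : V} (hx : x ∈ A) (hy : y ∈ A) :
    ¬ G.Adj x y := fun hxy => by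
  have : y ∈ nb G W x := mem_nb.2 ⟨h.1 hy, hxy⟩
  rw [h.2.2.1 x hx] at this
  exact disjoint_left.1 h.disjoint hy this

lemma Comp.pair_mem {W A B : Finset V} (h : Comp G W A B) {x y : V} (hx : x ∈ A) (hy : y ∈ B) :
    {x, y} ∈ MD G (A ∪ B) := by
  have hxy := h.adj hx hy
  refine mem_MD.2 ⟨?_, diss_iff.2 ?_, ?_⟩
  · intro z hz; simp only [mem_insert, mem_singleton] at hz
    rcases hz with rfl | rfl <;> simp [hx, hy]
  · intro r hr s hs t ht hrs hrt
    simp only [mem_insert, mem_singleton] at hr hs ht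
    rcases hr with rfl | rfl <;> rcases hs with rfl | rfl <;> rcases ht with rfl | rfl <;>
    first | rfl | exact absurd rfl hrs.ne | exact absurd rfl hrt.ne
  · intro z hz hzn hD
    simp only [mem_insert, mem_singleton, not_or] at hzn
    rcases mem_union.1 hz with hz | hz
    · exact hzn.1 (hD.eq (x := y) (by simp) (by simp) (by simp) (h.adj hz hy).symm hxy.symm)
    · exact hzn.2 (hD.eq (x := x) (by simp) (by simp) (by simp) (h.adj hx hz) hxy)

lemma Comp.part_mem {W A B : Finset V} (h : Comp G W A B) (hB : 2 ≤ #B) : B ∈ MD G (A ∪ B) := by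
  refine mem_MD.2 ⟨subset_union_right, diss_iff.2 ?_, ?_⟩
  · intro x hx y hy z _ hxy
    exact absurd hxy (h.symm.not_adj hx hy)
  · intro z hz hzn hD
    have hzA := (mem_union.1 hz).resolve_right hzn
    obtain ⟨x, hx⟩ := card_pos.1 (show 0 < #B by omega)
    obtain ⟨y, hy, hyx⟩ := card_two_le_exists hB x
    exact hyx (hD.eq (x := z) (by simp) (by simp [hy]) (by simp [hx]) (h.adj hzA hy) (h.adj hzA hx))

/-- The sets are the edges, the part `B`, and also `A` if it has at least two vertices. A part
consisting of one vertex is contained in an edge and is not maximal, which gives 3 for a path on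
three vertices. -/
lemma Comp.le_ph {W A B : Finset V} (h : Comp G W A B) (hA : 1 ≤ #A) (hB : 2 ≤ #B) :
    (#A * #B + 1 + if 2 ≤ #A then 1 else 0) * ph G (W \ (A ∪ B)) ≤ ph G W := by
  refine le_trans (Nat.mul_le_mul_right _ ?_) (ph_mul_le h.sub fun x hx y hy => h.closed hx hy)
  have hd := disjoint_left.1 h.disjoint
  have hP : #((A ×ˢ B).image fun p => ({p.1, p.2} : Finset V)) = #A * #B := by
    rw [card_image_of_injOn, card_product]
    rintro ⟨x, y⟩ hxy ⟨x', y'⟩ hxy' heq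
    obtain ⟨h1, h2⟩ := mem_product.1 hxy
    obtain ⟨h3, h4⟩ := mem_product.1 hxy'
    simp only at heq h1 h2 h3 h4
    have e1 : x ∈ ({x', y'} : Finset V) := heq ▸ mem_insert_self _ _
    have e2 : y ∈ ({x', y'} : Finset V) := heq ▸ (by simp)
    simp only [mem_insert, mem_singleton] at e1 e2
    have e3 := e1.resolve_right fun e => hd h1 (e ▸ h4)
    have e4 := e2.resolve_left fun e => hd h3 (e ▸ h2)
    rw [e3, e4]
  set P := (A ×ˢ B).image fun p => ({p.1, p.2} : Finset V)
  have hPm : ∀ F ∈ P, F ∈ MD G (A ∪ B) ∧ F ≠ A ∧ F ≠ B := by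
    intro F hF
    obtain ⟨⟨x, y⟩, hxy, rfl⟩ := mem_image.1 hF
    obtain ⟨hx, hy⟩ := mem_product.1 hxy
    refine ⟨h.pair_mem hx hy, fun e => hd (e ▸ (by simp) : y ∈ A) hy, fun e => hd hx (e ▸ (by simp) : x ∈ B)⟩
  have hBP : B ∉ P := fun hB => (hPm B hB).2.2 rfl
  split_ifs with h2
  · have hAP : A ∉ insert B P := by
      rw [mem_insert, not_or]
      refine ⟨fun e => ?_, fun hA => (hPm A hA).2.1 rfl⟩
      obtain ⟨x, hx⟩ := card_pos.1 hA
      exact hd hx (e ▸ hx)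
    rw [← hP, ← card_insert_of_notMem hBP, ← card_insert_of_notMem hAP]
    refine card_le_card fun F hF => ?_
    rcases mem_insert.1 hF with rfl | hF
    · have := h.symm.part_mem h2
      rwa [union_comm] at this
    rcases mem_insert.1 hF with rfl | hF
    · exact h.part_mem hB
    · exact (hPm F hF).1
  · rw [← hP, Nat.add_zero, ← card_insert_of_notMem hBP]
    refine card_le_card fun F hF => ?_
    rcases mem_insert.1 hF with rfl | hF
    · exact h.part_mem hB
    · exact (hPm F hF).1

lemma C4s.le_ph {W : Finset V} (h : C4s G W) : Fz #W ≤ ph G W := by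
  induction h with
  | nil =>
    have : ∅ ∈ MD G (∅ : Finset V) := mem_MD.2 ⟨le_rfl, by simp [Diss], by simp⟩
    have : 1 ≤ ph G ∅ := card_pos.2 ⟨_, this⟩
    norm_num [Fz, quad]
    exact this
  | @step W A B hc ha hb _ ih =>
    have h1 := hc.le_ph (by omega) (by omega)
    rw [ha, hb] at h1
    have h2 : (6 : ℚ) * ph G (W \ (A ∪ B)) ≤ ph G W := by exact_mod_cast h1
    have hn := hc.card
    rw [show (#(W \ (A ∪ B)) : ℤ) = #W - 4 by omega] at ih
    have := (Fz_four #W).1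
    linarith

lemma core_value (n : ℤ) : (n % 4 = 3 → 3 * Fz (n - 3) = Fz n) ∧ (n % 4 = 1 → 8 * Fz (n - 5) = Fz n) ∧
    (n % 4 = 2 → 11 * Fz (n - 6) = Fz n) := by
  obtain ⟨s, hs, hc⟩ := quad_cases n
  simp only [Fz, quad_far n]
  rcases hc with hc | hc | hc | hc <;> simp only [hc] <;>
    refine ⟨?_, ?_, ?_⟩ <;> norm_num <;> ring

lemma Ext.le_ph {W : Finset V} (h : Ext G W) : Fz #W ≤ ph G W := by
  rcases h with h | ⟨A, B, hc, hcore, h⟩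
  · exact h.le_ph
  have h4 := h.card
  have hn := hc.card
  have ih := h.le_ph
  obtain ⟨e1, e2, e3⟩ := core_value #W
  rcases hcore with ⟨ha, hb⟩ | ⟨ha, hb⟩ | ⟨ha, hb⟩
  · have h1 := hc.le_ph (by omega) (by omega)
    rw [ha, hb] at h1
    have h2 : (3 : ℚ) * ph G (W \ (A ∪ B)) ≤ ph G W := by exact_mod_cast h1
    rw [show (#(W \ (A ∪ B)) : ℤ) = #W - 3 by omega] at ih
    linarith [e1 (by omega)]
  · have h1 := hc.le_ph (by omega) (by omega)
    rw [ha, hb] at h1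
    have h2 : (8 : ℚ) * ph G (W \ (A ∪ B)) ≤ ph G W := by exact_mod_cast h1
    rw [show (#(W \ (A ∪ B)) : ℤ) = #W - 5 by omega] at ih
    linarith [e2 (by omega)]
  · have h1 := hc.le_ph (by omega) (by omega)
    rw [ha, hb] at h1
    have h2 : (11 : ℚ) * ph G (W \ (A ∪ B)) ≤ ph G W := by exact_mod_cast h1
    rw [show (#(W \ (A ∪ B)) : ℤ) = #W - 6 by omega] at ih
    linarith [e3 (by omega)]

/-! ### From components to isomorphisms with the extremal graphs -/

/-- The graph induced on `W` is isomorphic to `H`. -/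
def Model {V X : Type*} (G : SimpleGraph V) (W : Finset V) (H : SimpleGraph X) : Prop :=
  ∃ f : X → V, Function.Injective f ∧ (∀ v, v ∈ W ↔ ∃ x, f x = v) ∧ ∀ x y, G.Adj (f x) (f y) ↔ H.Adj x y

section
variable {X Y : Type*} {H : SimpleGraph X} {H' : SimpleGraph Y} {W : Finset V}

lemma Model.trans {V : Type*} {G : SimpleGraph V} {W : Finset V} (h : Model G W H) (e : H ≃g H') : Model G W H' := by
  obtain ⟨f, h1, h2, h3⟩ := h
  refine ⟨f ∘ e.symm, h1.comp e.symm.injective, fun v => ?_, fun x y => ?_⟩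
  · rw [h2]
    exact ⟨fun ⟨x, hx⟩ => ⟨e x, by simp [hx]⟩, fun ⟨y, hy⟩ => ⟨e.symm y, hy⟩⟩
  · rw [Function.comp_apply, Function.comp_apply, h3, e.symm.map_adj_iff]

lemma model_univ_iff [Fintype V] : Model G univ H ↔ Nonempty (G ≃g H) := by
  constructor
  · rintro ⟨f, h1, h2, h3⟩
    exact ⟨(⟨Equiv.ofBijective f ⟨h1, fun v => (h2 v).1 (mem_univ v)⟩, @fun x y => h3 x y⟩ : H ≃g G).symm⟩
  · rintro ⟨e⟩
    exact ⟨e.symm, e.symm.injective, fun v => ⟨fun _ => ⟨e v, by simp⟩, fun _ => mem_univ v⟩,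
      fun x y => e.symm.map_adj_iff⟩

lemma Model.card [Fintype X] (h : Model G W H) : #W = Fintype.card X := by
  obtain ⟨f, h1, h2, h3⟩ := h
  rw [← card_univ, ← card_image_of_injective univ h1]
  congr 1
  ext v; simp [h2]

lemma model_of_comp {A B : Finset V} {a b : ℕ} (hc : Comp G W A B) (ha : #A = a) (hb : #B = b)
    (h : Model G (W \ (A ∪ B)) H) :
    Model G W (completeBipartiteGraph (Fin a) (Fin b) ⊕g H) := by
  obtain ⟨f, h1, h2, h3⟩ := h
  have hf : ∀ x, f x ∈ W ∧ f x ∉ A ∪ B := fun x => mem_sdiff.1 ((h2 _).2 ⟨x, rfl⟩)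
  let eA := (A.equivFinOfCardEq ha).symm
  let eB := (B.equivFinOfCardEq hb).symm
  have hA : ∀ i, (eA i : V) ∈ A := fun i => (eA i).2
  have hB : ∀ i, (eB i : V) ∈ B := fun i => (eB i).2
  have hAB : ∀ i j, (eA i : V) ≠ eB j := fun i j e => disjoint_left.1 hc.disjoint (hA i) (e ▸ hB j)
  have hAf : ∀ i x, (eA i : V) ≠ f x := fun i x e => (hf x).2 (e ▸ mem_union_left _ (hA i))
  have hBf : ∀ i x, (eB i : V) ≠ f x := fun i x e => (hf x).2 (e ▸ mem_union_right _ (hB i))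
  have nA : ∀ i x, ¬ G.Adj (eA i) (f x) := fun i x e =>
    (hf x).2 (hc.closed (mem_union_left _ (hA i)) (hf x).1 e)
  have nB : ∀ i x, ¬ G.Adj (eB i) (f x) := fun i x e =>
    (hf x).2 (hc.closed (mem_union_right _ (hB i)) (hf x).1 e)
  refine ⟨Sum.elim (Sum.elim (fun i => (eA i : V)) fun i => (eB i : V)) f, ?_, ?_, ?_⟩
  · refine Function.Injective.sumElim (Function.Injective.sumElim
      (Subtype.val_injective.comp eA.injective) (Subtype.val_injective.comp eB.injective) hAB) h1 ?_
    rintro (i | i) x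
    exacts [hAf i x, hBf i x]
  · intro v
    constructor
    · intro hv
      by_cases hvA : v ∈ A
      · exact ⟨Sum.inl (Sum.inl (eA.symm ⟨v, hvA⟩)), by simp⟩
      by_cases hvB : v ∈ B
      · exact ⟨Sum.inl (Sum.inr (eB.symm ⟨v, hvB⟩)), by simp⟩
      obtain ⟨x, hx⟩ := (h2 v).1 (by simp [hv, hvA, hvB])
      exact ⟨Sum.inr x, hx⟩
    · rintro ⟨(i | i) | x, rfl⟩
      exacts [hc.1 (hA i), hc.2.1 (hB i), (hf x).1]
  · rintro ((i | i) | x) ((j | j) | y)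
    · simpa using hc.not_adj (hA i) (hA j)
    · simpa using hc.adj (hA i) (hB j)
    · simpa using nA i y
    · simpa using (hc.adj (hA j) (hB i)).symm
    · simpa using hc.symm.not_adj (hB i) (hB j)
    · simpa using nB i y
    · simpa using fun h => nA j x h.symm
    · simpa using fun h => nB j x h.symm
    · simpa using h3 x y

lemma Model.comp {a b : ℕ} (h : Model G W (completeBipartiteGraph (Fin a) (Fin b) ⊕g H)) :
    ∃ A B, Comp G W A B ∧ #A = a ∧ #B = b ∧ Model G (W \ (A ∪ B)) H := by
  obtain ⟨f, h1, h2, h3⟩ := h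
  have hW : ∀ x, f x ∈ W := fun x => (h2 _).2 ⟨x, rfl⟩
  have mA : ∀ v, v ∈ univ.image (fun i : Fin a => f (Sum.inl (Sum.inl i))) ↔
      ∃ i, f (Sum.inl (Sum.inl i)) = v := by simp
  have mB : ∀ v, v ∈ univ.image (fun i : Fin b => f (Sum.inl (Sum.inr i))) ↔
      ∃ i, f (Sum.inl (Sum.inr i)) = v := by simp
  refine ⟨univ.image fun i => f (Sum.inl (Sum.inl i)), univ.image fun i => f (Sum.inl (Sum.inr i)),
    ⟨?_, ?_, ?_, ?_⟩, ?_, ?_, ?_⟩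
  · intro v hv; obtain ⟨i, rfl⟩ := (mA v).1 hv; exact hW _
  · intro v hv; obtain ⟨i, rfl⟩ := (mB v).1 hv; exact hW _
  · intro v hv; obtain ⟨i, rfl⟩ := (mA v).1 hv
    ext y
    rw [mem_nb, mB]
    constructor
    · rintro ⟨hy, hadj⟩
      obtain ⟨(j | j) | x, rfl⟩ := (h2 y).1 hy <;> rw [h3] at hadj
      · simp at hadj
      · exact ⟨j, rfl⟩
      · simp at hadj
    · rintro ⟨j, rfl⟩
      exact ⟨hW _, (h3 _ _).2 (by simp)⟩
  · intro v hv; obtain ⟨i, rfl⟩ := (mB v).1 hv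
    ext y
    rw [mem_nb, mA]
    constructor
    · rintro ⟨hy, hadj⟩
      obtain ⟨(j | j) | x, rfl⟩ := (h2 y).1 hy <;> rw [h3] at hadj
      · exact ⟨j, rfl⟩
      · simp at hadj
      · simp at hadj
    · rintro ⟨j, rfl⟩
      exact ⟨hW _, (h3 _ _).2 (by simp)⟩
  · exact (card_image_of_injective _ (h1.comp (Sum.inl_injective.comp Sum.inl_injective))).trans (by simp)
  · exact (card_image_of_injective _ (h1.comp (Sum.inl_injective.comp Sum.inr_injective))).trans (by simp)
  · refine ⟨fun x => f (Sum.inr x), h1.comp Sum.inr_injective, fun v => ?_, fun x y => by simp [h3]⟩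
    rw [mem_sdiff, mem_union, mA, mB, h2]
    constructor
    · rintro ⟨⟨(i | i) | x, rfl⟩, hn⟩
      · exact absurd (Or.inl ⟨i, rfl⟩) hn
      · exact absurd (Or.inr ⟨i, rfl⟩) hn
      · exact ⟨x, rfl⟩
    · rintro ⟨x, rfl⟩
      refine ⟨⟨_, rfl⟩, ?_⟩
      rintro (⟨i, hi⟩ | ⟨i, hi⟩) <;> simpa using h1 hi

end

/-- Splitting off one copy. -/
def copiesSucc {X : Type*} (k : ℕ) (H : SimpleGraph X) : copies (k + 1) H ≃g H ⊕g copies k H where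
  toFun p := Fin.cases (Sum.inl p.2) (fun i => Sum.inr (i, p.2)) p.1
  invFun := Sum.elim (fun x => (0, x)) fun p => (p.1.succ, p.2)
  left_inv := by
    rintro ⟨i, x⟩
    induction i using Fin.cases <;> simp
  right_inv := by rintro (x | ⟨i, x⟩) <;> simp
  map_rel_iff' := by
    rintro ⟨i, x⟩ ⟨j, y⟩
    induction i using Fin.cases <;> induction j using Fin.cases <;> simp [copies, Fin.succ_ne_zero, (Fin.succ_ne_zero _).symm]

def cycleFourIso : SimpleGraph.cycleGraph 4 ≃g completeBipartiteGraph (Fin 2) (Fin 2) where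
  toFun := ![Sum.inl 0, Sum.inr 0, Sum.inl 1, Sum.inr 1]
  invFun := Sum.elim ![0, 2] ![1, 3]
  left_inv := by decide
  right_inv := by decide
  map_rel_iff' := by
    intro a b
    fin_cases a <;> fin_cases b <;> simp [SimpleGraph.cycleGraph_adj] <;> decide

def pathThreeIso : SimpleGraph.pathGraph 3 ≃g completeBipartiteGraph (Fin 1) (Fin 2) where
  toFun := ![Sum.inr 0, Sum.inl 0, Sum.inr 1]
  invFun := Sum.elim ![1] ![0, 2]
  left_inv := by decide
  right_inv := by decide
  map_rel_iff' := by
    intro a b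
    fin_cases a <;> fin_cases b <;> simp [SimpleGraph.pathGraph_adj]

lemma C4s.model {W : Finset V} (h : C4s G W) : ∃ k, Model G W (copies k (SimpleGraph.cycleGraph 4)) := by
  induction h with
  | nil => exact ⟨0, fun p => p.1.elim0, fun p => p.1.elim0, by simp, fun p => p.1.elim0⟩
  | step hc ha hb _ ih =>
    obtain ⟨k, ih⟩ := ih
    refine ⟨k + 1, (model_of_comp hc ha hb ih).trans ?_⟩
    exact (SimpleGraph.Iso.sumCongr cycleFourIso.symm SimpleGraph.Iso.refl).trans (copiesSucc k _).symm

lemma c4s_of_model {W : Finset V} {k : ℕ} (h : Model G W (copies k (SimpleGraph.cycleGraph 4))) : C4s G W := by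
  induction k generalizing W with
  | zero =>
    obtain ⟨f, -, h2, -⟩ := h
    have : W = ∅ := eq_empty_iff_forall_notMem.2 fun v hv => by
      obtain ⟨p, -⟩ := (h2 v).1 hv; exact p.1.elim0
    rw [this]; exact C4s.nil
  | succ k ih =>
    obtain ⟨A, B, hc, ha, hb, h⟩ := (h.trans ((copiesSucc k _).trans
      (SimpleGraph.Iso.sumCongr cycleFourIso SimpleGraph.Iso.refl))).comp
    exact C4s.step hc ha hb (ih h)

lemma Ext.mem {W : Finset V} (h : Ext G W) {v : V} (hv : v ∈ W) : ∃ A B, Comp G W A B ∧ v ∈ A := by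
  rcases h with h | ⟨A, B, hc, -, h⟩
  · obtain ⟨A, B, hc, -, -, hv⟩ := h.mem hv
    exact ⟨A, B, hc, hv⟩
  by_cases hvA : v ∈ A
  · exact ⟨A, B, hc, hvA⟩
  by_cases hvB : v ∈ B
  · exact ⟨B, A, hc.symm, hvB⟩
  obtain ⟨A', B', hc', -, -, hv'⟩ := h.mem (mem_sdiff.2 ⟨hv, by simp [hvA, hvB]⟩)
  exact ⟨A', B', hc.lift hc', hv'⟩

/-- Every vertex lies in a complete bipartite component, so its neighbours are pairwise nonadjacent.
This makes the extremal graph an admissible witness for the maximum. -/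
lemma Ext.tf [Fintype V] (h : Ext G univ) : TF G := by
  intro x y z hxy hyz hxz
  obtain ⟨A, B, hc, hx⟩ := h.mem (mem_univ x)
  have hy : y ∈ B := by rw [← hc.2.2.1 x hx]; exact mem_nb.2 ⟨mem_univ _, hxy⟩
  have hz : z ∈ B := by rw [← hc.2.2.1 x hx]; exact mem_nb.2 ⟨mem_univ _, by simpa using hxz⟩
  exact hc.symm.not_adj hy hz hyz

lemma cliqueFree_three_iff : G.CliqueFree 3 ↔ TF G := by
  constructor
  · intro h x y z hxy hyz hxz
    exact h {x, y, z} (SimpleGraph.is3Clique_triple_iff.2 ⟨hxy, hxz, hyz⟩)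
  · intro h s hs
    obtain ⟨x, y, z, hxy, hxz, hyz, -⟩ := SimpleGraph.is3Clique_iff.1 hs
    exact h x y z hxy hyz hxz

lemma ext_iff_copies [Fintype V] {t : ℕ} (hn : Fintype.card V = 4 * t) :
    Ext G univ ↔ Nonempty (G ≃g copies t (SimpleGraph.cycleGraph 4)) := by
  rw [← model_univ_iff]
  constructor
  · intro h
    obtain ⟨k, hk⟩ := (h.c4s (by rw [card_univ]; omega)).model
    have hc := hk.card
    simp only [card_univ, Fintype.card_prod, Fintype.card_fin] at hc
    obtain rfl : k = t := by omega
    exact hk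
  · exact fun h => Or.inl (c4s_of_model h)

lemma ext_iff_core [Fintype V] {a b t : ℕ} (hab : Core a b) (hn : Fintype.card V = a + b + 4 * t) :
    Ext G univ ↔
      Nonempty (G ≃g completeBipartiteGraph (Fin a) (Fin b) ⊕g copies t (SimpleGraph.cycleGraph 4)) := by
  rw [← model_univ_iff]
  constructor
  · intro h
    obtain ⟨A, B, hc, ha, hb, hC⟩ := h.core hab (by rw [card_univ]; omega)
    obtain ⟨k, hk⟩ := hC.model
    have h1 := hk.card
    have h2 := hc.card
    simp only [card_univ, Fintype.card_prod, Fintype.card_fin] at h1 h2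
    obtain rfl : k = t := by omega
    exact model_of_comp hc ha hb hk
  · intro h
    obtain ⟨A, B, hc, rfl, rfl, hC⟩ := h.comp
    exact Or.inr ⟨A, B, hc, hab, c4s_of_model hC⟩

/-- As `Kz` never exceeds `Fz`, a graph attaining `Fz` cannot satisfy the strict alternative of
`Good` and must be extremal. -/
lemma phi_eq_iff [Fintype V] (ht : TF G) {N : ℕ} (hN : (N : ℚ) = Fz (Fintype.card V)) :
    phi G ≤ N ∧ (phi G = N ↔ Ext G univ) := by
  obtain ⟨h1, h2⟩ := good ht univ
  rw [card_univ, ← hN] at h1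
  have hle : ph G univ ≤ N := by exact_mod_cast h1
  rw [phi_eq]
  refine ⟨hle, fun h => ?_, fun h => ?_⟩
  · refine h2.resolve_right fun hlt => ?_
    have := hlt.trans_le (Kz_le_Fz _)
    rw [card_univ, ← hN, h] at this
    exact lt_irrefl _ this
  · have := h.le_ph
    rw [card_univ, ← hN] at this
    exact hle.antisymm (by exact_mod_cast this)

theorem phi_extremal {V : Type*} [Fintype V] {X : Type*} [Fintype X] (H : SimpleGraph X) (N : ℕ)
    (hN : (N : ℚ) = Fz (Fintype.card V)) (hX : Fintype.card X = Fintype.card V)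
    (hH : ∀ (G : SimpleGraph V) [DecidableEq V] [DecidableRel G.Adj],
      Ext G univ ↔ Nonempty (G ≃g H)) :
    IsGreatest (triangleFreePhiValues V) N ∧
      ∀ G : SimpleGraph V, G.CliqueFree 3 → (phi G = N ↔ Nonempty (G ≃g H)) := by
  classical
  refine ⟨⟨?_, ?_⟩, fun G hG => ?_⟩
  · let e : V ≃ X := Fintype.equivOfCardEq hX.symm
    have hE : Ext (H.comap e) univ := (hH _).2 ⟨SimpleGraph.Iso.comap e H⟩
    exact ⟨H.comap e, cliqueFree_three_iff.2 hE.tf, (phi_eq_iff hE.tf hN).2.2 hE⟩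
  · rintro m ⟨G, hG, rfl⟩
    exact (phi_eq_iff (cliqueFree_three_iff.1 hG) hN).1
  · rw [(phi_eq_iff (cliqueFree_three_iff.1 hG) hN).2, hH]

end DissociationSets

open DissociationSets SimpleGraph in
theorem theorem5p2 (V : Type*) [Fintype V] (t : ℕ) (ht : 1 ≤ t) :
    (Fintype.card V = 4 * t →
      IsGreatest (triangleFreePhiValues V) (6 ^ t) ∧
      ∀ G : SimpleGraph V, G.CliqueFree 3 →
        (phi G = 6 ^ t ↔ Nonempty (G ≃g copies t (cycleGraph 4)))) ∧
    (Fintype.card V = 4 * t + 1 →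
      IsGreatest (triangleFreePhiValues V) (8 * 6 ^ (t - 1)) ∧
      ∀ G : SimpleGraph V, G.CliqueFree 3 →
        (phi G = 8 * 6 ^ (t - 1) ↔
          Nonempty (G ≃g
            (completeBipartiteGraph (Fin 2) (Fin 3) ⊕g copies (t - 1) (cycleGraph 4))))) ∧
    (Fintype.card V = 4 * t + 2 →
      IsGreatest (triangleFreePhiValues V) (11 * 6 ^ (t - 1)) ∧
      ∀ G : SimpleGraph V, G.CliqueFree 3 →
        (phi G = 11 * 6 ^ (t - 1) ↔
          Nonempty (G ≃g
            (completeBipartiteGraph (Fin 3) (Fin 3) ⊕g copies (t - 1) (cycleGraph 4))))) ∧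
    (Fintype.card V = 4 * t + 3 →
      IsGreatest (triangleFreePhiValues V) (3 * 6 ^ t) ∧
      ∀ G : SimpleGraph V, G.CliqueFree 3 →
        (phi G = 3 * 6 ^ t ↔
          Nonempty (G ≃g (pathGraph 3 ⊕g copies t (cycleGraph 4))))) := by
  have hz : ∀ k : ℕ, ((6 : ℚ) ^ (k : ℤ)) = 6 ^ k := fun k => zpow_natCast 6 k
  obtain ⟨u, rfl⟩ : ∃ u, t = u + 1 := ⟨t - 1, by omega⟩
  rw [Nat.add_sub_cancel]
  refine ⟨fun h => ?_, fun h => ?_, fun h => ?_, fun h => ?_⟩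
  · refine phi_extremal _ _ ?_ (by simp [h, mul_comm]) fun G _ _ => ext_iff_copies h
    have e : ((4 * (u + 1) : ℕ) : ℤ) % 4 = 0 ∧ ((4 * (u + 1) : ℕ) : ℤ) / 4 = (u + 1 : ℕ) := by omega
    rw [h, Fz, quad, e.1, e.2, hz]
    push_cast
    norm_num
  · refine phi_extremal _ _ ?_ (by simp [h]; ring) fun G _ _ =>
      ext_iff_core (by unfold Core; omega) (by omega)
    have e : ((4 * (u + 1) + 1 : ℕ) : ℤ) % 4 = 1 ∧
      ((4 * (u + 1) + 1 : ℕ) : ℤ) / 4 = (u + 1 : ℕ) := by omega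
    rw [h, Fz, quad, e.1, e.2, hz]
    push_cast
    norm_num
    ring
  · refine phi_extremal _ _ ?_ (by simp [h]; ring) fun G _ _ =>
      ext_iff_core (by unfold Core; omega) (by omega)
    have e : ((4 * (u + 1) + 2 : ℕ) : ℤ) % 4 = 2 ∧
      ((4 * (u + 1) + 2 : ℕ) : ℤ) / 4 = (u + 1 : ℕ) := by omega
    rw [h, Fz, quad, e.1, e.2, hz]
    push_cast
    norm_num
    ring
  · refine phi_extremal _ _ ?_ (by simp [h]; ring) fun G _ _ =>
      (ext_iff_core (a := 1) (b := 2) (t := u + 1) (by unfold Core; omega) (by omega)).trans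
        ⟨fun ⟨e⟩ => ⟨e.trans (Iso.sumCongr pathThreeIso.symm Iso.refl)⟩,
          fun ⟨e⟩ => ⟨e.trans (Iso.sumCongr pathThreeIso Iso.refl)⟩⟩
    have e : ((4 * (u + 1) + 3 : ℕ) : ℤ) % 4 = 3 ∧
      ((4 * (u + 1) + 3 : ℕ) : ℤ) / 4 = (u + 1 : ℕ) := by omega
    rw [h, Fz, quad, e.1, e.2, hz]
    push_cast
    norm_num
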